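/- Let $\mathbb T$ be the unit circle with normalized arc length measure $m$ and let $0<p<1$. Let $H^p(\mathbb T)$ be the closure of the analytic polynomials in $L^p(\mathbb T)=L^p(\mathbb T,m)$. Let $\eta$ be an inner function on the unit disc $\mathbb D$ (analytic, $|\eta|\le 1$ on $\mathbb D$, with unimodular radial limits at almost every point of $\mathbb T$) such that $\eta(0)=0$, and let $\mathbb E(\cdot|\eta)$ denote the conditional expectation on $L^1(\mathbb T)$ with respect to the $\sigma$-algebra generated by the boundary function of $\eta$. For $X=H^p(\mathbb T)$ or $X=L^p(\mathbb T)$, call $\mathbb E(\cdot|\eta)$ bounded on $X$ if there is a bounded linear operator $T:X\to X$ with $Tf=\mathbb E(f|\eta)$ for all $f\in X\cap L^1(\mathbb T)$; such a $T$ is then unique, and $\|\mathbb E(\cdot|\eta)\|_X:=\sup\{\|Tf\|_p : f\in X,\ \|f\|_p=1\}$. Then $\mathbb E(\cdot|\eta)$ is bounded on $H^p(\mathbb T)$ if and only if $\eta$ is a finite Blaschke product, i.e. $\eta(z)=c\prod_{j=1}^n\frac{z-a_j}{1-\overline{a_j}z}$ on $\mathbb D$ with $|c|=1$ and $a_1,\dots,a_n\in\mathbb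 D$. In that case $\mathbb E(\cdot|\eta)$ is also bounded on $L^p(\mathbb T)$, and $$\|\mathbb E(\cdot|\eta)\|_{H^p}=\|\mathbb E(\cdot|\eta)\|_{L^p}=\|\eta'\|_\infty^{\frac1p-1},\qquad \|\eta'\|_\infty=\sup_{w\in\mathbb T}|\eta'(w)|.$$ -/

import Mathlib

open MeasureTheory Filter Topology
open scoped ENNReal

noncomputable section

namespace HardyCondExp

/-- The circle carries its Borel `σ`-algebra. -/
instance : MeasurableSpace Circle := borel Circle

instance : BorelSpace Circle := ⟨rfl⟩

/-- The normalized arc length (Haar) measure on the circle, `dm = dθ / 2π`. -/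
def circleMeasure : Measure Circle :=
  (ENNReal.ofReal (2 * Real.pi))⁻¹ •
    (volume.restrict (Set.Ioc 0 (2 * Real.pi))).map Circle.exp

/-- The Hardy space `H^p(𝕋)`: all functions in `L^p(𝕋)` that can be approximated in the
`L^p` (quasi-)norm by analytic polynomials. -/
def hardy (p : ℝ≥0∞) : Submodule ℂ (Lp ℂ p circleMeasure) where
  carrier := {f | ∀ ε : ℝ≥0∞, 0 < ε → ∃ q : Polynomial ℂ,
    eLpNorm (fun w : Circle => f w - q.eval (w : ℂ)) p circleMeasure < ε}
  zero_mem' := by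
    intro ε hε
    refine ⟨0, ?_⟩
    have h : (fun w : Circle => (0 : Lp ℂ p circleMeasure) w - (0 : Polynomial ℂ).eval (w : ℂ))
        =ᵐ[circleMeasure] (0 : Circle → ℂ) := by
      filter_upwards [Lp.coeFn_zero ℂ p circleMeasure] with w hw
      rw [hw, Polynomial.eval_zero, sub_zero]
    rw [eLpNorm_congr_ae h, eLpNorm_zero]
    exact hε
  add_mem' := by
    intro f g hf hg ε hε
    obtain ⟨δ, hδ, H⟩ := exists_Lp_half ℂ circleMeasure p hε.ne'
    obtain ⟨q, hq⟩ := hf δ hδ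
    obtain ⟨r, hr⟩ := hg δ hδ
    refine ⟨q + r, ?_⟩
    have hm : ∀ (u : Lp ℂ p circleMeasure) (s : Polynomial ℂ),
        AEStronglyMeasurable (fun w : Circle => u w - s.eval (w : ℂ)) circleMeasure := fun u s =>
      (Lp.aestronglyMeasurable u).sub
        (show Continuous (fun w : Circle => s.eval (w : ℂ)) by fun_prop).aestronglyMeasurable
    have h : (fun w : Circle => (f + g) w - (q + r).eval (w : ℂ)) =ᵐ[circleMeasure]
        (fun w : Circle => f w - q.eval (w : ℂ)) + (fun w : Circle => g w - r.eval (w : ℂ)) := by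
      filter_upwards [Lp.coeFn_add f g] with w hw
      simp only [hw, Pi.add_apply, Polynomial.eval_add]
      ring
    rw [eLpNorm_congr_ae h]
    exact H _ _ (hm f q) (hm g r) hq.le hr.le
  smul_mem' := by
    intro c f hf ε hε
    have h : ∀ q : Polynomial ℂ,
        (fun w : Circle => (c • f) w - (c • q).eval (w : ℂ)) =ᵐ[circleMeasure]
        c • (fun w : Circle => f w - q.eval (w : ℂ)) := by
      intro q
      filter_upwards [Lp.coeFn_smul c f] with w hw
      simp only [hw, Pi.smul_apply, Polynomial.eval_smul, smul_sub]
    by_cases hc : c = 0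
    · refine ⟨0, ?_⟩
      have h' := h 0
      rw [smul_zero, hc, zero_smul, zero_smul] at h'
      rw [hc, zero_smul, eLpNorm_congr_ae h', eLpNorm_zero]
      exact hε
    · have hc' : ‖c‖ₑ ≠ 0 := by simpa using hc
      obtain ⟨q, hq⟩ := hf (ε / ‖c‖ₑ) (ENNReal.div_pos hε.ne' enorm_ne_top)
      refine ⟨c • q, ?_⟩
      rw [eLpNorm_congr_ae (h q), eLpNorm_const_smul, mul_comm]
      exact (ENNReal.lt_div_iff_mul_lt (Or.inl hc') (Or.inl enorm_ne_top)).1 hq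

/-- The radial limit `lim_{r → 1⁻} f (r w)` at a point `w` of the circle (a fixed junk value where
the limit does not exist). -/
def radialLimit (f : ℂ → ℂ) (w : Circle) : ℂ :=
  limUnder (𝓝[<] (1 : ℝ)) (fun r : ℝ => f ((r : ℂ) * (w : ℂ)))

/-- Inner functions: analytic on the open unit disc, bounded by `1` there, with unimodular radial
limits almost everywhere. Only the values of `η` on the open disc matter. -/
structure IsInner (η : ℂ → ℂ) : Prop where
  differentiableOn : DifferentiableOn ℂ η (Metric.ball 0 1)
  norm_le_one : ∀ z ∈ Metric.ball (0 : ℂ) 1, ‖η z‖ ≤ 1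
  radial : ∀ᵐ w : Circle ∂circleMeasure, ∃ l : ℂ, ‖l‖ = 1 ∧
    Tendsto (fun r : ℝ => η ((r : ℂ) * (w : ℂ))) (𝓝[<] (1 : ℝ)) (𝓝 l)

/-- Finite Blaschke products `c ∏_j (z - a_j) / (1 - conj a_j z)`, as functions on the disc. -/
def IsFiniteBlaschke (η : ℂ → ℂ) : Prop :=
  ∃ (c : ℂ) (n : ℕ) (a : Fin n → ℂ), ‖c‖ = 1 ∧ (∀ j, ‖a j‖ < 1) ∧
    ∀ z ∈ Metric.ball (0 : ℂ) 1,
      η z = c * ∏ j, (z - a j) / (1 - (starRingEnd ℂ) (a j) * z)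

/-- The boundary function of a function that is continuous on the disc is Borel measurable, so that
it generates a sub-`σ`-algebra of the Borel `σ`-algebra. -/
theorem measurable_radialLimit {f : ℂ → ℂ} (hf : ContinuousOn f (Metric.ball 0 1)) :
    Measurable (radialLimit f) := by
  classical
  let ι := {q : ℚ // 0 < q ∧ q < 1}
  let c : ι → ℝ := fun q => ((q : ℚ) : ℝ)
  let l : Filter ι := comap c (𝓝[<] (1 : ℝ))
  have hdisc : ∀ (w : Circle) (r : ℝ), r ∈ Set.Ioo (0 : ℝ) 1 →
      (r : ℂ) * (w : ℂ) ∈ Metric.ball (0 : ℂ) 1 := by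
    intro w r hr
    rw [mem_ball_zero_iff, norm_mul, Circle.norm_coe, mul_one, Complex.norm_real,
      Real.norm_of_nonneg hr.1.le]
    exact hr.2
  have hmeas : ∀ q : ι, Measurable (fun w : Circle => f ((c q : ℂ) * (w : ℂ))) := by
    intro q
    have hq : c q ∈ Set.Ioo (0 : ℝ) 1 := by
      refine ⟨?_, ?_⟩
      · simpa [c] using q.2.1
      · have := q.2.2
        simp only [c]
        exact_mod_cast this
    exact (hf.comp_continuous (by fun_prop) (fun w => hdisc w _ hq)).measurable
  have hcont : ∀ w : Circle, ContinuousOn (fun r : ℝ => f ((r : ℂ) * (w : ℂ))) (Set.Ioo 0 1) := by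
    intro w
    exact hf.comp (by fun_prop) (fun r hr => hdisc w r hr)
  have hden : ∀ a b : ℝ, 0 ≤ a → a < b → b ≤ 1 → ∃ q : ι, c q ∈ Set.Ioo a b := by
    intro a b ha hab hb
    obtain ⟨q, hq1, hq2⟩ := exists_rat_btwn hab
    have h0 : (0 : ℚ) < q := by exact_mod_cast ha.trans_lt hq1
    have h1 : q < (1 : ℚ) := by exact_mod_cast hq2.trans_le hb
    exact ⟨⟨q, h0, h1⟩, hq1, hq2⟩
  have hl : l.NeBot := by
    refine comap_neBot fun t ht => ?_
    obtain ⟨a, ha, hat⟩ := (mem_nhdsLT_iff_exists_Ioo_subset (a := (1 : ℝ))).1 ht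
    obtain ⟨q, hq⟩ := hden (max a 0) 1 (le_max_right _ _) (max_lt ha one_pos) le_rfl
    exact ⟨q, hat ⟨(le_max_left _ _).trans_lt hq.1, hq.2⟩⟩
  have hiff : ∀ (w : Circle) (x : ℂ),
      Tendsto (fun q : ι => f ((c q : ℂ) * (w : ℂ))) l (𝓝 x) ↔
      Tendsto (fun r : ℝ => f ((r : ℂ) * (w : ℂ))) (𝓝[<] (1 : ℝ)) (𝓝 x) := by
    intro w x
    refine ⟨fun h => ?_, fun h => h.comp tendsto_comap⟩
    rw [Metric.nhds_basis_closedBall.tendsto_right_iff] at h ⊢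
    intro ε hε
    obtain ⟨t, ht, hts⟩ := mem_comap.1 (h ε hε)
    obtain ⟨a, ha, hat⟩ := (mem_nhdsLT_iff_exists_Ioo_subset (a := (1 : ℝ))).1 ht
    have hmem : Set.Ioo (max a 0) 1 ∈ 𝓝[<] (1 : ℝ) :=
      Ioo_mem_nhdsLT (max_lt ha one_pos)
    filter_upwards [hmem] with r hr
    have hr01 : r ∈ Set.Ioo (0 : ℝ) 1 := ⟨(le_max_right _ _).trans_lt hr.1, hr.2⟩
    have hat' : ContinuousAt (fun r : ℝ => f ((r : ℂ) * (w : ℂ))) r :=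
      (hcont w).continuousAt (Ioo_mem_nhds hr01.1 hr01.2)
    by_contra hne
    have hopen : ∀ᶠ s : ℝ in 𝓝 r, f ((s : ℂ) * (w : ℂ)) ∉ Metric.closedBall x ε :=
      hat'.eventually (Metric.isClosed_closedBall.isOpen_compl.mem_nhds hne)
    obtain ⟨δ, hδ, hδs⟩ := Metric.eventually_nhds_iff.1 hopen
    obtain ⟨q, hq⟩ := hden r (min (r + δ) 1) hr01.1.le (lt_min (by linarith) hr.2)
      (min_le_right _ _)
    have hq1 : c q < r + δ := hq.2.trans_le (min_le_left _ _)
    have hq2 : c q < 1 := hq.2.trans_le (min_le_right _ _)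
    refine hδs (y := c q) ?_ (hts (hat ⟨?_, hq2⟩))
    · rw [Real.dist_eq, abs_of_pos (by linarith [hq.1])]
      linarith
    · exact (le_max_left _ _).trans_lt (hr.1.trans hq.1)
  have hset : MeasurableSet {w : Circle | ∃ x, Tendsto
      (fun q : ι => f ((c q : ℂ) * (w : ℂ))) l (𝓝 x)} :=
    measurableSet_exists_tendsto (f := fun (q : ι) (w : Circle) => f ((c q : ℂ) * (w : ℂ))) hmeas
  let S : Set Circle := {w : Circle | ∃ x, Tendsto
      (fun q : ι => f ((c q : ℂ) * (w : ℂ))) l (𝓝 x)}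
  let d : ℂ := Classical.epsilon (fun _ => False)
  have hoff : ∀ w ∉ S, radialLimit f w = d := by
    intro w hw
    have hF : (fun x : ℂ => map (fun r : ℝ => f ((r : ℂ) * (w : ℂ))) (𝓝[<] (1 : ℝ)) ≤ 𝓝 x) =
        fun _ => False := by
      funext x
      exact eq_false fun h => hw ⟨x, (hiff w x).2 h⟩
    change Classical.epsilon
      (fun x : ℂ => map (fun r : ℝ => f ((r : ℂ) * (w : ℂ))) (𝓝[<] (1 : ℝ)) ≤ 𝓝 x) = _
    rw [hF]
  refine measurable_of_tendsto_metrizable' l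
    (f := fun (q : ι) (w : Circle) => if w ∈ S then f ((c q : ℂ) * (w : ℂ)) else d)
    (fun q => Measurable.ite hset (hmeas q) measurable_const) ?_
  rw [tendsto_pi_nhds]
  intro w
  by_cases hw : w ∈ S
  · simp only [hw, if_true]
    obtain ⟨x, hx⟩ := hw
    have hx' := (hiff w x).1 hx
    have : radialLimit f w = x := hx'.limUnder_eq
    rwa [this]
  · simp only [hw, if_false]
    rw [hoff w hw]
    exact tendsto_const_nhds

/-- The `σ`-algebra on the circle generated by the boundary function of `η`. -/
@[reducible]
def sigmaAlgebra (η : ℂ → ℂ) : MeasurableSpace Circle :=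
  MeasurableSpace.comap (radialLimit η) inferInstance

/-- `T` is a bounded operator on the subspace `X` of `L^p(𝕋)` that extends the conditional
expectation `𝔼(· | η)`, which is defined on the integrable functions in `X`. -/
def IsBoundedCondExp {p : ℝ≥0∞} (η : ℂ → ℂ) (X : Submodule ℂ (Lp ℂ p circleMeasure))
    (T : X →ₗ[ℂ] X) : Prop :=
  (∃ C : ℝ, ∀ f : X, ‖(T f : Lp ℂ p circleMeasure)‖ ≤ C * ‖(f : Lp ℂ p circleMeasure)‖) ∧
  ∀ f : X, Integrable (f : Lp ℂ p circleMeasure) circleMeasure →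
    (T f : Lp ℂ p circleMeasure) =ᵐ[circleMeasure]
      circleMeasure[(f : Lp ℂ p circleMeasure) | sigmaAlgebra η]

/-- The operator (quasi-)norm `sup_{‖f‖_p = 1} ‖T f‖_p`. -/
def opNorm {p : ℝ≥0∞} {X : Submodule ℂ (Lp ℂ p circleMeasure)} (T : X →ₗ[ℂ] X) : ℝ :=
  sSup {r : ℝ | ∃ f : X, ‖(f : Lp ℂ p circleMeasure)‖ = 1 ∧ r = ‖(T f : Lp ℂ p circleMeasure)‖}

/-- `sup_{w ∈ 𝕋} |η'(w)|`, with the values of `η'` on the circle taken as radial limits. -/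
def derivSup (η : ℂ → ℂ) : ℝ :=
  ⨆ w : Circle, ‖radialLimit (deriv η) w‖

end HardyCondExp

end

open HardyCondExp

/-!
Since `η(0) = 0`, the boundary map of `η` preserves `m`, and the conditional expectation of `f` is
`G ∘ η` for a function `G` that is determined by its Fourier coefficients `∫ f · η⁻ⁿ dm`.

*Necessity.* For the derivative kernel `f_a(w) = w (1 - ā w)⁻²` this gives
`G = conj (η' a) f_b` with `b = η a`, and `f_a` may be multiplied by a power of `(1 - b̄ η)⁻¹`.
Boundedness on these functions, together with the growth of the integral means of the Cauchy
kernel, yields `|η' a| ≤ M ((1 - |η a|) / (1 - |a|)) ^ β` with `β < 1`. Integrated along radii, this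
forces `|η| → 1` uniformly at the circle, so that `η` is a finite Blaschke product.

*Sufficiency.* A finite Blaschke product lifts to an increasing diffeomorphism of the line, hence is
a covering of the circle with finitely many sections `ζₖ`, and the conditional expectation is the
average `G = ∑ₖ (f / |η'|) ∘ ζₖ` over the fibres. As `|∑ₖ xₖ|^p ≤ ∑ₖ |xₖ|^p` for `p ≤ 1`, a change
of variables bounds `∫ |G|^p` by `∫ |f|^p |η'|^(1-p)`, hence by `‖η'‖_∞^(1-p) ∫ |f|^p`. Polynomials
concentrated near a point where `|η'|` is maximal show that the constant is sharp, already on `H^p`.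
-/

noncomputable section

open Metric
open scoped ComplexConjugate Real NNReal

namespace HardyCondExp

/-! ### The normalized arc length measure -/

lemma setLIntegral_Ioc_eq_of_periodic {g : ℝ → ℝ≥0∞} {T : ℝ} (hg : Function.Periodic g T)
    (hT : 0 < T) (s t : ℝ) :
    ∫⁻ θ in Set.Ioc s (s + T), g θ = ∫⁻ θ in Set.Ioc t (t + T), g θ := by
  refine (isAddFundamentalDomain_Ioc hT s).setLIntegral_eq
    (isAddFundamentalDomain_Ioc hT t) _ ?_
  rintro ⟨_, n, rfl⟩ x
  simpa only [AddSubgroup.vadd_def, vadd_eq_add, add_comm] using hg.zsmul n x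

lemma lintegral_circleMeasure {F : Circle → ℝ≥0∞} (hF : Measurable F) (t : ℝ) :
    ∫⁻ w, F w ∂circleMeasure =
      (ENNReal.ofReal (2 * π))⁻¹ * ∫⁻ θ in Set.Ioc t (t + 2 * π), F (Circle.exp θ) := by
  have hper : Function.Periodic (fun θ => F (Circle.exp θ)) (2 * π) := fun θ => by
    simp only [Circle.exp_add, Circle.exp_two_pi, mul_one]
  rw [setLIntegral_Ioc_eq_of_periodic hper Real.two_pi_pos t 0, zero_add, circleMeasure,
    lintegral_smul_measure, smul_eq_mul, lintegral_map hF Circle.exp.continuous.measurable]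

instance : IsProbabilityMeasure circleMeasure := by
  constructor
  rw [← lintegral_one, lintegral_circleMeasure measurable_const 0, setLIntegral_one,
    Real.volume_Ioc, zero_add, sub_zero]
  exact ENNReal.inv_mul_cancel (by simp [Real.pi_pos]) ENNReal.ofReal_ne_top

instance : circleMeasure.IsMulLeftInvariant := by
  refine ⟨fun c => Measure.ext_of_lintegral _ fun F hF => ?_⟩
  obtain ⟨t, rfl⟩ := Circle.exp_surjective c
  have hF' : Measurable fun w => F (Circle.exp t * w) := hF.comp (measurable_const_mul _)
  have hshift := (measurePreserving_add_left volume t).setLIntegral_comp_preimage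
    (measurableSet_Ioc (a := t) (b := t + 2 * π)) (hF.comp Circle.exp.continuous.measurable)
  simp only [Function.comp_apply, Set.preimage_const_add_Ioc, sub_self, add_sub_cancel_left,
    Circle.exp_add] at hshift
  rw [lintegral_map hF (measurable_const_mul _), lintegral_circleMeasure hF t,
    lintegral_circleMeasure hF' 0, zero_add, hshift]

lemma integral_circleMeasure {E : Type*} [NormedAddCommGroup E] [NormedSpace ℝ E] {F : ℂ → E}
    (hF : ContinuousOn F (sphere 0 1)) :
    ∫ w : Circle, F w ∂circleMeasure = Real.circleAverage F 0 1 := by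
  have hF' : Continuous fun w : Circle => F w :=
    hF.comp_continuous (by fun_prop) fun w => by simp [Circle.norm_coe]
  rw [circleMeasure, integral_smul_measure, integral_map Circle.exp.continuous.aemeasurable
    hF'.aestronglyMeasurable, Real.circleAverage_def,
    intervalIntegral.integral_of_le Real.two_pi_pos.le, ENNReal.toReal_inv,
    ENNReal.toReal_ofReal Real.two_pi_pos.le]
  simp only [Circle.coe_exp, circleMap_zero, Complex.ofReal_one, one_mul]

/-! ### Bounded analytic functions and their boundary values -/

lemma ofReal_mul_circle_mem_ball (w : Circle) {r : ℝ} (hr : r ∈ Set.Ioo (0 : ℝ) 1) :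
    (r : ℂ) * (w : ℂ) ∈ ball (0 : ℂ) 1 := by
  simpa [Circle.norm_coe, abs_of_pos hr.1] using hr.2

lemma eventually_ofReal_mul_circle_mem_ball (w : Circle) :
    ∀ᶠ r : ℝ in 𝓝[<] 1, (r : ℂ) * (w : ℂ) ∈ ball (0 : ℂ) 1 := by
  filter_upwards [Ioo_mem_nhdsLT one_pos] with r hr using ofReal_mul_circle_mem_ball w hr

lemma tendsto_ofReal_mul (z : ℂ) : Tendsto (fun r : ℝ => (r : ℂ) * z) (𝓝[<] 1) (𝓝 z) := by
  have h : Tendsto (fun r : ℝ => (r : ℂ) * z) (𝓝 1) (𝓝 (((1 : ℝ) : ℂ) * z)) :=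
    Continuous.tendsto (by fun_prop) 1
  simpa using h.mono_left nhdsWithin_le_nhds

lemma circle_sub_ne_zero (w : Circle) {a : ℂ} (ha : ‖a‖ < 1) : (w : ℂ) - a ≠ 0 :=
  sub_ne_zero.2 fun h => ha.ne (by rw [← h, Circle.norm_coe])

/-- `F` is a bounded analytic function on the unit disc with radial limits `f` almost everywhere,
i.e. `F ∈ H^∞` with boundary function `f`. -/
structure HasBoundary (F : ℂ → ℂ) (f : Circle → ℂ) : Prop where
  differentiableOn : DifferentiableOn ℂ F (ball 0 1)
  bounded : ∃ K : ℝ, ∀ z ∈ ball (0 : ℂ) 1, ‖F z‖ ≤ K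
  tendsto : ∀ᵐ w : Circle ∂circleMeasure,
    Tendsto (fun r : ℝ => F ((r : ℂ) * (w : ℂ))) (𝓝[<] (1 : ℝ)) (𝓝 (f w))

namespace HasBoundary

variable {F G : ℂ → ℂ} {f g : Circle → ℂ}

lemma const (c : ℂ) : HasBoundary (fun _ => c) (fun _ => c) :=
  ⟨differentiableOn_const c, ⟨‖c‖, fun _ _ => le_rfl⟩, ae_of_all _ fun _ => tendsto_const_nhds⟩

lemma of_diffContOnCl (hF : DiffContOnCl ℂ F (ball 0 1)) : HasBoundary F (fun w => F w) := by
  have hc : ContinuousOn F (closedBall 0 1) := hF.continuousOn_ball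
  refine ⟨hF.differentiableOn, ?_, ae_of_all _ fun w => ?_⟩
  · obtain ⟨K, hK⟩ := (isCompact_closedBall (0 : ℂ) 1).exists_bound_of_continuousOn hc
    exact ⟨K, fun z hz => hK z (ball_subset_closedBall hz)⟩
  · refine (hc (w : ℂ) (by simp [Circle.norm_coe])).tendsto.comp
      (tendsto_nhdsWithin_iff.2 ⟨tendsto_ofReal_mul _, ?_⟩)
    exact (eventually_ofReal_mul_circle_mem_ball w).mono fun _ h => ball_subset_closedBall h

lemma id : HasBoundary (fun z => z) (fun w => (w : ℂ)) :=
  of_diffContOnCl differentiable_id.diffContOnCl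

lemma mul (hF : HasBoundary F f) (hG : HasBoundary G g) :
    HasBoundary (fun z => F z * G z) (fun w => f w * g w) := by
  obtain ⟨K, hK⟩ := hF.bounded
  obtain ⟨L, hL⟩ := hG.bounded
  refine ⟨hF.differentiableOn.mul hG.differentiableOn, ⟨K * L, fun z hz => ?_⟩, ?_⟩
  · exact norm_mul_le_of_le (hK z hz) (hL z hz)
  · filter_upwards [hF.tendsto, hG.tendsto] with w h1 h2 using h1.mul h2

lemma add (hF : HasBoundary F f) (hG : HasBoundary G g) :
    HasBoundary (fun z => F z + G z) (fun w => f w + g w) := by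
  obtain ⟨K, hK⟩ := hF.bounded
  obtain ⟨L, hL⟩ := hG.bounded
  refine ⟨hF.differentiableOn.add hG.differentiableOn, ⟨K + L, fun z hz => ?_⟩, ?_⟩
  · exact norm_add_le_of_le (hK z hz) (hL z hz)
  · filter_upwards [hF.tendsto, hG.tendsto] with w h1 h2 using h1.add h2

lemma pow (hF : HasBoundary F f) (n : ℕ) : HasBoundary (fun z => F z ^ n) (fun w => f w ^ n) := by
  induction n with
  | zero => simpa only [pow_zero] using const 1
  | succ n ih => simpa only [pow_succ] using ih.mul hF

lemma polynomial (hF : HasBoundary F f) (q : Polynomial ℂ) :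
    HasBoundary (fun z => q.eval (F z)) (fun w => q.eval (f w)) := by
  induction q using Polynomial.induction_on' with
  | add p q hp hq => simpa only [Polynomial.eval_add] using hp.add hq
  | monomial n a => simpa only [Polynomial.eval_monomial] using (const a).mul (hF.pow n)

lemma continuous_dilate (hF : HasBoundary F f) {r : ℝ} (hr : r ∈ Set.Ioo (0 : ℝ) 1) :
    Continuous (fun w : Circle => F ((r : ℂ) * (w : ℂ))) :=
  hF.differentiableOn.continuousOn.comp_continuous (by fun_prop)
    fun w => ofReal_mul_circle_mem_ball w hr

lemma aestronglyMeasurable (hF : HasBoundary F f) : AEStronglyMeasurable f circleMeasure := by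
  obtain ⟨r, -, hr, hlim⟩ := exists_seq_strictMono_tendsto' (one_pos (α := ℝ))
  have hlim' : Tendsto r atTop (𝓝[<] 1) :=
    tendsto_nhdsWithin_iff.2 ⟨hlim, Eventually.of_forall fun n => (hr n).2⟩
  refine aestronglyMeasurable_of_tendsto_ae atTop
    (fun n => (hF.continuous_dilate (hr n)).aestronglyMeasurable) ?_
  filter_upwards [hF.tendsto] with w hw using hw.comp hlim'

lemma ae_norm_le (hF : HasBoundary F f) {K : ℝ} (hK : ∀ z ∈ ball (0 : ℂ) 1, ‖F z‖ ≤ K) :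
    ∀ᵐ w ∂circleMeasure, ‖f w‖ ≤ K := by
  filter_upwards [hF.tendsto] with w hw
  exact le_of_tendsto hw.norm ((eventually_ofReal_mul_circle_mem_ball w).mono fun _ h => hK _ h)

lemma memLp (hF : HasBoundary F f) (p : ℝ≥0∞) : MemLp f p circleMeasure := by
  obtain ⟨K, hK⟩ := hF.bounded
  exact MemLp.of_bound hF.aestronglyMeasurable K (hF.ae_norm_le hK)

lemma integrable (hF : HasBoundary F f) : Integrable f circleMeasure :=
  memLp_one_iff_integrable.1 (hF.memLp 1)

lemma tendsto_integral_mul_dilate (hF : HasBoundary F f) {u : Circle → ℂ} (hu : Continuous u) :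
    Tendsto (fun r : ℝ => ∫ w : Circle, u w * F (r * w) ∂circleMeasure) (𝓝[<] (1 : ℝ))
      (𝓝 (∫ w, u w * f w ∂circleMeasure)) := by
  obtain ⟨K, hK⟩ := hF.bounded
  obtain ⟨L, hL⟩ := isCompact_univ.exists_bound_of_continuousOn hu.continuousOn
  refine tendsto_integral_filter_of_dominated_convergence (fun _ => L * K) ?_ ?_
    (integrable_const _) ?_
  · filter_upwards [Ioo_mem_nhdsLT one_pos] with r hr
    exact (hu.mul (hF.continuous_dilate hr)).aestronglyMeasurable
  · filter_upwards [Ioo_mem_nhdsLT one_pos] with r hr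
    exact ae_of_all _ fun w =>
      norm_mul_le_of_le (hL w trivial) (hK _ (ofReal_mul_circle_mem_ball w hr))
  · filter_upwards [hF.tendsto] with w hw using hw.const_mul _

end HasBoundary

lemma integral_mul_eq_deriv_of_differentiableOn {F : ℂ → ℂ} {U : Set ℂ} (hU : IsOpen U)
    (hsub : closedBall 0 1 ⊆ U) (hF : DifferentiableOn ℂ F U) {a : ℂ} (ha : ‖a‖ < 1) :
    ∫ w : Circle, (w : ℂ) / ((w : ℂ) - a) ^ 2 * F w ∂circleMeasure = deriv F a := by
  have hcont : ContinuousOn (fun z : ℂ => z / (z - a) ^ 2 * F z) (sphere 0 1) := by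
    refine (continuousOn_id.div (by fun_prop) fun z hz => ?_).mul
      (hF.continuousOn.mono (sphere_subset_closedBall.trans hsub))
    exact pow_ne_zero 2 (circle_sub_ne_zero ⟨z, hz⟩ ha)
  rw [integral_circleMeasure hcont, Real.circleAverage_eq_circleIntegral one_ne_zero,
    ← Complex.two_pi_I_inv_smul_circleIntegral_sub_sq_inv_smul_of_differentiable hU hsub hF
      (mem_ball_zero_iff.2 ha)]
  congr 1
  refine circleIntegral.integral_congr zero_le_one fun z hz => ?_
  have hz0 : z ≠ 0 := ne_of_mem_sphere hz one_ne_zero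
  simp only [sub_zero, smul_eq_mul]
  field_simp

namespace HasBoundary

variable {F : ℂ → ℂ} {f : Circle → ℂ}

lemma integral_mul_eq_deriv (hF : HasBoundary F f) {a : ℂ} (ha : ‖a‖ < 1) :
    ∫ w : Circle, (w : ℂ) / ((w : ℂ) - a) ^ 2 * f w ∂circleMeasure = deriv F a := by
  have hcont : Continuous fun w : Circle => (w : ℂ) / ((w : ℂ) - a) ^ 2 :=
    Continuous.div (by fun_prop) (by fun_prop) fun w => pow_ne_zero 2 (circle_sub_ne_zero w ha)
  have hderiv : Tendsto (fun r : ℝ => (r : ℂ) * deriv F (r * a)) (𝓝[<] 1) (𝓝 (1 * deriv F a)) := by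
    have hd : ContinuousAt (deriv F) a :=
      (hF.differentiableOn.deriv isOpen_ball).continuousOn.continuousAt
        (isOpen_ball.mem_nhds (mem_ball_zero_iff.2 ha))
    exact (by simpa using tendsto_ofReal_mul 1 : Tendsto (fun r : ℝ => (r : ℂ)) _ _).mul
      (hd.tendsto.comp (tendsto_ofReal_mul a))
  rw [one_mul] at hderiv
  refine tendsto_nhds_unique ((hF.tendsto_integral_mul_dilate hcont).congr' ?_) hderiv
  filter_upwards [Ioo_mem_nhdsLT one_pos] with r hr
  have hsub : closedBall (0 : ℂ) 1 ⊆ (fun z : ℂ => (r : ℂ) * z) ⁻¹' ball 0 1 := by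
    intro z hz
    rw [Set.mem_preimage, mem_ball_zero_iff, norm_mul, Complex.norm_real,
      Real.norm_of_nonneg hr.1.le]
    exact (mul_le_of_le_one_right hr.1.le (mem_closedBall_zero_iff.1 hz)).trans_lt hr.2
  rw [integral_mul_eq_deriv_of_differentiableOn (F := fun z : ℂ => F (r * z))
    (isOpen_ball.preimage (by fun_prop)) hsub
    (hF.differentiableOn.comp (by fun_prop) fun _ hz => hz) ha,
    deriv_comp_mul_left (r : ℂ) F a, smul_eq_mul]

lemma integral_eq (hF : HasBoundary F f) : ∫ w, f w ∂circleMeasure = F 0 := by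
  have h := (HasBoundary.id.mul hF).integral_mul_eq_deriv (a := 0) (by simp)
  have hd : DifferentiableAt ℂ F 0 :=
    hF.differentiableOn.differentiableAt (isOpen_ball.mem_nhds (by simp))
  rw [deriv_fun_mul differentiableAt_fun_id hd] at h
  simp only [deriv_id'', one_mul, zero_mul, add_zero, sub_zero] at h
  rw [← h]
  refine integral_congr_ae (ae_of_all _ fun w => ?_)
  have := Circle.coe_ne_zero w
  simp only
  field_simp

end HasBoundary

/-! ### Approximation by polynomials -/

/-- `f` is a limit of analytic polynomials in `L^p(𝕋)`, i.e. `f` represents an element of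
`H^p(𝕋)`; stated for functions rather than for classes, so that it applies before `f` is known to
be in `L^p`. -/
def PolyApprox (p : ℝ≥0∞) (f : Circle → ℂ) : Prop :=
  ∀ ε : ℝ≥0∞, 0 < ε → ∃ q : Polynomial ℂ,
    eLpNorm (fun w : Circle => f w - q.eval (w : ℂ)) p circleMeasure < ε

lemma mem_hardy_iff {p : ℝ≥0∞} {f : Lp ℂ p circleMeasure} :
    f ∈ hardy p ↔ PolyApprox p f := Iff.rfl

lemma polyApprox_polynomial (p : ℝ≥0∞) (q : Polynomial ℂ) :
    PolyApprox p (fun w : Circle => q.eval (w : ℂ)) :=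
  fun ε hε => ⟨q, by simpa using hε⟩

lemma PolyApprox.congr {p : ℝ≥0∞} {f g : Circle → ℂ} (hf : PolyApprox p f)
    (h : f =ᵐ[circleMeasure] g) : PolyApprox p g := by
  intro ε hε
  obtain ⟨q, hq⟩ := hf ε hε
  refine ⟨q, lt_of_eq_of_lt (eLpNorm_congr_ae ?_) hq⟩
  filter_upwards [h] with w hw
  rw [hw]

lemma toLp_mem_hardy {p : ℝ≥0∞} {f : Circle → ℂ} (hf : MemLp f p circleMeasure)
    (h : PolyApprox p f) : hf.toLp f ∈ hardy p :=
  mem_hardy_iff.2 (h.congr hf.coeFn_toLp.symm)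

lemma PolyApprox.of_approx {p : ℝ≥0∞} {f : Circle → ℂ} (hf : AEStronglyMeasurable f circleMeasure)
    (h : ∀ ε : ℝ≥0∞, 0 < ε → ∃ g : Circle → ℂ, PolyApprox p g ∧
      AEStronglyMeasurable g circleMeasure ∧
      eLpNorm (fun w : Circle => f w - g w) p circleMeasure ≤ ε) : PolyApprox p f := by
  intro ε hε
  obtain ⟨δ, hδ, hadd⟩ := exists_Lp_half ℂ circleMeasure p hε.ne'
  obtain ⟨g, hg, hgm, hfg⟩ := h δ hδ
  obtain ⟨q, hq⟩ := hg δ hδ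
  have hqm : AEStronglyMeasurable (fun w : Circle => q.eval (w : ℂ)) circleMeasure :=
    Continuous.aestronglyMeasurable (by fun_prop)
  refine ⟨q, ?_⟩
  convert hadd _ _ (hf.sub hgm) (hgm.sub hqm) hfg hq.le using 2
  funext w
  simp

lemma exists_polynomial_forall_closedBall_norm_sub_le {F : ℂ → ℂ}
    (hF : DifferentiableOn ℂ F (ball 0 1)) {r : ℝ} (hr0 : 0 ≤ r) (hr1 : r < 1) {δ : ℝ}
    (hδ : 0 < δ) : ∃ q : Polynomial ℂ, ∀ z ∈ closedBall (0 : ℂ) r, ‖F z - q.eval z‖ ≤ δ := by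
  obtain ⟨s, hrs, hs1⟩ := exists_between hr1
  obtain ⟨t, hst, ht1⟩ := exists_between hs1
  lift s to NNReal using hr0.trans hrs.le
  lift t to NNReal using s.2.trans hst.le
  have hps := (hF.mono (closedBall_subset_ball ht1)).hasFPowerSeriesOnBall
    (hr0.trans_lt (hrs.trans hst))
  have hu := hps.tendstoUniformlyOn (r' := s) (by exact_mod_cast hst)
  obtain ⟨n, hn⟩ := (Metric.tendstoUniformlyOn_iff.1 hu δ hδ).exists
  refine ⟨∑ k ∈ Finset.range n, Polynomial.C ((cauchyPowerSeries F 0 t).coeff k) *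
    Polynomial.X ^ k, fun z hz => ?_⟩
  have hz' := (hn z (closedBall_subset_ball hrs hz)).le
  rw [zero_add, dist_eq_norm, FormalMultilinearSeries.partialSum] at hz'
  simpa only [Polynomial.eval_finsetSum, Polynomial.eval_mul, Polynomial.eval_C,
    Polynomial.eval_pow, Polynomial.eval_X, FormalMultilinearSeries.apply_eq_pow_smul_coeff,
    smul_eq_mul, mul_comm] using hz'

lemma HasBoundary.polyApprox_dilate {F : ℂ → ℂ} {f : Circle → ℂ} (hF : HasBoundary F f)
    {r : ℝ} (hr : r ∈ Set.Ioo (0 : ℝ) 1) (p : ℝ≥0∞) :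
    PolyApprox p (fun w : Circle => F ((r : ℂ) * (w : ℂ))) := by
  refine PolyApprox.of_approx (hF.continuous_dilate hr).aestronglyMeasurable fun ε hε => ?_
  obtain ⟨δ, -, hδ0, hδ⟩ := ENNReal.lt_iff_exists_real_btwn.1 hε
  obtain ⟨q, hq⟩ := exists_polynomial_forall_closedBall_norm_sub_le hF.differentiableOn hr.1.le hr.2
    (ENNReal.ofReal_pos.1 hδ0)
  refine ⟨fun w => (q.comp (Polynomial.C (r : ℂ) * Polynomial.X)).eval (w : ℂ),
    polyApprox_polynomial p _, Continuous.aestronglyMeasurable (by fun_prop), ?_⟩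
  refine (eLpNorm_le_of_ae_bound (C := δ) (ae_of_all _ fun w => ?_)).trans (by simpa using hδ.le)
  simpa using hq (r * w) (by simp [Circle.norm_coe, abs_of_pos hr.1])

lemma tendsto_eLpNorm_zero_of_bounded {α ι E : Type*} [MeasurableSpace α] {μ : Measure α}
    [IsFiniteMeasure μ] [NormedAddCommGroup E] {l : Filter ι} [l.IsCountablyGenerated]
    {p : ℝ≥0∞} (hp : p ≠ ⊤) {g : ι → α → E} {K : ℝ}
    (hm : ∀ᶠ i in l, AEStronglyMeasurable (g i) μ) (hb : ∀ᶠ i in l, ∀ᵐ x ∂μ, ‖g i x‖ ≤ K)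
    (ht : ∀ᵐ x ∂μ, Tendsto (fun i => g i x) l (𝓝 0)) :
    Tendsto (fun i => eLpNorm (g i) p μ) l (𝓝 0) := by
  rcases eq_or_ne p 0 with rfl | hp0
  · simpa only [eLpNorm_exponent_zero] using tendsto_const_nhds
  have hpos : 0 < p.toReal := ENNReal.toReal_pos hp0 hp
  have hrpow {y : ℝ} (hy : 0 < y) : Tendsto (fun x : ℝ≥0∞ => x ^ y) (𝓝 0) (𝓝 0) := by
    simpa only [ENNReal.zero_rpow_of_pos hy] using
      (ENNReal.continuous_rpow_const (y := y)).tendsto 0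
  have hint : Tendsto (fun i => ∫⁻ x, ‖g i x‖ₑ ^ p.toReal ∂μ) l (𝓝 (∫⁻ _, 0 ∂μ)) := by
    refine tendsto_lintegral_filter_of_dominated_convergence'
      (fun _ => ENNReal.ofReal K ^ p.toReal) (hm.mono fun i h => h.enorm.pow_const _) ?_ ?_ ?_
    · filter_upwards [hb] with i hi
      filter_upwards [hi] with x hx
      rw [← ofReal_norm]
      gcongr
    · rw [lintegral_const]
      exact ENNReal.mul_ne_top (ENNReal.rpow_ne_top_of_nonneg hpos.le ENNReal.ofReal_ne_top)
        (measure_ne_top _ _)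
    · filter_upwards [ht] with x hx
      exact (hrpow hpos).comp (by simpa using hx.enorm)
  rw [lintegral_zero] at hint
  simp only [eLpNorm_eq_lintegral_rpow_enorm_toReal hp0 hp]
  exact (hrpow (by positivity)).comp hint

lemma HasBoundary.polyApprox {F : ℂ → ℂ} {f : Circle → ℂ} (hF : HasBoundary F f) {p : ℝ≥0∞}
    (hp : p ≠ ⊤) : PolyApprox p f := by
  refine PolyApprox.of_approx hF.aestronglyMeasurable fun ε hε => ?_
  obtain ⟨K, hK⟩ := hF.bounded
  have hIoo : ∀ᶠ r : ℝ in 𝓝[<] 1, r ∈ Set.Ioo (0 : ℝ) 1 := Ioo_mem_nhdsLT one_pos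
  have hlim : Tendsto (fun r : ℝ => eLpNorm (fun w : Circle => f w - F ((r : ℂ) * (w : ℂ))) p
      circleMeasure) (𝓝[<] 1) (𝓝 0) := by
    refine tendsto_eLpNorm_zero_of_bounded hp (K := K + K) ?_ ?_ ?_
    · filter_upwards [hIoo] with r hr
      exact hF.aestronglyMeasurable.sub (hF.continuous_dilate hr).aestronglyMeasurable
    · filter_upwards [hIoo] with r hr
      filter_upwards [hF.ae_norm_le hK] with w hw
      exact norm_sub_le_of_le hw (hK _ (ofReal_mul_circle_mem_ball w hr))
    · filter_upwards [hF.tendsto] with w hw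
      simpa only [sub_self] using hw.const_sub (f w)
  obtain ⟨r, hr, hrε⟩ := (hIoo.and (hlim.eventually (gt_mem_nhds hε))).exists
  exact ⟨_, hF.polyApprox_dilate hr p, (hF.continuous_dilate hr).aestronglyMeasurable, hrε.le⟩

/-! ### Trigonometric polynomials determine integrals -/

lemma continuous_circle_coe : Continuous (fun w : Circle => (w : ℂ)) := continuous_subtype_val

lemma conj_coe_zpow (w : Circle) (n : ℤ) : conj ((w : ℂ) ^ n) = (w : ℂ) ^ (-n) := by
  rw [map_zpow₀, ← Circle.coe_inv_eq_conj, Circle.coe_inv, inv_zpow, zpow_neg]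

lemma HasBoundary.integral_coe_zpow {F : ℂ → ℂ} {b : Circle → Circle}
    (hF : HasBoundary F (fun w => (b w : ℂ))) (hF0 : F 0 = 0) (n : ℤ) :
    ∫ w, (b w : ℂ) ^ n ∂circleMeasure = if n = 0 then 1 else 0 := by
  have hnat (k : ℕ) : ∫ w, (b w : ℂ) ^ k ∂circleMeasure = if k = 0 then 1 else 0 := by
    rw [(hF.pow k).integral_eq, hF0, zero_pow_eq]
  obtain ⟨k, rfl | rfl⟩ := n.eq_nat_or_neg
  · simpa using hnat k
  · simp only [← conj_coe_zpow, zpow_natCast, integral_conj, hnat k]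
    split_ifs <;> simp_all

lemma integral_coe_zpow (n : ℤ) :
    ∫ w : Circle, (w : ℂ) ^ n ∂circleMeasure = if n = 0 then 1 else 0 :=
  HasBoundary.id.integral_coe_zpow (b := fun w => w) rfl n

/-- The character `w ↦ wⁿ` of the circle, as a continuous function. -/
def circleZPow (n : ℤ) : C(Circle, ℂ) where
  toFun w := (w : ℂ) ^ n
  continuous_toFun := continuous_circle_coe.zpow₀ n fun w => Or.inl w.coe_ne_zero

lemma span_circleZPow_closure_eq_top :
    (Submodule.span ℂ (Set.range circleZPow)).topologicalClosure = ⊤ := by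
  let h : AddCircle (1 : ℝ) ≃ₜ Circle := AddCircle.homeomorphCircle one_ne_zero
  let R : C(AddCircle (1 : ℝ), ℂ) →L[ℂ] C(Circle, ℂ) :=
    ⟨ContinuousMap.compRightAlgHom ℂ ℂ (h.symm : C(Circle, AddCircle (1 : ℝ))) |>.toLinearMap,
      ContinuousMap.continuous_precomp _⟩
  have hR : Function.Surjective R := fun Φ =>
    ⟨Φ.comp (h : C(AddCircle (1 : ℝ), Circle)), by
      ext w
      exact congrArg Φ (h.apply_symm_apply w)⟩
  have hfourier : R ∘ fourier = circleZPow := by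
    funext n
    ext w
    change fourier n (h.symm w) = (w : ℂ) ^ n
    rw [fourier_apply, AddCircle.toCircle_zsmul, Circle.coe_zpow,
      ← AddCircle.homeomorphCircle_apply one_ne_zero, h.apply_symm_apply]
  have hclosure := hR.denseRange.topologicalClosure_map_submodule
    (span_fourier_closure_eq_top (T := (1 : ℝ)))
  rwa [Submodule.map_span, ContinuousLinearMap.coe_coe, ← Set.range_comp, hfourier] at hclosure

lemma integrable_mul_comp {f : Circle → ℂ} (hf : Integrable f circleMeasure)
    {b : Circle → Circle} (hb : Measurable b) (Φ : C(Circle, ℂ)) :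
    Integrable (fun w => f w * Φ (b w)) circleMeasure :=
  hf.mul_bdd (c := ‖Φ‖) (Φ.continuous.measurable.comp hb).aestronglyMeasurable
    (ae_of_all _ fun _ => Φ.norm_coe_le_norm _)

/-- The functional `Φ ↦ ∫ f · (Φ ∘ b) dm`, i.e. the push-forward under `b` of the complex measure
`f dm`. -/
def integralMulComp {f : Circle → ℂ} (hf : Integrable f circleMeasure)
    {b : Circle → Circle} (hb : Measurable b) : C(Circle, ℂ) →L[ℂ] ℂ :=
  LinearMap.mkContinuous
    { toFun := fun Φ => ∫ w, f w * Φ (b w) ∂circleMeasure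
      map_add' := fun Φ Ψ => by
        rw [← integral_add (integrable_mul_comp hf hb Φ) (integrable_mul_comp hf hb Ψ)]
        simp only [ContinuousMap.add_apply, mul_add]
      map_smul' := fun c Φ => by
        simp only [ContinuousMap.smul_apply, smul_eq_mul, RingHom.id_apply, mul_left_comm _ c,
          integral_const_mul] }
    (∫ w, ‖f w‖ ∂circleMeasure) (fun Φ => by
      rw [← integral_mul_const]
      refine norm_integral_le_of_norm_le (hf.norm.mul_const _) (ae_of_all _ fun w => ?_)
      rw [norm_mul]
      gcongr
      exact Φ.norm_coe_le_norm _)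

lemma integral_mul_comp_eq_of_zpow {f G : Circle → ℂ} (hf : Integrable f circleMeasure)
    (hG : Integrable G circleMeasure) {b : Circle → Circle} (hb : Measurable b)
    (h : ∀ n : ℤ, ∫ w, f w * (b w : ℂ) ^ n ∂circleMeasure =
      ∫ w, G w * (w : ℂ) ^ n ∂circleMeasure) (Φ : C(Circle, ℂ)) :
    ∫ w, f w * Φ (b w) ∂circleMeasure = ∫ w, G w * Φ w ∂circleMeasure := by
  have hdense := Submodule.dense_iff_topologicalClosure_eq_top.2 span_circleZPow_closure_eq_top
  have heq : integralMulComp hf hb = integralMulComp hG measurable_id :=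
    ContinuousLinearMap.ext_on hdense (by rintro _ ⟨n, rfl⟩; exact h n)
  exact congrArg (fun L => L Φ) heq

lemma tendsto_integral_mul_apprSeq_comp {f : Circle → ℂ} (hf : Integrable f circleMeasure)
    {b : Circle → Circle} (hb : Measurable b) {s : Set Circle} (hs : IsClosed s) :
    Tendsto (fun n => ∫ w, f w * ((hs.apprSeq n (b w) : NNReal) : ℂ) ∂circleMeasure) atTop
      (𝓝 (∫ w in b ⁻¹' s, f w ∂circleMeasure)) := by
  rw [← integral_indicator (hb hs.measurableSet)]
  refine tendsto_integral_of_dominated_convergence (fun w => ‖f w‖) (fun n =>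
    (integrable_mul_comp hf hb ⟨fun w => (hs.apprSeq n w : NNReal), by fun_prop⟩).1) hf.norm
    (fun n => ae_of_all _ fun w => ?_) (ae_of_all _ fun w => ?_)
  · have hle : (hs.apprSeq n (b w) : ℝ) ≤ 1 := HasOuterApproxClosed.apprSeq_apply_le_one hs n (b w)
    rw [norm_mul]
    exact mul_le_of_le_one_right (norm_nonneg _) (by simpa using hle)
  · have hlim := tendsto_pi_nhds.1 (HasOuterApproxClosed.tendsto_apprSeq hs) (b w)
    refine ((((Complex.continuous_ofReal.comp NNReal.continuous_coe).tendsto _).comp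
      hlim).const_mul (f w)).trans_eq ?_
    by_cases hw : b w ∈ s <;> simp [Set.indicator, hw]

lemma setIntegral_preimage_eq {f G : Circle → ℂ} (hf : Integrable f circleMeasure)
    (hG : Integrable G circleMeasure) {b : Circle → Circle} (hb : Measurable b)
    (h : ∀ Φ : C(Circle, ℂ), ∫ w, f w * Φ (b w) ∂circleMeasure = ∫ w, G w * Φ w ∂circleMeasure)
    {A : Set Circle} (hA : MeasurableSet A) :
    ∫ w in b ⁻¹' A, f w ∂circleMeasure = ∫ w in A, G w ∂circleMeasure := by
  have hcompl {s : Set Circle} (hs : MeasurableSet s)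
      (he : ∫ w in b ⁻¹' s, f w ∂circleMeasure = ∫ w in s, G w ∂circleMeasure) :
      ∫ w in b ⁻¹' sᶜ, f w ∂circleMeasure = ∫ w in sᶜ, G w ∂circleMeasure := by
    have hone : ∫ w, f w ∂circleMeasure = ∫ w, G w ∂circleMeasure := by
      simpa using h (ContinuousMap.const _ 1)
    rw [Set.preimage_compl, setIntegral_compl (hb hs) hf, setIntegral_compl hs hG, he, hone]
  have hclosed {s : Set Circle} (hs : IsClosed s) :
      ∫ w in b ⁻¹' s, f w ∂circleMeasure = ∫ w in s, G w ∂circleMeasure :=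
    tendsto_nhds_unique (tendsto_integral_mul_apprSeq_comp hf hb hs) <|
      (tendsto_integral_mul_apprSeq_comp hG measurable_id hs).congr fun n =>
        (h ⟨fun w => (hs.apprSeq n w : NNReal), by fun_prop⟩).symm
  induction A, hA using MeasurableSet.induction_on_open with
  | isOpen U hU =>
    simpa only [compl_compl] using hcompl hU.measurableSet.compl (hclosed hU.isClosed_compl)
  | compl s hs ihs => exact hcompl hs ihs
  | iUnion g g_disj g_meas hg =>
    rw [Set.preimage_iUnion, integral_iUnion (fun i => hb (g_meas i))
      (fun i j hij => (g_disj hij).preimage b) hf.integrableOn,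
      integral_iUnion g_meas g_disj hG.integrableOn]
    simp only [hg]

lemma measurePreserving_of_zpow {b : Circle → Circle} (hb : Measurable b)
    (h : ∀ n : ℤ, ∫ w, (b w : ℂ) ^ n ∂circleMeasure = ∫ w : Circle, (w : ℂ) ^ n ∂circleMeasure) :
    MeasurePreserving b circleMeasure circleMeasure := by
  refine ⟨hb, Measure.ext fun A hA => ?_⟩
  have hone : Integrable (fun _ : Circle => (1 : ℂ)) circleMeasure := integrable_const 1
  have hreal := setIntegral_preimage_eq hone hone hb
    (integral_mul_comp_eq_of_zpow hone hone hb (by simpa using h)) hA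
  simp only [setIntegral_const, Complex.real_smul, mul_one, Complex.ofReal_inj] at hreal
  rw [Measure.map_apply hb hA]
  exact (measureReal_eq_measureReal_iff).1 hreal

/-! ### The boundary map of an inner function -/

/-- Unimodular numbers as points of the circle, with junk value `1`. -/
def toCircle (z : ℂ) : Circle :=
  if h : ‖z‖ = 1 then ⟨z, mem_sphere_zero_iff_norm.2 h⟩ else 1

lemma coe_toCircle {z : ℂ} (h : ‖z‖ = 1) : (toCircle z : ℂ) = z := by
  simp [toCircle, h]

lemma measurable_toCircle : Measurable toCircle := by
  have hcoe : MeasurableEmbedding (fun w : Circle => (w : ℂ)) :=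
    (continuous_circle_coe.isClosedEmbedding Circle.coe_injective).measurableEmbedding
  have hite : (fun w : Circle => (w : ℂ)) ∘ toCircle = fun z => if ‖z‖ = 1 then z else 1 := by
    funext z
    by_cases h : ‖z‖ = 1 <;> simp [toCircle, h]
  rw [← hcoe.measurable_comp_iff, hite]
  exact Measurable.ite (measurableSet_eq_fun measurable_norm measurable_const) measurable_id
    measurable_const

/-- The boundary function of an inner function, as a self-map of the circle. -/
def boundaryMap (η : ℂ → ℂ) (w : Circle) : Circle := toCircle (radialLimit η w)

namespace IsInner

variable {η : ℂ → ℂ}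

lemma measurable_radialLimit (hη : IsInner η) : Measurable (radialLimit η) :=
  HardyCondExp.measurable_radialLimit hη.differentiableOn.continuousOn

lemma measurable_boundaryMap (hη : IsInner η) : Measurable (boundaryMap η) :=
  measurable_toCircle.comp hη.measurable_radialLimit

lemma ae_coe_boundaryMap (hη : IsInner η) :
    ∀ᵐ w ∂circleMeasure, (boundaryMap η w : ℂ) = radialLimit η w := by
  filter_upwards [hη.radial] with w ⟨l, hl, ht⟩
  have hlim : radialLimit η w = l := ht.limUnder_eq
  rw [boundaryMap, hlim, coe_toCircle hl]

lemma hasBoundary (hη : IsInner η) : HasBoundary η (fun w => (boundaryMap η w : ℂ)) := by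
  refine ⟨hη.differentiableOn, ⟨1, hη.norm_le_one⟩, ?_⟩
  filter_upwards [hη.radial, hη.ae_coe_boundaryMap] with w ⟨l, _, ht⟩ hw
  have hlim : radialLimit η w = l := ht.limUnder_eq
  rwa [hw, hlim]

lemma measurePreserving (hη : IsInner η) (hη0 : η 0 = 0) :
    MeasurePreserving (boundaryMap η) circleMeasure circleMeasure :=
  measurePreserving_of_zpow hη.measurable_boundaryMap fun n => by
    rw [hη.hasBoundary.integral_coe_zpow hη0, integral_coe_zpow]

end IsInner

/-- `f` and `G` have the same integrals against all functions of the boundary map, which makes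
`G ∘ η` the conditional expectation of `f`. -/
structure Represents (η : ℂ → ℂ) (f G : Circle → ℂ) : Prop where
  integrable_left : Integrable f circleMeasure
  integrable_right : Integrable G circleMeasure
  integral_eq : ∀ Φ : C(Circle, ℂ),
    ∫ w, f w * Φ (boundaryMap η w) ∂circleMeasure = ∫ w, G w * Φ w ∂circleMeasure

namespace Represents

variable {η : ℂ → ℂ} {f G f' G' : Circle → ℂ}

lemma of_zpow (hη : IsInner η) (hf : Integrable f circleMeasure) (hG : Integrable G circleMeasure)
    (h : ∀ n : ℤ, ∫ w, f w * (boundaryMap η w : ℂ) ^ n ∂circleMeasure =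
      ∫ w, G w * (w : ℂ) ^ n ∂circleMeasure) : Represents η f G :=
  ⟨hf, hG, integral_mul_comp_eq_of_zpow hf hG hη.measurable_boundaryMap h⟩

lemma condExp_ae_eq (hη : IsInner η) (hη0 : η 0 = 0) (h : Represents η f G) :
    circleMeasure[f | sigmaAlgebra η] =ᵐ[circleMeasure] fun w => G (boundaryMap η w) := by
  have hmp := hη.measurePreserving hη0
  have hint : Integrable (fun w => G (boundaryMap η w)) circleMeasure :=
    hmp.integrable_comp_of_integrable h.integrable_right
  refine (ae_eq_condExp_of_forall_setIntegral_eq hη.measurable_radialLimit.comap_le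
    h.integrable_left (fun s _ _ => hint.integrableOn) ?_ ?_).symm
  · rintro s ⟨A, hA, rfl⟩ -
    let B : Set Circle := (fun w : Circle => (w : ℂ)) ⁻¹' A
    have hB : MeasurableSet B := continuous_circle_coe.measurable hA
    have hset : radialLimit η ⁻¹' A =ᵐ[circleMeasure] boundaryMap η ⁻¹' B := by
      filter_upwards [hη.ae_coe_boundaryMap] with w hw
      exact congrArg (· ∈ A) hw.symm
    have hmap := setIntegral_map (μ := circleMeasure) (f := G) hB
      (by rw [hmp.map_eq]; exact h.integrable_right.aestronglyMeasurable)
      hmp.measurable.aemeasurable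
    rw [setIntegral_congr_set hset, setIntegral_congr_set hset, ← hmap, hmp.map_eq,
      setIntegral_preimage_eq h.integrable_left h.integrable_right hmp.measurable h.integral_eq hB]
  · obtain ⟨G₀, hG₀, hG⟩ := h.integrable_right.aestronglyMeasurable
    exact ⟨fun w => G₀ (boundaryMap η w), hG₀.comp_measurable
      (measurable_toCircle.comp (comap_measurable (radialLimit η))),
      hmp.quasiMeasurePreserving.ae_eq_comp hG⟩

lemma mul (hη : IsInner η) (h : Represents η f G) (Ψ : C(Circle, ℂ)) :
    Represents η (fun w => f w * Ψ (boundaryMap η w)) (fun w => G w * Ψ w) := by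
  refine ⟨integrable_mul_comp h.integrable_left hη.measurable_boundaryMap Ψ,
    integrable_mul_comp h.integrable_right measurable_id Ψ, fun Φ => ?_⟩
  simpa only [ContinuousMap.mul_apply, mul_assoc] using h.integral_eq (Ψ * Φ)

lemma add (hη : IsInner η) (h : Represents η f G) (h' : Represents η f' G') :
    Represents η (fun w => f w + f' w) (fun w => G w + G' w) := by
  refine ⟨h.integrable_left.add h'.integrable_left, h.integrable_right.add h'.integrable_right,
    fun Φ => ?_⟩
  simp only [add_mul]
  rw [integral_add (integrable_mul_comp h.integrable_left hη.measurable_boundaryMap Φ)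
      (integrable_mul_comp h'.integrable_left hη.measurable_boundaryMap Φ),
    h.integral_eq, h'.integral_eq]
  exact (integral_add (integrable_mul_comp h.integrable_right measurable_id Φ)
    (integrable_mul_comp h'.integrable_right measurable_id Φ)).symm

end Represents

/-! ### Conditional expectations of polynomials -/

lemma integrable_polynomial (q : Polynomial ℂ) :
    Integrable (fun w : Circle => q.eval (w : ℂ)) circleMeasure :=
  (HasBoundary.id.polynomial q).integrable

lemma integral_polynomial_mul_zpow_neg (q : Polynomial ℂ) (j : ℕ) :
    ∫ w : Circle, q.eval (w : ℂ) * (w : ℂ) ^ (-j : ℤ) ∂circleMeasure = q.coeff j := by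
  induction q using Polynomial.induction_on' with
  | add p q hp hq =>
    simp only [Polynomial.eval_add, add_mul, Polynomial.coeff_add, ← hp, ← hq]
    exact integral_add
      (integrable_mul_comp (integrable_polynomial p) measurable_id (circleZPow (-j)))
      (integrable_mul_comp (integrable_polynomial q) measurable_id (circleZPow (-j)))
  | monomial n a =>
    have hterm (w : Circle) : a * (w : ℂ) ^ n * (w : ℂ) ^ (-j : ℤ) = a * (w : ℂ) ^ (n - j : ℤ) := by
      rw [sub_eq_add_neg, zpow_add₀ w.coe_ne_zero, zpow_natCast, mul_assoc]
    simp only [Polynomial.eval_monomial, hterm, integral_const_mul, integral_coe_zpow,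
      Polynomial.coeff_monomial, sub_eq_zero, Nat.cast_inj, mul_ite, mul_one, mul_zero]

lemma HasBoundary.integral_mul_zpow_eq_zero {F G : ℂ → ℂ} {f : Circle → ℂ} {b : Circle → Circle}
    (hF : HasBoundary F f) (hG : HasBoundary G (fun w => (b w : ℂ))) (hG0 : G 0 = 0) {n : ℤ}
    (hn : 0 < n) : ∫ w, f w * (b w : ℂ) ^ n ∂circleMeasure = 0 := by
  lift n to ℕ using hn.le
  have hn' : n ≠ 0 := by rintro rfl; simp at hn
  simpa [hG0, hn'] using (hF.mul (hG.pow n)).integral_eq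

namespace IsInner

variable {η : ℂ → ℂ}

lemma hasBoundary_div (hη : IsInner η) (hη0 : η 0 = 0) :
    HasBoundary (dslope η 0) (fun w : Circle => (boundaryMap η w : ℂ) / (w : ℂ)) := by
  refine ⟨(Complex.differentiableOn_dslope (ball_mem_nhds 0 one_pos)).2 hη.differentiableOn,
    ⟨1, fun z hz => ?_⟩, ?_⟩
  · simpa using Complex.norm_dslope_le_div_of_mapsTo_ball (R₂ := 1) hη.differentiableOn
      (fun z hz => by simpa [hη0] using hη.norm_le_one z hz) hz
  · filter_upwards [hη.hasBoundary.tendsto] with w hw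
    refine (hw.div (tendsto_ofReal_mul w) w.coe_ne_zero).congr' ?_
    filter_upwards [Ioo_mem_nhdsLT one_pos] with r hr
    have hne : (r : ℂ) * (w : ℂ) ≠ 0 := mul_ne_zero (mod_cast hr.1.ne') w.coe_ne_zero
    simp only [Pi.div_apply]
    rw [dslope_of_ne _ hne, slope_def_field, hη0, sub_zero, sub_zero]

/- The conjugate of the integrand is the boundary function of the analytic function
`z ^ (m - k) * (η z / z) ^ m`, which vanishes at `0`. -/
lemma integral_pow_mul_zpow_neg_eq_zero (hη : IsInner η) (hη0 : η 0 = 0) {k m : ℕ} (hkm : k < m) :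
    ∫ w : Circle, (w : ℂ) ^ k * (boundaryMap η w : ℂ) ^ (-m : ℤ) ∂circleMeasure = 0 := by
  have hanalytic := ((HasBoundary.id.pow (m - k)).mul ((hη.hasBoundary_div hη0).pow m)).integral_eq
  rw [zero_pow (Nat.sub_pos_of_lt hkm).ne', zero_mul] at hanalytic
  rw [← map_zero conj, ← hanalytic, ← integral_conj]
  congr 1
  funext w
  have hw : conj (w : ℂ) = (w : ℂ)⁻¹ := by rw [← Circle.coe_inv_eq_conj, Circle.coe_inv]
  have hb : conj (boundaryMap η w : ℂ) ^ m = (boundaryMap η w : ℂ) ^ (-m : ℤ) := by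
    rw [← conj_coe_zpow, zpow_natCast, map_pow]
  rw [map_mul, map_pow, map_pow, map_div₀, div_pow, hb, hw, inv_pow, inv_pow, div_inv_eq_mul,
    ← pow_sub_mul_pow (w : ℂ) hkm.le]
  have hw0 := w.coe_ne_zero
  field_simp

lemma exists_represents_pow (hη : IsInner η) (hη0 : η 0 = 0) (k : ℕ) :
    ∃ Q : Polynomial ℂ, Represents η (fun w => (w : ℂ) ^ k) (fun w => Q.eval (w : ℂ)) := by
  let c : ℕ → ℂ := fun j =>
    ∫ w : Circle, (w : ℂ) ^ k * (boundaryMap η w : ℂ) ^ (-j : ℤ) ∂circleMeasure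
  let Q : Polynomial ℂ := ∑ j ∈ Finset.range (k + 1), Polynomial.monomial j (c j)
  have hcoeff (j : ℕ) : Q.coeff j = c j := by
    have hc : k < j → c j = 0 := hη.integral_pow_mul_zpow_neg_eq_zero hη0
    simp only [Q, Polynomial.finsetSum_coeff, Polynomial.coeff_monomial, Finset.sum_ite_eq',
      Finset.mem_range, ite_eq_left_iff]
    exact fun hj => (hc (by omega)).symm
  refine ⟨Q, .of_zpow hη (HasBoundary.id.pow k).integrable (integrable_polynomial Q) fun n => ?_⟩
  rcases lt_or_ge 0 n with hn | hn
  · rw [(HasBoundary.id.pow k).integral_mul_zpow_eq_zero hη.hasBoundary hη0 hn,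
      (HasBoundary.id.polynomial Q).integral_mul_zpow_eq_zero (b := fun w => w) HasBoundary.id
        rfl hn]
  · obtain ⟨j, rfl⟩ := Int.exists_eq_neg_ofNat hn
    rw [integral_polynomial_mul_zpow_neg, hcoeff]

lemma exists_represents_polynomial (hη : IsInner η) (hη0 : η 0 = 0) (q : Polynomial ℂ) :
    ∃ Q : Polynomial ℂ, Represents η (fun w => q.eval (w : ℂ)) (fun w => Q.eval (w : ℂ)) := by
  induction q using Polynomial.induction_on' with
  | add p q hp hq =>
    obtain ⟨P, hP⟩ := hp
    obtain ⟨Q, hQ⟩ := hq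
    exact ⟨P + Q, by simpa only [Polynomial.eval_add] using hP.add hη hQ⟩
  | monomial n a =>
    obtain ⟨Q, hQ⟩ := hη.exists_represents_pow hη0 n
    refine ⟨Q * Polynomial.C a, ?_⟩
    simpa [mul_comm] using hQ.mul hη (ContinuousMap.const _ a)

end IsInner

/-! ### A characterization of finite Blaschke products -/

/-- The Blaschke factor with zero `a`, an automorphism of the disc if `‖a‖ < 1`. -/
def blaschkeFactor (a z : ℂ) : ℂ := (z - a) / (1 - conj a * z)

lemma one_sub_conj_mul_ne_zero {a z : ℂ} (ha : ‖a‖ < 1) (hz : ‖z‖ ≤ 1) : 1 - conj a * z ≠ 0 := by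
  intro h
  have hone : ‖conj a * z‖ = 1 := by rw [← sub_eq_zero.1 h, norm_one]
  rw [norm_mul, RCLike.norm_conj] at hone
  nlinarith [norm_nonneg a, norm_nonneg z]

lemma norm_blaschkeFactor_sq {a z : ℂ} (ha : ‖a‖ < 1) (hz : ‖z‖ ≤ 1) :
    ‖blaschkeFactor a z‖ ^ 2 = 1 - (1 - ‖a‖ ^ 2) * (1 - ‖z‖ ^ 2) / ‖1 - conj a * z‖ ^ 2 := by
  have hdiff : ‖1 - conj a * z‖ ^ 2 - ‖z - a‖ ^ 2 = (1 - ‖a‖ ^ 2) * (1 - ‖z‖ ^ 2) := by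
    simp only [← Complex.normSq_eq_norm_sq, Complex.normSq_apply, Complex.sub_re, Complex.sub_im,
      Complex.mul_re, Complex.mul_im, Complex.conj_re, Complex.conj_im, Complex.one_re,
      Complex.one_im]
    ring
  have hne : ‖1 - conj a * z‖ ^ 2 ≠ 0 :=
    pow_ne_zero 2 (norm_ne_zero_iff.2 (one_sub_conj_mul_ne_zero ha hz))
  rw [blaschkeFactor, norm_div, div_pow, ← hdiff, sub_div, div_self hne, sub_sub_cancel]

lemma norm_blaschkeFactor_lt_one {a z : ℂ} (ha : ‖a‖ < 1) (hz : ‖z‖ < 1) :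
    ‖blaschkeFactor a z‖ < 1 := by
  have hne : 0 < ‖1 - conj a * z‖ := norm_pos_iff.2 (one_sub_conj_mul_ne_zero ha hz.le)
  have ha' : 0 < 1 - ‖a‖ ^ 2 := sub_pos.2 (pow_lt_one₀ (norm_nonneg a) ha two_ne_zero)
  have hz' : 0 < 1 - ‖z‖ ^ 2 := sub_pos.2 (pow_lt_one₀ (norm_nonneg z) hz two_ne_zero)
  rw [← sq_lt_one_iff₀ (norm_nonneg _), norm_blaschkeFactor_sq ha hz.le]
  exact sub_lt_self _ (by positivity)

lemma norm_blaschkeFactor_sq_le {ρ : ℝ} (hρ : ρ < 1) {a z : ℂ} (ha : ‖a‖ ≤ ρ) (hz : ‖z‖ ≤ ρ) :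
    ‖blaschkeFactor a z‖ ^ 2 ≤ 1 - (1 - ρ ^ 2) ^ 2 / 4 := by
  have ha1 := ha.trans_lt hρ
  have hz1 := (hz.trans_lt hρ).le
  have hne : 0 < ‖1 - conj a * z‖ := norm_pos_iff.2 (one_sub_conj_mul_ne_zero ha1 hz1)
  have hle : ‖1 - conj a * z‖ ≤ 2 := by
    refine (norm_sub_le _ _).trans ?_
    rw [norm_one, norm_mul, RCLike.norm_conj]
    linarith [mul_le_one₀ ha1.le (norm_nonneg z) hz1]
  have hρ2 : 0 ≤ 1 - ρ ^ 2 := sub_nonneg.2 (pow_le_one₀ ((norm_nonneg a).trans ha) hρ.le)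
  have ha2 : 1 - ρ ^ 2 ≤ 1 - ‖a‖ ^ 2 := by gcongr
  have hz2 : 1 - ρ ^ 2 ≤ 1 - ‖z‖ ^ 2 := by gcongr
  rw [norm_blaschkeFactor_sq ha1 hz1, sq (1 - ρ ^ 2), (by norm_num : (4 : ℝ) = 2 ^ 2)]
  have hnum := mul_le_mul ha2 hz2 hρ2 (hρ2.trans ha2)
  exact sub_le_sub_left (div_le_div₀ ((mul_nonneg hρ2 hρ2).trans hnum) hnum (by positivity)
    (pow_le_pow_left₀ hne.le hle 2)) 1

lemma differentiableOn_blaschkeFactor {a : ℂ} (ha : ‖a‖ < 1) :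
    DifferentiableOn ℂ (blaschkeFactor a) (ball 0 1) :=
  DifferentiableOn.div (by fun_prop) (by fun_prop) fun _ hz =>
    one_sub_conj_mul_ne_zero ha (mem_ball_zero_iff.1 hz).le

lemma mapsTo_blaschkeFactor {a : ℂ} (ha : ‖a‖ < 1) :
    Set.MapsTo (blaschkeFactor a) (ball 0 1) (ball 0 1) := fun _ hz =>
  mem_ball_zero_iff.2 (norm_blaschkeFactor_lt_one ha (mem_ball_zero_iff.1 hz))

lemma blaschkeFactor_neg_blaschkeFactor {a z : ℂ} (ha : ‖a‖ < 1) (hz : ‖z‖ ≤ 1) :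
    blaschkeFactor (-a) (blaschkeFactor a z) = z := by
  have hz' := one_sub_conj_mul_ne_zero ha hz
  have ha' := one_sub_conj_mul_ne_zero ha ha.le
  have hden : 1 - conj (-a) * blaschkeFactor a z = (1 - conj a * a) / (1 - conj a * z) := by
    rw [blaschkeFactor, map_neg]
    field_simp
    ring
  rw [blaschkeFactor, hden, blaschkeFactor, sub_neg_eq_add, div_add' _ _ _ hz',
    div_div_div_cancel_right₀ hz', div_eq_iff ha']
  ring

/- The Schwarz–Pick lemma at a zero. -/
lemma norm_le_norm_blaschkeFactor {η : ℂ → ℂ} (hd : DifferentiableOn ℂ η (ball 0 1))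
    (hb : ∀ z ∈ ball (0 : ℂ) 1, ‖η z‖ ≤ 1) {a : ℂ} (ha : ‖a‖ < 1) (h0 : η a = 0)
    {z : ℂ} (hz : ‖z‖ < 1) : ‖η z‖ ≤ ‖blaschkeFactor a z‖ := by
  have ha' : ‖-a‖ < 1 := by rwa [norm_neg]
  have hschwarz := Complex.norm_le_norm_of_mapsTo_ball (f := η ∘ blaschkeFactor (-a)) (R := 1)
    (hd.comp (differentiableOn_blaschkeFactor ha') (mapsTo_blaschkeFactor ha'))
    (fun ζ hζ => by simpa using hb _ (mapsTo_blaschkeFactor ha' hζ))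
    (by simp [blaschkeFactor, h0]) (norm_blaschkeFactor_lt_one ha hz)
  rwa [Function.comp_apply, blaschkeFactor_neg_blaschkeFactor ha hz.le] at hschwarz

lemma exists_eq_blaschkeFactor_mul {η : ℂ → ℂ} (hd : DifferentiableOn ℂ η (ball 0 1))
    (hb : ∀ z ∈ ball (0 : ℂ) 1, ‖η z‖ ≤ 1) {a : ℂ} (ha : ‖a‖ < 1) (h0 : η a = 0) :
    ∃ θ : ℂ → ℂ, DifferentiableOn ℂ θ (ball 0 1) ∧ (∀ z ∈ ball (0 : ℂ) 1, ‖θ z‖ ≤ 1) ∧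
      ∀ z ∈ ball (0 : ℂ) 1, η z = blaschkeFactor a z * θ z := by
  let θ : ℂ → ℂ := fun z => dslope η a z * (1 - conj a * z)
  have hθd : DifferentiableOn ℂ θ (ball 0 1) :=
    ((Complex.differentiableOn_dslope (isOpen_ball.mem_nhds (mem_ball_zero_iff.2 ha))).2 hd).mul
      (by fun_prop)
  have heq : ∀ z ∈ ball (0 : ℂ) 1, η z = blaschkeFactor a z * θ z := fun z hz => by
    have hne := one_sub_conj_mul_ne_zero ha (mem_ball_zero_iff.1 hz).le
    have hslope := sub_smul_dslope η a z
    rw [h0, sub_zero, smul_eq_mul] at hslope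
    simp only [θ, blaschkeFactor]
    rw [← hslope, div_mul_eq_mul_div, eq_div_iff hne]
    ring
  have hle : ∀ z ∈ ball (0 : ℂ) 1, z ≠ a → ‖θ z‖ ≤ 1 := fun z hz hza => by
    have hz' := mem_ball_zero_iff.1 hz
    have hpick := norm_le_norm_blaschkeFactor hd hb ha h0 hz'
    have hpos : 0 < ‖blaschkeFactor a z‖ := norm_pos_iff.2
      (div_ne_zero (sub_ne_zero.2 hza) (one_sub_conj_mul_ne_zero ha hz'.le))
    rw [heq z hz, norm_mul] at hpick
    exact (mul_le_iff_le_one_right hpos).1 hpick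
  refine ⟨θ, hθd, fun z hz => ?_, heq⟩
  rcases eq_or_ne z a with rfl | hza
  · have hθz : ContinuousAt θ z := hθd.continuousOn.continuousAt (isOpen_ball.mem_nhds hz)
    refine le_of_tendsto (hθz.tendsto.mono_left nhdsWithin_le_nhds : Tendsto θ (𝓝[≠] z) _).norm ?_
    filter_upwards [self_mem_nhdsWithin, nhdsWithin_le_nhds (isOpen_ball.mem_nhds hz)]
      with y hyz hy using hle y hy hyz
  · exact hle z hz hza

lemma IsFiniteBlaschke.of_eq_blaschkeFactor_mul {η θ : ℂ → ℂ} (hθ : IsFiniteBlaschke θ) {a : ℂ}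
    (ha : ‖a‖ < 1) (h : ∀ z ∈ ball (0 : ℂ) 1, η z = blaschkeFactor a z * θ z) :
    IsFiniteBlaschke η := by
  obtain ⟨c, n, b, hc, hb, hθ⟩ := hθ
  refine ⟨c, n + 1, Fin.cons a b, hc, Fin.cases ha hb, fun z hz => ?_⟩
  rw [h z hz, hθ z hz, Fin.prod_univ_succ, blaschkeFactor]
  simp only [Fin.cons_zero, Fin.cons_succ]
  ring

/-- `‖η z‖` is eventually at least `1 - ε` as `‖z‖` tends to `1` in the disc, uniformly in the
direction. -/
def UniformlyUnimodular (η : ℂ → ℂ) : Prop :=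
  ∀ ε : ℝ, 0 < ε → ∃ ρ < (1 : ℝ), ∀ z : ℂ, ρ < ‖z‖ → ‖z‖ < 1 → 1 - ε ≤ ‖η z‖

namespace UniformlyUnimodular

variable {η θ : ℂ → ℂ}

lemma mono (hη : UniformlyUnimodular η) (h : ∀ z ∈ ball (0 : ℂ) 1, ‖η z‖ ≤ ‖θ z‖) :
    UniformlyUnimodular θ := fun ε hε => by
  obtain ⟨ρ, hρ, hle⟩ := hη ε hε
  exact ⟨ρ, hρ, fun z hzρ hz => (hle z hzρ hz).trans (h z (mem_ball_zero_iff.2 hz))⟩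

/- The maximum principle for `1 / η`. -/
lemma one_le_norm_of_ne_zero (hu : UniformlyUnimodular η)
    (hd : DifferentiableOn ℂ η (ball 0 1)) (hne : ∀ z ∈ ball (0 : ℂ) 1, η z ≠ 0) {z : ℂ}
    (hz : z ∈ ball (0 : ℂ) 1) : 1 ≤ ‖η z‖ := by
  refine le_of_forall_sub_le fun ε hε => ?_
  rcases le_or_gt 1 ε with hε1 | hε1
  · exact (sub_nonpos.2 hε1).trans (norm_nonneg _)
  obtain ⟨ρ, hρ, hle⟩ := hu ε hε
  obtain ⟨r, hr, hr1⟩ := exists_between (max_lt hρ (mem_ball_zero_iff.1 hz))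
  obtain ⟨hρr, hzr⟩ := max_lt_iff.1 hr
  have hmax := Complex.norm_le_of_forall_mem_frontier_norm_le (C := (1 - ε)⁻¹) isBounded_ball
    ((hd.inv hne).diffContOnCl_ball (closedBall_subset_ball hr1)) (fun w hw => ?_)
    (subset_closure (mem_ball_zero_iff.2 hzr))
  · rw [Pi.inv_apply, norm_inv] at hmax
    exact (inv_le_inv₀ (norm_pos_iff.2 (hne z hz)) (sub_pos.2 hε1)).1 hmax
  · rw [frontier_ball _ ((norm_nonneg z).trans_lt hzr).ne', mem_sphere_zero_iff_norm] at hw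
    rw [Pi.inv_apply, norm_inv]
    exact inv_anti₀ (sub_pos.2 hε1) (hle w (hw ▸ hρr) (hw ▸ hr1))

lemma const_of_ne_zero (hu : UniformlyUnimodular η) (hd : DifferentiableOn ℂ η (ball 0 1))
    (hb : ∀ z ∈ ball (0 : ℂ) 1, ‖η z‖ ≤ 1) (hne : ∀ z ∈ ball (0 : ℂ) 1, η z ≠ 0) :
    ∃ c : ℂ, ‖c‖ = 1 ∧ ∀ z ∈ ball (0 : ℂ) 1, η z = c := by
  have hone {z : ℂ} (hz : z ∈ ball (0 : ℂ) 1) : ‖η z‖ = 1 :=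
    le_antisymm (hb z hz) (hu.one_le_norm_of_ne_zero hd hne hz)
  have h0 : (0 : ℂ) ∈ ball (0 : ℂ) 1 := mem_ball_self one_pos
  exact ⟨η 0, hone h0, Complex.eqOn_of_isPreconnected_of_isMaxOn_norm
    (convex_ball (0 : ℂ) 1).isPreconnected isOpen_ball hd h0
    fun z hz => (hone hz).trans_le (hone h0).ge⟩

/- Each zero that is divided out multiplies the value at `z₁` by a factor bounded away from `1`, so
that at most `n` divisions are possible. -/
lemma isFiniteBlaschke_of_pow_lt {ρ : ℝ} (hρ : ρ < 1) {z₁ : ℂ} (hz₁ : ‖z₁‖ ≤ ρ) (n : ℕ)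
    {η : ℂ → ℂ} (hd : DifferentiableOn ℂ η (ball 0 1)) (hb : ∀ z ∈ ball (0 : ℂ) 1, ‖η z‖ ≤ 1)
    (hu : UniformlyUnimodular η) (hzero : ∀ z ∈ ball (0 : ℂ) 1, η z = 0 → ‖z‖ ≤ ρ)
    (h : (1 - (1 - ρ ^ 2) ^ 2 / 4) ^ n < ‖η z₁‖ ^ 2) : IsFiniteBlaschke η := by
  have hz₁' : z₁ ∈ ball (0 : ℂ) 1 := mem_ball_zero_iff.2 (hz₁.trans_lt hρ)
  induction n generalizing η with
  | zero =>
    rw [pow_zero] at h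
    exact absurd h (pow_le_one₀ (norm_nonneg _) (hb z₁ hz₁')).not_gt
  | succ n ih =>
    by_cases hne : ∀ z ∈ ball (0 : ℂ) 1, η z ≠ 0
    · obtain ⟨c, hc, hηc⟩ := hu.const_of_ne_zero hd hb hne
      exact ⟨c, 0, Fin.elim0, hc, fun j => j.elim0, fun z hz => by simpa using hηc z hz⟩
    push Not at hne
    obtain ⟨a, ha, ha0⟩ := hne
    have ha1 : ‖a‖ < 1 := mem_ball_zero_iff.1 ha
    obtain ⟨θ, hθd, hθb, hθ⟩ := exists_eq_blaschkeFactor_mul hd hb ha1 ha0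
    have hle : ∀ z ∈ ball (0 : ℂ) 1, ‖η z‖ ≤ ‖θ z‖ := fun z hz => by
      rw [hθ z hz, norm_mul]
      exact mul_le_of_le_one_left (norm_nonneg _)
        (norm_blaschkeFactor_lt_one ha1 (mem_ball_zero_iff.1 hz)).le
    have hfactor := norm_blaschkeFactor_sq_le hρ (hzero a ha ha0) hz₁
    refine .of_eq_blaschkeFactor_mul (ih hθd hθb (hu.mono hle)
      (fun z hz hθz => hzero z hz (by rw [hθ z hz, hθz, mul_zero])) ?_) ha1 hθ
    rw [hθ z₁ hz₁', norm_mul, mul_pow, pow_succ'] at h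
    exact lt_of_mul_lt_mul_left (h.trans_le (mul_le_mul_of_nonneg_right hfactor (sq_nonneg _)))
      ((sq_nonneg _).trans hfactor)

lemma isFiniteBlaschke (hu : UniformlyUnimodular η) (hd : DifferentiableOn ℂ η (ball 0 1))
    (hb : ∀ z ∈ ball (0 : ℂ) 1, ‖η z‖ ≤ 1) : IsFiniteBlaschke η := by
  obtain ⟨ρ, hρ, hle⟩ := hu (1 / 2) (by norm_num)
  obtain ⟨s, hs, hs1⟩ := exists_between (max_lt hρ one_pos)
  obtain ⟨hρs, hs0⟩ := max_lt_iff.1 hs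
  have hnorm : ‖(s : ℂ)‖ = s := by rw [Complex.norm_real, Real.norm_of_nonneg hs0.le]
  have hne : 0 < ‖η s‖ := by linarith [hle s (by rwa [hnorm]) (by rwa [hnorm])]
  have hτ : 1 - (1 - s ^ 2) ^ 2 / 4 < 1 := by
    have : 0 < 1 - s ^ 2 := sub_pos.2 (pow_lt_one₀ hs0.le hs1 two_ne_zero)
    exact sub_lt_self _ (by positivity)
  obtain ⟨n, hn⟩ := exists_pow_lt_of_lt_one (pow_pos hne 2) hτ
  refine isFiniteBlaschke_of_pow_lt hs1 hnorm.le n hd hb hu (fun z hz h0 => ?_) hn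
  by_contra! hlt
  have := hle z (hρs.trans hlt) (mem_ball_zero_iff.1 hz)
  rw [h0, norm_zero] at this
  linarith

end UniformlyUnimodular

/-! ### Integral means of the Cauchy kernel -/

/-- The integral mean `∫ ‖1 - conj a * w‖ ^ (-γ) dm(w)` of a power of the Cauchy kernel. -/
def kernelMean (γ : ℝ) (a : ℂ) : ℝ≥0∞ :=
  ∫⁻ w : Circle, ‖1 - conj a * (w : ℂ)‖ₑ ^ (-γ) ∂circleMeasure

lemma measurable_kernel (γ : ℝ) (a : ℂ) :
    Measurable fun w : Circle => ‖1 - conj a * (w : ℂ)‖ₑ ^ (-γ) := by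
  have : Continuous fun w : Circle => ‖1 - conj a * (w : ℂ)‖ₑ := by fun_prop
  exact this.measurable.pow_const _

lemma kernelMean_eq_norm (γ : ℝ) (a : ℂ) : kernelMean γ a = kernelMean γ (‖a‖ : ℂ) := by
  have hc : conj a * Circle.exp a.arg = ‖a‖ := by
    have hconj : conj a = ‖a‖ * (Circle.exp a.arg : ℂ)⁻¹ := by
      rw [← Circle.coe_inv, Circle.coe_inv_eq_conj, ← Complex.conj_ofReal, ← map_mul,
        Circle.coe_exp, Complex.norm_mul_exp_arg_mul_I]
    rw [hconj, inv_mul_cancel_right₀ (Circle.coe_ne_zero _)]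
  rw [kernelMean, kernelMean, ← lintegral_mul_left_eq_self _ (Circle.exp a.arg)]
  simp only [Circle.coe_mul, ← mul_assoc, hc, Complex.conj_ofReal]

lemma kernelMean_eq_lintegral_Ioc (γ : ℝ) (a : ℂ) (t : ℝ) :
    kernelMean γ a = (ENNReal.ofReal (2 * π))⁻¹ *
      ∫⁻ θ in Set.Ioc t (t + 2 * π), ‖1 - (‖a‖ : ℂ) * Circle.exp θ‖ₑ ^ (-γ) := by
  rw [kernelMean_eq_norm, kernelMean, lintegral_circleMeasure (measurable_kernel _ _) t,
    Complex.conj_ofReal]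

lemma norm_one_sub_ofReal_mul_exp_le {r : ℝ} (hr0 : 0 ≤ r) (hr1 : r ≤ 1) (θ : ℝ) :
    ‖1 - (r : ℂ) * Circle.exp θ‖ ≤ 1 - r + |θ| := by
  have hexp : ‖1 - (Circle.exp θ : ℂ)‖ ≤ |θ| := by
    rw [Circle.coe_exp, norm_sub_rev, mul_comm]
    exact Real.norm_exp_I_mul_ofReal_sub_one_le
  calc ‖1 - (r : ℂ) * Circle.exp θ‖
      = ‖((1 - r : ℝ) : ℂ) + r * (1 - Circle.exp θ)‖ := by push_cast; ring_nf
    _ ≤ (1 - r) + r * ‖1 - (Circle.exp θ : ℂ)‖ := by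
        refine (norm_add_le _ _).trans_eq ?_
        rw [norm_mul, Complex.norm_real, Complex.norm_real, Real.norm_of_nonneg hr0,
          Real.norm_of_nonneg (sub_nonneg.2 hr1)]
    _ ≤ 1 - r + |θ| := by
        gcongr
        exact (mul_le_of_le_one_left (norm_nonneg _) hr1).trans hexp

lemma two_div_pi_mul_abs_le_norm_one_sub_exp {θ : ℝ} (hθ : |θ| ≤ π) :
    2 / π * |θ| ≤ ‖1 - (Circle.exp θ : ℂ)‖ := by
  have hsin := Real.mul_abs_le_abs_sin (x := θ / 2) (by rw [abs_div, abs_two]; linarith)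
  rw [abs_div, abs_two] at hsin
  rw [Circle.coe_exp, norm_sub_rev, mul_comm (θ : ℂ), Complex.norm_exp_I_mul_ofReal_sub_one,
    norm_mul, Real.norm_eq_abs, Real.norm_eq_abs, abs_two]
  linarith

lemma le_norm_one_sub_ofReal_mul_exp {r : ℝ} (hr0 : 0 ≤ r) (hr1 : r ≤ 1) {θ : ℝ} (hθ : |θ| ≤ π) :
    (2 * π)⁻¹ * (1 - r + |θ|) ≤ ‖1 - (r : ℂ) * Circle.exp θ‖ := by
  set k := ‖1 - (r : ℂ) * Circle.exp θ‖
  have hradial : 1 - r ≤ k := by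
    have := norm_sub_norm_le (1 : ℂ) ((r : ℂ) * Circle.exp θ)
    rwa [norm_one, norm_mul, Circle.norm_coe, mul_one, Complex.norm_real,
      Real.norm_of_nonneg hr0] at this
  have htangential : ‖1 - (Circle.exp θ : ℂ)‖ ≤ k + (1 - r) :=
    calc ‖1 - (Circle.exp θ : ℂ)‖
        = ‖(1 - (r : ℂ) * Circle.exp θ) - ((1 - r : ℝ) : ℂ) * Circle.exp θ‖ := by
          push_cast; ring_nf
      _ ≤ k + (1 - r) := by
          refine (norm_sub_le _ _).trans_eq ?_
          rw [norm_mul _ (Circle.exp θ : ℂ), Circle.norm_coe, mul_one, Complex.norm_real,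
            Real.norm_of_nonneg (sub_nonneg.2 hr1)]
  have habs : |θ| ≤ π * k := by
    have := two_div_pi_mul_abs_le_norm_one_sub_exp hθ
    rw [div_mul_eq_mul_div, div_le_iff₀ Real.pi_pos] at this
    nlinarith [Real.pi_pos]
  rw [inv_mul_le_iff₀ Real.two_pi_pos]
  nlinarith [Real.pi_gt_three]

lemma le_kernelMean {γ : ℝ} (hγ : 0 ≤ γ) {a : ℂ} (ha : ‖a‖ < 1) :
    ENNReal.ofReal ((2 * π)⁻¹ * 2 ^ (-γ) * (1 - ‖a‖) ^ (1 - γ)) ≤ kernelMean γ a := by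
  have hd : 0 < 1 - ‖a‖ := sub_pos.2 ha
  have hbound : ∀ θ ∈ Set.Ioc 0 (1 - ‖a‖), ENNReal.ofReal (2 * (1 - ‖a‖)) ^ (-γ) ≤
      ‖1 - (‖a‖ : ℂ) * Circle.exp θ‖ₑ ^ (-γ) := fun θ hθ => by
    rw [ENNReal.rpow_neg, ENNReal.rpow_neg, ← ofReal_norm]
    refine ENNReal.inv_le_inv.2 (ENNReal.rpow_le_rpow (ENNReal.ofReal_le_ofReal ?_) hγ)
    have := norm_one_sub_ofReal_mul_exp_le (norm_nonneg a) ha.le θ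
    rw [abs_of_pos hθ.1] at this
    linarith [hθ.2]
  calc ENNReal.ofReal ((2 * π)⁻¹ * 2 ^ (-γ) * (1 - ‖a‖) ^ (1 - γ))
      = (ENNReal.ofReal (2 * π))⁻¹ * ∫⁻ _ in Set.Ioc 0 (1 - ‖a‖),
          ENNReal.ofReal (2 * (1 - ‖a‖)) ^ (-γ) := by
        rw [setLIntegral_const, Real.volume_Ioc, sub_zero,
          ← ENNReal.ofReal_inv_of_pos Real.two_pi_pos, ENNReal.ofReal_rpow_of_pos (by positivity),
          ← ENNReal.ofReal_mul (by positivity), ← ENNReal.ofReal_mul (by positivity),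
          Real.mul_rpow zero_le_two hd.le, sub_eq_neg_add 1 γ, Real.rpow_add hd, Real.rpow_one]
        ring_nf
    _ ≤ (ENNReal.ofReal (2 * π))⁻¹ * ∫⁻ θ in Set.Ioc 0 (0 + 2 * π),
          ‖1 - (‖a‖ : ℂ) * Circle.exp θ‖ₑ ^ (-γ) := by
        have hsub : Set.Ioc 0 (1 - ‖a‖) ⊆ Set.Ioc 0 (0 + 2 * π) :=
          Set.Ioc_subset_Ioc_right (by linarith [norm_nonneg a, Real.pi_gt_three])
        exact mul_le_mul_right
          ((setLIntegral_mono' measurableSet_Ioc hbound).trans (lintegral_mono_set hsub)) _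
    _ = kernelMean γ a := (kernelMean_eq_lintegral_Ioc γ a 0).symm

lemma integral_add_abs_rpow_neg {γ : ℝ} (hγ : 1 < γ) {d : ℝ} (hd : 0 < d) :
    ∫ x : ℝ, (d + |x|) ^ (-γ) = 2 * (d ^ (1 - γ) / (γ - 1)) := by
  have hshift := (measurePreserving_add_left volume d).setIntegral_preimage_emb
    (measurableEmbedding_addLeft d) (fun x => x ^ (-γ)) (Set.Ioi d)
  rw [Set.preimage_const_add_Ioi, sub_self] at hshift
  rw [integral_comp_abs (f := fun x => (d + x) ^ (-γ)), hshift,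
    integral_Ioi_rpow_of_lt (by linarith) hd, neg_add_eq_sub, ← neg_sub γ 1, neg_div_neg_eq]

lemma lintegral_add_abs_rpow_neg {γ : ℝ} (hγ : 1 < γ) {d : ℝ} (hd : 0 < d) :
    ∫⁻ x : ℝ, ENNReal.ofReal (d + |x|) ^ (-γ) = ENNReal.ofReal (2 * (d ^ (1 - γ) / (γ - 1))) := by
  have hpos : 0 < 2 * (d ^ (1 - γ) / (γ - 1)) := by
    have := sub_pos.2 hγ
    positivity
  rw [← integral_add_abs_rpow_neg hγ hd] at hpos ⊢
  rw [ofReal_integral_eq_lintegral_ofReal (.of_integral_ne_zero hpos.ne')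
    (ae_of_all _ fun x => by positivity)]
  exact lintegral_congr fun x => ENNReal.ofReal_rpow_of_pos (by positivity)

lemma kernelMean_le {γ : ℝ} (hγ : 1 < γ) {a : ℂ} (ha : ‖a‖ < 1) :
    kernelMean γ a ≤
      ENNReal.ofReal ((2 * π)⁻¹ * (2 * π) ^ γ * (2 / (γ - 1)) * (1 - ‖a‖) ^ (1 - γ)) := by
  have hd : 0 < 1 - ‖a‖ := sub_pos.2 ha
  have hbound : ∀ θ ∈ Set.Ioc (-π) (-π + 2 * π), ‖1 - (‖a‖ : ℂ) * Circle.exp θ‖ₑ ^ (-γ) ≤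
      ENNReal.ofReal ((2 * π) ^ γ) * ENNReal.ofReal (1 - ‖a‖ + |θ|) ^ (-γ) := fun θ hθ => by
    have hle := le_norm_one_sub_ofReal_mul_exp (norm_nonneg a) ha.le
      (abs_le.2 ⟨hθ.1.le, by linarith [hθ.2]⟩ : |θ| ≤ π)
    rw [← ofReal_norm, ENNReal.ofReal_rpow_of_pos (by positivity : 0 < 1 - ‖a‖ + |θ|),
      ← ENNReal.ofReal_mul (by positivity), ENNReal.ofReal_rpow_of_pos
        ((by positivity : 0 < (2 * π)⁻¹ * (1 - ‖a‖ + |θ|)).trans_le hle)]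
    refine ENNReal.ofReal_le_ofReal ?_
    calc ‖1 - (‖a‖ : ℂ) * Circle.exp θ‖ ^ (-γ)
        ≤ ((2 * π)⁻¹ * (1 - ‖a‖ + |θ|)) ^ (-γ) :=
          Real.rpow_le_rpow_of_nonpos (by positivity) hle (by linarith)
      _ = (2 * π) ^ γ * (1 - ‖a‖ + |θ|) ^ (-γ) := by
          rw [Real.mul_rpow (by positivity) (by positivity), Real.inv_rpow (by positivity),
            Real.rpow_neg (by positivity), inv_inv]
  calc kernelMean γ a
      = (ENNReal.ofReal (2 * π))⁻¹ * ∫⁻ θ in Set.Ioc (-π) (-π + 2 * π),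
          ‖1 - (‖a‖ : ℂ) * Circle.exp θ‖ₑ ^ (-γ) := kernelMean_eq_lintegral_Ioc γ a (-π)
    _ ≤ (ENNReal.ofReal (2 * π))⁻¹ * ∫⁻ θ : ℝ,
          ENNReal.ofReal ((2 * π) ^ γ) * ENNReal.ofReal (1 - ‖a‖ + |θ|) ^ (-γ) := by
        exact mul_le_mul_right
          ((setLIntegral_mono' measurableSet_Ioc hbound).trans (setLIntegral_le_lintegral _ _)) _
    _ = ENNReal.ofReal ((2 * π)⁻¹ * (2 * π) ^ γ * (2 / (γ - 1)) * (1 - ‖a‖) ^ (1 - γ)) := by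
        rw [lintegral_const_mul' _ _ ENNReal.ofReal_ne_top, lintegral_add_abs_rpow_neg hγ hd,
          ← ENNReal.ofReal_mul (by positivity), ← ENNReal.ofReal_inv_of_pos Real.two_pi_pos,
          ← ENNReal.ofReal_mul (by positivity)]
        ring_nf

lemma exists_kernelMean_bounds {γ : ℝ} (hγ : 1 < γ) : ∃ c C : ℝ, 0 < c ∧ 0 < C ∧
    ∀ a : ℂ, ‖a‖ < 1 → ENNReal.ofReal (c * (1 - ‖a‖) ^ (1 - γ)) ≤ kernelMean γ a ∧
      kernelMean γ a ≤ ENNReal.ofReal (C * (1 - ‖a‖) ^ (1 - γ)) := by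
  have := sub_pos.2 hγ
  exact ⟨_, _, by positivity, by positivity, fun a ha =>
    ⟨le_kernelMean (by linarith) ha, kernelMean_le hγ ha⟩⟩

/-! ### The operator norm -/

section OpNorm

variable {p : ℝ≥0∞} {X : Submodule ℂ (Lp ℂ p circleMeasure)}

lemma opNorm_nonneg (T : X →ₗ[ℂ] X) : 0 ≤ opNorm T := by
  refine Real.sSup_nonneg ?_
  rintro r ⟨f, -, rfl⟩
  exact ENNReal.toReal_nonneg

lemma opNorm_le {T : X →ₗ[ℂ] X} {C : ℝ} (hC0 : 0 ≤ C)
    (hC : ∀ f : X, ‖(T f : Lp ℂ p circleMeasure)‖ ≤ C * ‖(f : Lp ℂ p circleMeasure)‖) :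
    opNorm T ≤ C := by
  refine Real.sSup_le ?_ hC0
  rintro r ⟨f, hf, rfl⟩
  simpa only [hf, mul_one] using hC f

/- For `p < 1` the space `L^p` is not a normed space, so that `norm_smul` does not apply. -/
lemma norm_const_smul_Lp {α E : Type*} [MeasurableSpace α] {μ : Measure α} [NormedAddCommGroup E]
    [NormedSpace ℂ E] (c : ℂ) (f : Lp E p μ) : ‖c • f‖ = ‖c‖ * ‖f‖ := by
  rw [Lp.norm_def, Lp.norm_def, eLpNorm_congr_ae (Lp.coeFn_smul c f), eLpNorm_const_smul,
    ENNReal.toReal_mul, toReal_enorm]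

namespace IsBoundedCondExp

variable {η : ℂ → ℂ} {T : X →ₗ[ℂ] X}

lemma norm_le_opNorm (hT : IsBoundedCondExp η X T) (f : X) :
    ‖(T f : Lp ℂ p circleMeasure)‖ ≤ opNorm T * ‖(f : Lp ℂ p circleMeasure)‖ := by
  obtain ⟨C, hC⟩ := hT.1
  set r := ‖(f : Lp ℂ p circleMeasure)‖ with hr
  rcases (show 0 ≤ r from ENNReal.toReal_nonneg).eq_or_lt with h0 | hpos
  · simpa only [← hr, ← h0, mul_zero] using hC f
  let u : X := ((r⁻¹ : ℝ) : ℂ) • f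
  have hscale (g : Lp ℂ p circleMeasure) : ‖((r⁻¹ : ℝ) : ℂ) • g‖ = r⁻¹ * ‖g‖ := by
    rw [norm_const_smul_Lp, Complex.norm_real, Real.norm_of_nonneg (inv_nonneg.2 hpos.le)]
  have hu : ‖(u : Lp ℂ p circleMeasure)‖ = 1 := (hscale _).trans (inv_mul_cancel₀ hpos.ne')
  have hbdd : BddAbove {s : ℝ | ∃ g : X, ‖(g : Lp ℂ p circleMeasure)‖ = 1 ∧
      s = ‖(T g : Lp ℂ p circleMeasure)‖} := by
    refine ⟨C, ?_⟩
    rintro s ⟨g, hg, rfl⟩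
    simpa only [hg, mul_one] using hC g
  have hTu : ‖(T u : Lp ℂ p circleMeasure)‖ ≤ opNorm T := le_csSup hbdd ⟨u, hu, rfl⟩
  rwa [map_smul, Submodule.coe_smul, hscale, inv_mul_le_iff₀ hpos, mul_comm] at hTu

lemma eLpNorm_apply_le (hT : IsBoundedCondExp η X T) (f : X) :
    eLpNorm (T f : Lp ℂ p circleMeasure) p circleMeasure ≤
      ENNReal.ofReal (opNorm T) * eLpNorm (f : Lp ℂ p circleMeasure) p circleMeasure := by
  have hle := hT.norm_le_opNorm f
  rwa [Lp.norm_def, Lp.norm_def, ← ENNReal.toReal_ofReal (opNorm_nonneg T), ← ENNReal.toReal_mul,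
    ENNReal.toReal_le_toReal (Lp.eLpNorm_ne_top _)
      (ENNReal.mul_ne_top ENNReal.ofReal_ne_top (Lp.eLpNorm_ne_top _))] at hle

end IsBoundedCondExp

end OpNorm

lemma eLpNorm_ofReal_rpow {p : ℝ} (hp : 0 < p) (f : Circle → ℂ) :
    eLpNorm f (ENNReal.ofReal p) circleMeasure ^ p = ∫⁻ w, ‖f w‖ₑ ^ p ∂circleMeasure := by
  rw [eLpNorm_eq_lintegral_rpow_enorm_toReal (by simpa using hp) ENNReal.ofReal_ne_top,
    ENNReal.toReal_ofReal hp.le, ← ENNReal.rpow_mul, one_div_mul_cancel hp.ne', ENNReal.rpow_one]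

lemma IsBoundedCondExp.lintegral_rpow_le {η : ℂ → ℂ} {p : ℝ}
    {X : Submodule ℂ (Lp ℂ (ENNReal.ofReal p) circleMeasure)} {T : X →ₗ[ℂ] X}
    (hT : IsBoundedCondExp η X T) (hη : IsInner η) (hη0 : η 0 = 0) (hp : 0 < p)
    {f G : Circle → ℂ} (hf : MemLp f (ENNReal.ofReal p) circleMeasure) (hfX : hf.toLp f ∈ X)
    (hG : Represents η f G) :
    ∫⁻ w, ‖G w‖ₑ ^ p ∂circleMeasure ≤
      ENNReal.ofReal (opNorm T) ^ p * ∫⁻ w, ‖f w‖ₑ ^ p ∂circleMeasure := by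
  have hcoe := hf.coeFn_toLp
  have hTf : (T ⟨_, hfX⟩ : Lp ℂ (ENNReal.ofReal p) circleMeasure) =ᵐ[circleMeasure]
      G ∘ boundaryMap η :=
    ((hT.2 ⟨_, hfX⟩ (hG.integrable_left.congr hcoe.symm)).trans (condExp_congr_ae hcoe)).trans
      (hG.condExp_ae_eq hη hη0)
  have hle := hT.eLpNorm_apply_le ⟨_, hfX⟩
  rw [eLpNorm_congr_ae hcoe, eLpNorm_congr_ae hTf, eLpNorm_comp_measurePreserving
    hG.integrable_right.aestronglyMeasurable (hη.measurePreserving hη0)] at hle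
  have hpow := ENNReal.rpow_le_rpow hle hp.le
  rwa [ENNReal.mul_rpow_of_nonneg _ _ hp.le, eLpNorm_ofReal_rpow hp, eLpNorm_ofReal_rpow hp]
    at hpow

/-! ### Boundedness forces a derivative estimate -/

/-- The kernel that reproduces the derivative of analytic functions at `a`:
`∫ conj (derivKernel a) * f dm = f' a`. -/
def derivKernel (a z : ℂ) : ℂ := z / (1 - conj a * z) ^ 2

lemma hasBoundary_derivKernel {a : ℂ} (ha : ‖a‖ < 1) :
    HasBoundary (derivKernel a) (fun w => derivKernel a w) := by
  refine .of_diffContOnCl (DifferentiableOn.diffContOnCl ?_)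
  rw [closure_ball _ one_ne_zero]
  exact DifferentiableOn.div (by fun_prop) (by fun_prop) fun z hz =>
    pow_ne_zero 2 (one_sub_conj_mul_ne_zero ha (mem_closedBall_zero_iff.1 hz))

lemma derivKernel_eq_conj (a : ℂ) (w : Circle) :
    derivKernel a w = conj ((w : ℂ) / ((w : ℂ) - a) ^ 2) := by
  have hw : conj (w : ℂ) = (w : ℂ)⁻¹ := by rw [← Circle.coe_inv_eq_conj, Circle.coe_inv]
  have hw0 := w.coe_ne_zero
  have hsub : (w : ℂ)⁻¹ - conj a = (1 - conj a * w) / w := by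
    rw [sub_div, mul_div_cancel_right₀ _ hw0, one_div]
  rw [derivKernel, map_div₀, map_pow, map_sub, hw, hsub, div_pow, div_div_eq_mul_div, sq (w : ℂ),
    inv_mul_cancel_left₀ hw0]

lemma HasBoundary.integral_derivKernel_mul_inv_pow {F : ℂ → ℂ} {b : Circle → Circle}
    (hF : HasBoundary F (fun w => (b w : ℂ))) {a : ℂ} (ha : ‖a‖ < 1) (k : ℕ) :
    ∫ w : Circle, derivKernel a w * (b w : ℂ) ^ (-k : ℤ) ∂circleMeasure =
      conj (k * F a ^ (k - 1) * deriv F a) := by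
  have hd : DifferentiableAt ℂ F a :=
    hF.differentiableOn.differentiableAt (isOpen_ball.mem_nhds (mem_ball_zero_iff.2 ha))
  rw [← deriv_fun_pow hd, ← (hF.pow k).integral_mul_eq_deriv ha, ← integral_conj]
  simp only [map_mul, ← derivKernel_eq_conj, ← conj_coe_zpow, zpow_natCast]

lemma HasBoundary.integral_derivKernel_mul_pow {F : ℂ → ℂ} {b : Circle → ℂ}
    (hF : HasBoundary F b) {a : ℂ} (ha : ‖a‖ < 1) (k : ℕ) :
    ∫ w : Circle, derivKernel a w * b w ^ k ∂circleMeasure = 0 := by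
  rw [((hasBoundary_derivKernel ha).mul (hF.pow k)).integral_eq, derivKernel, zero_div, zero_mul]

lemma IsInner.norm_le {η : ℂ → ℂ} (hη : IsInner η) (hη0 : η 0 = 0) {a : ℂ} (ha : ‖a‖ < 1) :
    ‖η a‖ ≤ ‖a‖ :=
  Complex.norm_le_norm_of_mapsTo_ball hη.differentiableOn
    (fun z hz => by simpa using hη.norm_le_one z hz) hη0 ha

lemma IsInner.represents_derivKernel {η : ℂ → ℂ} (hη : IsInner η) (hη0 : η 0 = 0) {a : ℂ}
    (ha : ‖a‖ < 1) : Represents η (fun w => derivKernel a w)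
      (fun w => conj (deriv η a) * derivKernel (η a) w) := by
  have hb : ‖η a‖ < 1 := (hη.norm_le hη0 ha).trans_lt ha
  refine .of_zpow hη (hasBoundary_derivKernel ha).integrable
    ((hasBoundary_derivKernel hb).integrable.const_mul _) fun n => ?_
  simp only [mul_assoc, integral_const_mul]
  obtain ⟨k, rfl | rfl⟩ := n.eq_nat_or_neg
  · simp only [zpow_natCast]
    rw [hη.hasBoundary.integral_derivKernel_mul_pow ha,
      HasBoundary.id.integral_derivKernel_mul_pow hb, mul_zero]
  · rw [hη.hasBoundary.integral_derivKernel_mul_inv_pow ha,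
      HasBoundary.id.integral_derivKernel_mul_inv_pow (b := fun w => w) hb, deriv_id'', mul_one,
      ← map_mul, mul_comm]

lemma continuous_inv_one_sub_conj_mul {b : ℂ} (hb : ‖b‖ < 1) :
    Continuous fun w : Circle => (1 - conj b * (w : ℂ))⁻¹ :=
  Continuous.inv₀ (by fun_prop) fun w => one_sub_conj_mul_ne_zero hb (Circle.norm_coe w).le

lemma HasBoundary.inv_one_sub_conj_mul {F : ℂ → ℂ} {f : Circle → ℂ} (hF : HasBoundary F f)
    (hF1 : ∀ z ∈ ball (0 : ℂ) 1, ‖F z‖ ≤ 1) {b : ℂ} (hb : ‖b‖ < 1) :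
    HasBoundary (fun z => (1 - conj b * F z)⁻¹) (fun w => (1 - conj b * f w)⁻¹) := by
  refine ⟨((hF.differentiableOn.const_mul _).const_sub _).inv fun z hz =>
    one_sub_conj_mul_ne_zero hb (hF1 z hz), ⟨(1 - ‖b‖)⁻¹, fun z hz => ?_⟩, ?_⟩
  · have hle : 1 - ‖b‖ ≤ ‖1 - conj b * F z‖ := by
      refine le_trans ?_ (norm_sub_norm_le _ _)
      rw [norm_one, norm_mul, RCLike.norm_conj]
      exact sub_le_sub_left (mul_le_of_le_one_right (norm_nonneg _) (hF1 z hz)) _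
    rw [norm_inv]
    exact inv_anti₀ (sub_pos.2 hb) hle
  · filter_upwards [hF.tendsto, hF.ae_norm_le hF1] with w hw hw1
    exact ((hw.const_mul _).const_sub _).inv₀ (one_sub_conj_mul_ne_zero hb hw1)

lemma enorm_derivKernel_mul_inv_pow_rpow {a b : ℂ} (ha : ‖a‖ < 1) (hb : ‖b‖ < 1) {p : ℝ}
    (hp : 0 ≤ p) (N : ℕ) (w z : Circle) :
    ‖derivKernel a w * (1 - conj b * (z : ℂ))⁻¹ ^ N‖ₑ ^ p =
      ‖1 - conj a * (w : ℂ)‖ₑ ^ (-(2 * p)) * ‖1 - conj b * (z : ℂ)‖ₑ ^ (-(N * p)) := by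
  have hwa := one_sub_conj_mul_ne_zero ha (Circle.norm_coe w).le
  have hzb := one_sub_conj_mul_ne_zero hb (Circle.norm_coe z).le
  have hw : ‖(w : ℂ)‖ₑ = 1 := by rw [← ofReal_norm, Circle.norm_coe, ENNReal.ofReal_one]
  rw [derivKernel, div_eq_mul_inv, enorm_mul, enorm_mul, enorm_pow, enorm_inv hzb,
    enorm_inv (pow_ne_zero 2 hwa), enorm_pow, hw, one_mul, ENNReal.mul_rpow_of_nonneg _ _ hp,
    ENNReal.inv_rpow, ← ENNReal.rpow_natCast_mul, ← ENNReal.rpow_natCast_mul, ENNReal.inv_rpow,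
    ENNReal.rpow_neg, ENNReal.rpow_neg, Nat.cast_ofNat]

section

variable {η : ℂ → ℂ} {p q : ℝ} {N : ℕ} {a : ℂ}

lemma lintegral_derivKernel_mul_inv_pow {b : ℂ} (hb : ‖b‖ < 1) (hp : 0 ≤ p)
    (hq : q = p * (1 + N / 2)) :
    ∫⁻ w : Circle, ‖derivKernel b w * (1 - conj b * (w : ℂ))⁻¹ ^ N‖ₑ ^ p ∂circleMeasure =
      kernelMean (2 * q) b := by
  refine lintegral_congr fun w => ?_
  have hne := one_sub_conj_mul_ne_zero hb (Circle.norm_coe w).le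
  rw [enorm_derivKernel_mul_inv_pow_rpow hb hb hp,
    ← ENNReal.rpow_add _ _ (enorm_ne_zero.2 hne) enorm_ne_top, hq]
  ring_nf

/- Hölder's inequality with the exponents `q / p` and `q / (q - p)`; composing with the
measure-preserving boundary map does not change the second mean. -/
lemma lintegral_derivKernel_mul_comp_inv_pow_le (hη : IsInner η) (hη0 : η 0 = 0) {b : ℂ}
    (ha : ‖a‖ < 1) (hb : ‖b‖ < 1) (hp : 0 < p) (hq : q = p * (1 + N / 2)) :
    ∫⁻ w : Circle, ‖derivKernel a w * (1 - conj b * (boundaryMap η w : ℂ))⁻¹ ^ N‖ₑ ^ p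
        ∂circleMeasure ≤
      kernelMean (2 * q) a ^ (p / q) * kernelMean (2 * q) b ^ (1 - p / q) := by
  have hmp := hη.measurePreserving hη0
  have hpq : p ≤ q := by
    rw [hq]
    exact le_mul_of_one_le_right hp.le (le_add_of_nonneg_right (by positivity))
  have hq0 : 0 < q := hp.trans_le hpq
  have hcomp : kernelMean (2 * q) b = ∫⁻ w : Circle,
      ‖1 - conj b * (boundaryMap η w : ℂ)‖ₑ ^ (-(2 * q)) ∂circleMeasure :=
    (hmp.lintegral_comp (measurable_kernel (2 * q) b)).symm
  rw [hcomp, kernelMean]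
  refine le_of_eq_of_le (lintegral_congr fun w => ?_)
    (ENNReal.lintegral_mul_norm_pow_le (measurable_kernel (2 * q) a).aemeasurable
      ((measurable_kernel (2 * q) b).comp hmp.measurable).aemeasurable (by positivity)
      (sub_nonneg.2 ((div_le_one hq0).2 hpq)) (by ring))
  have hexp₁ : -(2 * q) * (p / q) = -(2 * p) := by field_simp
  have hexp₂ : -(2 * q) * (1 - p / q) = -(N * p) := by
    rw [mul_one_sub, hexp₁, hq]
    ring
  rw [enorm_derivKernel_mul_inv_pow_rpow ha hb hp.le, Function.comp_apply, ← ENNReal.rpow_mul,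
    ← ENNReal.rpow_mul, hexp₁, hexp₂]

/- The test function is `w (1 - ā w)⁻² (1 - conj (η a) η)⁻ᴺ`. Its conditional expectation is
explicit, and `N` is at our disposal to make the exponent `2 q` exceed `1`, where the means of the
Cauchy kernel become unbounded. -/
lemma IsInner.enorm_deriv_rpow_mul_kernelMean_le_of_lintegral_le (hη : IsInner η) (hη0 : η 0 = 0)
    (hp : 0 < p) {C : ℝ≥0∞} (hC : ∀ (F : ℂ → ℂ) (f G : Circle → ℂ), HasBoundary F f →
      Represents η f G → ∫⁻ w, ‖G w‖ₑ ^ p ∂circleMeasure ≤ C * ∫⁻ w, ‖f w‖ₑ ^ p ∂circleMeasure)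
    (hq : q = p * (1 + N / 2)) (ha : ‖a‖ < 1) :
    ‖deriv η a‖ₑ ^ p * kernelMean (2 * q) (η a) ≤
      C * (kernelMean (2 * q) a ^ (p / q) * kernelMean (2 * q) (η a) ^ (1 - p / q)) := by
  have hb : ‖η a‖ < 1 := (hη.norm_le hη0 ha).trans_lt ha
  let Ψ : C(Circle, ℂ) := ⟨fun w => (1 - conj (η a) * (w : ℂ))⁻¹ ^ N,
    (continuous_inv_one_sub_conj_mul hb).pow N⟩
  have hle := hC _ _ _ ((hasBoundary_derivKernel ha).mul
    ((hη.hasBoundary.inv_one_sub_conj_mul hη.norm_le_one hb).pow N))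
    ((hη.represents_derivKernel hη0 ha).mul hη Ψ)
  have hleft : ∫⁻ w : Circle, ‖conj (deriv η a) * derivKernel (η a) w * Ψ w‖ₑ ^ p ∂circleMeasure =
      ‖deriv η a‖ₑ ^ p * kernelMean (2 * q) (η a) := by
    simp only [mul_assoc, enorm_mul (conj (deriv η a)), ENNReal.mul_rpow_of_nonneg _ _ hp.le,
      RCLike.enorm_conj]
    rw [lintegral_const_mul' _ _ (ENNReal.rpow_ne_top_of_nonneg hp.le enorm_ne_top)]
    exact congrArg _ (lintegral_derivKernel_mul_inv_pow hb hp.le hq)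
  rw [← hleft]
  exact hle.trans (mul_le_mul_right
    (lintegral_derivKernel_mul_comp_inv_pow_le hη hη0 ha hb hp hq) _)

end

lemma rpow_mul_le_of_rpow_mul_le {x y A B : ℝ≥0∞} {p q : ℝ} (hp : 0 < p) (hq : 0 < q)
    (hB0 : B ≠ 0) (hBt : B ≠ ⊤) (h : x ^ p * B ≤ y ^ p * (A ^ (p / q) * B ^ (1 - p / q))) :
    x ^ q * B ≤ y ^ q * A := by
  have hpq : 0 < p / q := div_pos hp hq
  have hqpq : q * (p / q) = p := mul_div_cancel₀ p hq.ne'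
  have hB : B = B ^ (p / q) * B ^ (1 - p / q) := by
    rw [← ENNReal.rpow_add _ _ hB0 hBt, add_sub_cancel, ENNReal.rpow_one]
  rw [← ENNReal.rpow_le_rpow_iff hpq, ENNReal.mul_rpow_of_nonneg _ _ hpq.le,
    ENNReal.mul_rpow_of_nonneg _ _ hpq.le, ← ENNReal.rpow_mul, ← ENNReal.rpow_mul, hqpq,
    ← ENNReal.mul_le_mul_iff_left (ENNReal.rpow_pos hB0.bot_lt hBt).ne'
      (ENNReal.rpow_ne_top_of_ne_zero hB0 hBt),
    mul_assoc, ← hB, mul_assoc]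
  exact h

lemma exists_nat_half_lt_mul_lt_one {p : ℝ} (hp0 : 0 < p) (hp1 : p < 1) :
    ∃ N : ℕ, 1 / 2 < p * (1 + N / 2) ∧ p * (1 + N / 2) < 1 := by
  classical
  have hex : ∃ N : ℕ, 1 / 2 < p * (1 + N / 2) := by
    obtain ⟨N, hN⟩ := exists_nat_gt (1 / p)
    rw [div_lt_iff₀ hp0] at hN
    exact ⟨N, by linarith⟩
  refine ⟨Nat.find hex, Nat.find_spec hex, ?_⟩
  rcases Nat.eq_zero_or_pos (Nat.find hex) with h | h
  · rw [h]
    simpa using hp1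
  · have hmin := Nat.find_min hex (Nat.sub_lt h one_pos)
    rw [Nat.cast_pred h, not_lt] at hmin
    linarith

lemma IsBoundedCondExp.exists_enorm_deriv_rpow_mul_kernelMean_le {η : ℂ → ℂ} (hη : IsInner η)
    (hη0 : η 0 = 0) {p : ℝ} (hp0 : 0 < p) (hp1 : p < 1)
    {T : hardy (ENNReal.ofReal p) →ₗ[ℂ] hardy (ENNReal.ofReal p)} (hT : IsBoundedCondExp η _ T) :
    ∃ q : ℝ, 1 / 2 < q ∧ q < 1 ∧ ∃ C : ℝ≥0, ∀ a : ℂ, ‖a‖ < 1 →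
      ‖deriv η a‖ₑ ^ q * kernelMean (2 * q) (η a) ≤ C ^ q * kernelMean (2 * q) a := by
  have hC (F : ℂ → ℂ) (f G : Circle → ℂ) (hF : HasBoundary F f) (hG : Represents η f G) :
      ∫⁻ w, ‖G w‖ₑ ^ p ∂circleMeasure ≤
        (opNorm T).toNNReal ^ p * ∫⁻ w, ‖f w‖ₑ ^ p ∂circleMeasure :=
    hT.lintegral_rpow_le hη hη0 hp0 (hF.memLp _)
      (toLp_mem_hardy _ (hF.polyApprox ENNReal.ofReal_ne_top)) hG
  obtain ⟨N, hN, hN1⟩ := exists_nat_half_lt_mul_lt_one hp0 hp1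
  refine ⟨p * (1 + N / 2), hN, hN1, (opNorm T).toNNReal, fun a ha => ?_⟩
  obtain ⟨c, K, hc, -, hK⟩ := exists_kernelMean_bounds (γ := 2 * (p * (1 + N / 2))) (by linarith)
  have hb : ‖η a‖ < 1 := (hη.norm_le hη0 ha).trans_lt ha
  obtain ⟨hlow, hupp⟩ := hK (η a) hb
  have hpos : 0 < ENNReal.ofReal (c * (1 - ‖η a‖) ^ (1 - 2 * (p * (1 + N / 2 : ℝ)))) :=
    ENNReal.ofReal_pos.2 (mul_pos hc (Real.rpow_pos_of_pos (sub_pos.2 hb) _))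
  exact rpow_mul_le_of_rpow_mul_le hp0 (by positivity) (hpos.trans_le hlow).ne'
    (hupp.trans_lt ENNReal.ofReal_lt_top).ne
    (hη.enorm_deriv_rpow_mul_kernelMean_le_of_lintegral_le hη0 hp0 hC rfl ha)

lemma IsBoundedCondExp.exists_norm_deriv_le {η : ℂ → ℂ} (hη : IsInner η) (hη0 : η 0 = 0) {p : ℝ}
    (hp0 : 0 < p) (hp1 : p < 1) {T : hardy (ENNReal.ofReal p) →ₗ[ℂ] hardy (ENNReal.ofReal p)}
    (hT : IsBoundedCondExp η _ T) : ∃ M β : ℝ, 0 ≤ M ∧ 0 ≤ β ∧ β < 1 ∧ ∀ a : ℂ, ‖a‖ < 1 →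
      ‖deriv η a‖ ≤ M * ((1 - ‖η a‖) / (1 - ‖a‖)) ^ β := by
  obtain ⟨q, hq, hq1, C, hC⟩ := hT.exists_enorm_deriv_rpow_mul_kernelMean_le hη hη0 hp0 hp1
  obtain ⟨c, K, hc, hK, hbound⟩ := exists_kernelMean_bounds (γ := 2 * q) (by linarith)
  have hq0 : 0 < q := by linarith
  refine ⟨C * (K / c) ^ (1 / q), (2 * q - 1) / q, by positivity, div_nonneg (by linarith) hq0.le,
    (div_lt_one hq0).2 (by linarith), fun a ha => ?_⟩
  have hb : ‖η a‖ < 1 := (hη.norm_le hη0 ha).trans_lt ha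
  have hda : 0 < 1 - ‖a‖ := sub_pos.2 ha
  have hdb : 0 < 1 - ‖η a‖ := sub_pos.2 hb
  have hmeans : ‖deriv η a‖ ^ q * (c * (1 - ‖η a‖) ^ (1 - 2 * q)) ≤
      C ^ q * (K * (1 - ‖a‖) ^ (1 - 2 * q)) := by
    have h := ((mul_le_mul_right (hbound _ hb).1 _).trans (hC a ha)).trans
      (mul_le_mul_right (hbound a ha).2 _)
    rwa [← ofReal_norm, ENNReal.ofReal_rpow_of_nonneg (norm_nonneg _) hq0.le,
      ← ENNReal.ofReal_coe_nnreal, ENNReal.ofReal_rpow_of_nonneg C.coe_nonneg hq0.le,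
      ← ENNReal.ofReal_mul (by positivity), ← ENNReal.ofReal_mul (by positivity),
      ENNReal.ofReal_le_ofReal_iff (by positivity)] at h
  rw [← neg_sub (2 * q), Real.rpow_neg hdb.le, Real.rpow_neg hda.le, ← div_eq_mul_inv c,
    ← le_div_iff₀ (by positivity)] at hmeans
  rw [← Real.rpow_le_rpow_iff (norm_nonneg _) (by positivity) hq0]
  refine hmeans.trans_eq ?_
  rw [Real.mul_rpow (by positivity) (by positivity), Real.mul_rpow (by positivity) (by positivity),
    ← Real.rpow_mul (by positivity), ← Real.rpow_mul (by positivity), one_div_mul_cancel hq0.ne',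
    div_mul_cancel₀ _ hq0.ne', Real.rpow_one, Real.div_rpow hdb.le hda.le]
  field_simp

/-! ### From the derivative estimate to finite Blaschke products -/

/- Separation of variables: `u ^ (1 - β) - M (b - t) ^ (1 - β)` is increasing and vanishes at
`b`. -/
lemma rpow_le_of_le_deriv {u u' : ℝ → ℝ} {a b M β : ℝ} (hβ : β < 1)
    (hu : ∀ t ∈ Set.Ioo a b, 0 < u t) (hu' : ∀ t ∈ Set.Ioo a b, HasDerivAt u (u' t) t)
    (hle : ∀ t ∈ Set.Ioo a b, -(M * (u t / (b - t)) ^ β) ≤ u' t)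
    (hlim : Tendsto u (𝓝[<] b) (𝓝 0)) {r : ℝ} (hr : r ∈ Set.Ioo a b) :
    u r ^ (1 - β) ≤ M * (b - r) ^ (1 - β) := by
  have hβ0 : 0 < 1 - β := sub_pos.2 hβ
  let g : ℝ → ℝ := fun t => u t ^ (1 - β) - M * (b - t) ^ (1 - β)
  have hderiv : ∀ t ∈ Set.Ioo a b,
      HasDerivAt g ((1 - β) * (u' t * u t ^ (-β) + M * (b - t) ^ (-β))) t := by
    intro t ht
    have h₁ := (hu' t ht).rpow_const (p := 1 - β) (.inl (hu t ht).ne')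
    have h₂ := (((hasDerivAt_id' t).const_sub b).rpow_const (p := 1 - β)
      (.inl (sub_pos.2 ht.2).ne')).const_mul M
    rw [show 1 - β - 1 = -β by ring] at h₁ h₂
    exact (h₁.sub h₂).congr_deriv (by ring)
  have hnonneg : ∀ t ∈ Set.Ioo a b, 0 ≤ (1 - β) * (u' t * u t ^ (-β) + M * (b - t) ^ (-β)) := by
    intro t ht
    have hut := hu t ht
    have hbt : 0 < b - t := sub_pos.2 ht.2
    have hmul := mul_le_mul_of_nonneg_right (hle t ht) (Real.rpow_nonneg hut.le (-β))
    have hcancel : (u t / (b - t)) ^ β * u t ^ (-β) = (b - t) ^ (-β) := by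
      rw [Real.div_rpow hut.le hbt.le, Real.rpow_neg hut.le, Real.rpow_neg hbt.le]
      field_simp
    rw [neg_mul, mul_assoc, hcancel] at hmul
    exact mul_nonneg hβ0.le (by linarith)
  have hmono : MonotoneOn g (Set.Ioo a b) := by
    refine monotoneOn_of_deriv_nonneg (convex_Ioo a b)
      (fun t ht => (hderiv t ht).continuousAt.continuousWithinAt) ?_ ?_ <;> rw [interior_Ioo]
    · exact fun t ht => (hderiv t ht).differentiableAt.differentiableWithinAt
    · exact fun t ht => (hderiv t ht).deriv ▸ hnonneg t ht
  have hglim : Tendsto g (𝓝[<] b) (𝓝 0) := by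
    have hsub : Tendsto (fun t => b - t) (𝓝[<] b) (𝓝 0) :=
      tendsto_nhdsWithin_of_tendsto_nhds (Continuous.tendsto' (by fun_prop) _ _ (sub_self b))
    simpa [hβ0.ne'] using (hlim.rpow_const (.inr hβ0.le)).sub
      ((hsub.rpow_const (.inr hβ0.le)).const_mul M)
  refine sub_nonpos.1 (ge_of_tendsto hglim ?_)
  filter_upwards [Ioo_mem_nhdsLT hr.2] with t ht using hmono hr ⟨hr.1.trans ht.1, ht.2⟩ ht.1.le

namespace IsInner

variable {η : ℂ → ℂ}

lemma hasDerivAt_one_sub_norm_sq (hη : IsInner η) (w : Circle) {t : ℝ}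
    (ht : t ∈ Set.Ioo (0 : ℝ) 1) :
    HasDerivAt (fun s : ℝ => 1 - ‖η (s * w)‖ ^ 2)
      (-(2 * inner ℝ (η (t * w)) (deriv η (t * w) * w))) t := by
  have hd : HasDerivAt η (deriv η (t * w)) (t * w) := (hη.differentiableOn.differentiableAt
    (isOpen_ball.mem_nhds (ofReal_mul_circle_mem_ball w ht))).hasDerivAt
  have hray : HasDerivAt (fun s : ℝ => (s : ℂ) * (w : ℂ)) (w : ℂ) t := by
    simpa using (Complex.ofRealCLM.hasDerivAt (x := t)).mul_const (w : ℂ)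
  exact (HasDerivAt.comp_of_eq t hd hray rfl).norm_sq.const_sub 1

lemma rpow_one_sub_norm_sq_le_of_tendsto (hη : IsInner η) (hη0 : η 0 = 0) {M β : ℝ} (hM : 0 ≤ M)
    (hβ0 : 0 ≤ β) (hβ1 : β < 1)
    (h : ∀ a : ℂ, ‖a‖ < 1 → ‖deriv η a‖ ≤ M * ((1 - ‖η a‖) / (1 - ‖a‖)) ^ β) {w : Circle} {l : ℂ}
    (hl : ‖l‖ = 1) (hw : Tendsto (fun r : ℝ => η (r * w)) (𝓝[<] (1 : ℝ)) (𝓝 l)) {r : ℝ}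
    (hr : r ∈ Set.Ioo (0 : ℝ) 1) :
    (1 - ‖η (r * w)‖ ^ 2) ^ (1 - β) ≤ 2 * M * (1 - r) ^ (1 - β) := by
  have hnorm : ∀ t ∈ Set.Ioo (0 : ℝ) 1, ‖(t : ℂ) * (w : ℂ)‖ = t := fun t ht => by
    rw [norm_mul, Circle.norm_coe, mul_one, Complex.norm_real, Real.norm_of_nonneg ht.1.le]
  have hlt : ∀ t ∈ Set.Ioo (0 : ℝ) 1, ‖η (t * w)‖ < 1 := fun t ht => by
    have ht1 := (hnorm t ht).trans_lt ht.2
    exact (hη.norm_le hη0 ht1).trans_lt ht1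
  refine rpow_le_of_le_deriv hβ1 (fun t ht => ?_) (fun t ht => hη.hasDerivAt_one_sub_norm_sq w ht)
    (fun t ht => ?_) ?_ hr
  · exact sub_pos.2 (pow_lt_one₀ (norm_nonneg _) (hlt t ht) two_ne_zero)
  · have ht1 : 0 < 1 - t := sub_pos.2 ht.2
    have hηt := hlt t ht
    have hinner : inner ℝ (η (t * w)) (deriv η (t * w) * w) ≤ ‖deriv η (t * w)‖ := by
      refine (real_inner_le_norm _ _).trans ?_
      rw [norm_mul, Circle.norm_coe, mul_one]
      exact mul_le_of_le_one_left (norm_nonneg _) hηt.le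
    have hderiv : ‖deriv η (t * w)‖ ≤ M * ((1 - ‖η (t * w)‖ ^ 2) / (1 - t)) ^ β := by
      have hle := h (t * w) ((hnorm t ht).trans_lt ht.2)
      rw [hnorm t ht] at hle
      have : 0 ≤ 1 - ‖η (t * w)‖ := sub_nonneg.2 hηt.le
      refine hle.trans ?_
      gcongr
      exact pow_le_of_le_one (norm_nonneg _) hηt.le two_ne_zero
    rw [mul_assoc]
    linarith
  · simpa [hl] using (hw.norm.pow 2).const_sub 1

lemma rpow_one_sub_norm_sq_le (hη : IsInner η) (hη0 : η 0 = 0) {M β : ℝ} (hM : 0 ≤ M)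
    (hβ0 : 0 ≤ β) (hβ1 : β < 1)
    (h : ∀ a : ℂ, ‖a‖ < 1 → ‖deriv η a‖ ≤ M * ((1 - ‖η a‖) / (1 - ‖a‖)) ^ β) {r : ℝ}
    (hr : r ∈ Set.Ioo (0 : ℝ) 1) (w : Circle) :
    (1 - ‖η (r * w)‖ ^ 2) ^ (1 - β) ≤ 2 * M * (1 - r) ^ (1 - β) := by
  have hae : ∀ᵐ w : Circle ∂circleMeasure,
      (1 - ‖η (r * w)‖ ^ 2) ^ (1 - β) ≤ 2 * M * (1 - r) ^ (1 - β) := by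
    filter_upwards [hη.radial] with w ⟨l, hl, hw⟩
    exact hη.rpow_one_sub_norm_sq_le_of_tendsto hη0 hM hβ0 hβ1 h hl hw hr
  have hcont : Continuous fun w : Circle => (1 - ‖η (r * w)‖ ^ 2) ^ (1 - β) :=
    (continuous_const.sub ((hη.hasBoundary.continuous_dilate hr).norm.pow 2)).rpow_const
      fun w => .inr (sub_pos.2 hβ1).le
  exact (Measure.dense_of_ae hae).induction (fun _ hx => hx) (isClosed_le hcont continuous_const) w

lemma uniformlyUnimodular (hη : IsInner η) (hη0 : η 0 = 0) {M β : ℝ} (hM : 0 ≤ M) (hβ0 : 0 ≤ β)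
    (hβ1 : β < 1) (h : ∀ a : ℂ, ‖a‖ < 1 → ‖deriv η a‖ ≤ M * ((1 - ‖η a‖) / (1 - ‖a‖)) ^ β) :
    UniformlyUnimodular η := by
  intro ε hε
  have hβ : 0 < 1 - β := sub_pos.2 hβ1
  have hlim : Tendsto (fun t : ℝ => 2 * M * (1 - t) ^ (1 - β)) (𝓝 1) (𝓝 0) :=
    Continuous.tendsto' (continuous_const.mul
      (Continuous.rpow_const (by fun_prop) fun _ => .inr hβ.le)) _ _ (by simp [hβ.ne'])
  obtain ⟨ρ, hρ, hsub⟩ := mem_nhdsLT_iff_exists_Ioo_subset.1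
    (tendsto_nhdsWithin_of_tendsto_nhds hlim (gt_mem_nhds (Real.rpow_pos_of_pos hε (1 - β))))
  refine ⟨max ρ 0, max_lt hρ one_pos, fun z hz hz1 => ?_⟩
  obtain ⟨hzρ, hz0⟩ := max_lt_iff.1 hz
  have hle := hη.rpow_one_sub_norm_sq_le hη0 hM hβ0 hβ1 h ⟨hz0, hz1⟩ (Circle.exp z.arg)
  rw [Circle.coe_exp, Complex.norm_mul_exp_arg_mul_I] at hle
  have hη1 : ‖η z‖ ≤ 1 := hη.norm_le_one z (mem_ball_zero_iff.2 hz1)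
  have hsq : ‖η z‖ ^ 2 ≤ ‖η z‖ := pow_le_of_le_one (norm_nonneg _) hη1 two_ne_zero
  have hε' : 1 - ‖η z‖ ^ 2 < ε :=
    (Real.rpow_lt_rpow_iff (by linarith) hε.le hβ).1 (hle.trans_lt (hsub ⟨hzρ, hz1⟩))
  linarith

end IsInner

theorem IsBoundedCondExp.isFiniteBlaschke {η : ℂ → ℂ} (hη : IsInner η) (hη0 : η 0 = 0) {p : ℝ}
    (hp0 : 0 < p) (hp1 : p < 1) {T : hardy (ENNReal.ofReal p) →ₗ[ℂ] hardy (ENNReal.ofReal p)}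
    (hT : IsBoundedCondExp η _ T) : IsFiniteBlaschke η := by
  obtain ⟨M, β, hM, hβ0, hβ1, h⟩ := hT.exists_norm_deriv_le hη hη0 hp0 hp1
  exact (hη.uniformlyUnimodular hη0 hM hβ0 hβ1 h).isFiniteBlaschke hη.differentiableOn
    hη.norm_le_one

/-! ### Covering maps of the circle and their sections -/

/-- Measurable sections of a self-map `b` of the circle with continuous Jacobian `J`, through which
arc length is the sum of its images with densities `1 / J`. -/
structure Sections (b : Circle → Circle) (J : Circle → ℝ) where
  card : ℕ
  sec : Fin card → Circle → Circle
  measurable_sec : ∀ k, Measurable (sec k)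
  map_sec : ∀ k w, b (sec k w) = w
  continuous_jacobian : Continuous J
  jacobian_pos : ∀ w, 0 < J w
  lintegral_eq : ∀ F : Circle → ℝ≥0∞, Measurable F → ∫⁻ w, F w ∂circleMeasure =
    ∫⁻ w, ∑ k, F (sec k w) / ENNReal.ofReal (J (sec k w)) ∂circleMeasure

/-- Only one of the sections meets some neighborhood of `w₀`. -/
def Sections.IsSeparatedAt {b : Circle → Circle} {J : Circle → ℝ} (S : Sections b J)
    (w₀ : Circle) : Prop :=
  ∃ k₀, ∃ U ∈ 𝓝 w₀, ∀ k, k ≠ k₀ → ∀ w, S.sec k w ∉ U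

lemma lintegral_Ioc_add_nat_mul (g : ℝ → ℝ≥0∞) (s : ℝ) {T : ℝ} (hT : 0 ≤ T) (N : ℕ) :
    ∫⁻ t in Set.Ioc s (s + N * T), g t =
      ∑ k : Fin N, ∫⁻ t in Set.Ioc s (s + T), g (t + k * T) := by
  induction N with
  | zero => simp
  | succ N ih =>
    have hN : 0 ≤ N * T := by positivity
    have hlast : ∫⁻ t in Set.Ioc s (s + T), g (t + N * T) =
        ∫⁻ t in Set.Ioc (s + N * T) (s + N * T + T), g t := by
      rw [← (measurePreserving_add_right volume (N * T)).setLIntegral_comp_preimage_emb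
        (measurableEmbedding_addRight _) g, Set.preimage_add_const_Ioc, add_sub_cancel_right,
        add_right_comm, add_sub_cancel_right]
    have hend : s + (N + 1 : ℕ) * T = s + N * T + T := by
      push_cast
      ring
    rw [Fin.sum_univ_castSucc]
    simp only [Fin.val_castSucc, Fin.val_last]
    rw [← ih, hlast, hend, ← Set.Ioc_union_Ioc_eq_Ioc (b := s + N * T) (by linarith) (by linarith),
      lintegral_union measurableSet_Ioc (Set.Ioc_disjoint_Ioc_of_le le_rfl)]

/-- The representative of the argument of `w` in `(t - π, t + π]`. -/
def argAt (t : ℝ) (w : Circle) : ℝ := t + Complex.arg ((w * (Circle.exp t)⁻¹ : Circle) : ℂ)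

lemma measurable_argAt (t : ℝ) : Measurable (argAt t) :=
  (Complex.measurable_arg.comp
    (continuous_circle_coe.comp (continuous_mul_const _)).measurable).const_add t

lemma exp_argAt (t : ℝ) (w : Circle) : Circle.exp (argAt t w) = w := by
  rw [argAt, Circle.exp_add, Circle.exp_arg, mul_left_comm, mul_inv_cancel, mul_one]

lemma argAt_mem (t : ℝ) (w : Circle) : argAt t w ∈ Set.Ioc (t - π) (t + π) := by
  have h := Complex.arg_mem_Ioc ((w * (Circle.exp t)⁻¹ : Circle) : ℂ)
  exact ⟨by rw [argAt]; linarith [h.1], by rw [argAt]; linarith [h.2]⟩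

lemma argAt_exp {t s : ℝ} (hs : s ∈ Set.Ioc (t - π) (t + π)) : argAt t (Circle.exp s) = s := by
  rw [argAt, ← div_eq_mul_inv, ← Circle.exp_sub,
    Circle.arg_exp (by linarith [hs.1]) (by linarith [hs.2]), add_sub_cancel]

/-- `φ` is a lift of the self-map `b` of the circle to the line, and its derivative is continuous
and positive and comes from a function `J` on the circle. -/
structure IsLift (b : Circle → Circle) (J : Circle → ℝ) (φ : ℝ → ℝ) : Prop where
  continuous_jacobian : Continuous J
  jacobian_pos : ∀ w, 0 < J w
  hasDerivAt : ∀ θ, HasDerivAt φ (J (Circle.exp θ)) θ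
  map_exp : ∀ θ, b (Circle.exp θ) = Circle.exp (φ θ)

namespace IsLift

variable {b : Circle → Circle} {J : Circle → ℝ} {φ : ℝ → ℝ}

lemma strictMono (h : IsLift b J φ) : StrictMono φ :=
  strictMono_of_deriv_pos fun θ => by
    rw [(h.hasDerivAt θ).deriv]
    exact h.jacobian_pos _

lemma intervalIntegrable_jacobian (h : IsLift b J φ) (x y : ℝ) :
    IntervalIntegrable (fun s => J (Circle.exp s)) volume x y :=
  (h.continuous_jacobian.comp Circle.exp.continuous).intervalIntegrable x y

lemma integral_jacobian (h : IsLift b J φ) (x y : ℝ) :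
    ∫ s in x..y, J (Circle.exp s) = φ y - φ x :=
  intervalIntegral.integral_eq_sub_of_hasDerivAt (fun s _ => h.hasDerivAt s)
    (h.intervalIntegrable_jacobian x y)

lemma periodic_jacobian (J : Circle → ℝ) :
    Function.Periodic (fun s => J (Circle.exp s)) (2 * π) := fun s => by
  simp only [Circle.exp_add_two_pi]

lemma surjective (h : IsLift b J φ) : Function.Surjective φ := by
  have hint : IntervalIntegrable (fun s => J (Circle.exp s)) volume 0 (2 * π) :=
    h.intervalIntegrable_jacobian 0 (2 * π)
  have heq : φ = fun θ => φ 0 + ∫ s in (0 : ℝ)..θ, J (Circle.exp s) := funext fun θ => by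
    rw [h.integral_jacobian, add_sub_cancel]
  refine Continuous.surjective
    (continuous_iff_continuousAt.2 fun θ => (h.hasDerivAt θ).continuousAt) ?_ ?_
  · rw [heq]
    exact tendsto_atTop_add_const_left _ _
      ((periodic_jacobian J).tendsto_atTop_intervalIntegral_of_pos' hint
        (fun _ => h.jacobian_pos _) Real.two_pi_pos)
  · rw [heq]
    exact tendsto_atBot_add_const_left _ _
      ((periodic_jacobian J).tendsto_atBot_intervalIntegral_of_pos' hint
        (fun _ => h.jacobian_pos _) Real.two_pi_pos)

lemma exists_degree (h : IsLift b J φ) :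
    ∃ N : ℕ, N ≠ 0 ∧ ∀ θ, φ (θ + 2 * π) = φ θ + N * (2 * π) := by
  have hexp : Circle.exp (φ (2 * π)) = Circle.exp (φ 0) := by
    rw [← h.map_exp, ← h.map_exp, Circle.exp_two_pi, Circle.exp_zero]
  obtain ⟨m, hm⟩ := Circle.exp_eq_exp.1 hexp
  have hm0 : 0 < m := by
    have : (0 : ℝ) < m * (2 * π) := by linarith [h.strictMono Real.two_pi_pos]
    exact_mod_cast (pos_iff_pos_of_mul_pos this).2 Real.two_pi_pos
  lift m to ℕ using hm0.le
  refine ⟨m, by exact_mod_cast hm0.ne', fun θ => ?_⟩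
  have hper := (periodic_jacobian J).intervalIntegral_add_eq θ 0
  rw [h.integral_jacobian, h.integral_jacobian, zero_add, hm, Int.cast_natCast] at hper
  linarith

/-- A lift as an order isomorphism of the line. -/
def orderIso (h : IsLift b J φ) : ℝ ≃o ℝ := h.strictMono.orderIsoOfSurjective φ h.surjective

lemma orderIso_apply (h : IsLift b J φ) (θ : ℝ) : h.orderIso θ = φ θ := rfl

lemma orderIso_symm_add (h : IsLift b J φ) {N : ℕ}
    (hN : ∀ θ, φ (θ + 2 * π) = φ θ + N * (2 * π)) (s : ℝ) :
    h.orderIso.symm (s + N * (2 * π)) = h.orderIso.symm s + 2 * π := by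
  rw [OrderIso.symm_apply_eq, h.orderIso_apply, hN, ← h.orderIso_apply, OrderIso.apply_symm_apply]

/-- The `k`-th inverse branch of `b`, cut at `exp (t + π)`. -/
def branch (h : IsLift b J φ) (t : ℝ) (k : ℕ) (w : Circle) : Circle :=
  Circle.exp (h.orderIso.symm (argAt t w + k * (2 * π)))

lemma measurable_branch (h : IsLift b J φ) (t : ℝ) (k : ℕ) : Measurable (h.branch t k) :=
  Circle.exp.continuous.measurable.comp
    (h.orderIso.symm.continuous.measurable.comp ((measurable_argAt t).add_const _))

lemma map_branch (h : IsLift b J φ) (t : ℝ) (k : ℕ) (w : Circle) : b (h.branch t k w) = w := by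
  have hexp : Circle.exp (argAt t w + k * (2 * π)) = Circle.exp (argAt t w) :=
    Circle.exp_eq_exp.2 ⟨k, by push_cast; ring⟩
  rw [branch, h.map_exp, ← h.orderIso_apply, OrderIso.apply_symm_apply, hexp, exp_argAt]

lemma lintegral_circleMeasure_eq_lintegral_orderIso_symm (h : IsLift b J φ) {N : ℕ}
    (hN : ∀ θ, φ (θ + 2 * π) = φ θ + N * (2 * π)) {F : Circle → ℝ≥0∞} (hF : Measurable F) (s : ℝ) :
    ∫⁻ w, F w ∂circleMeasure = (ENNReal.ofReal (2 * π))⁻¹ * ∫⁻ x in Set.Ioc s (s + N * (2 * π)),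
      F (Circle.exp (h.orderIso.symm x)) /
        ENNReal.ofReal (J (Circle.exp (h.orderIso.symm x))) := by
  let c := h.orderIso.symm s
  have himage : φ '' Set.Ioc c (c + 2 * π) = Set.Ioc s (s + N * (2 * π)) := by
    have := h.orderIso.image_Ioc c (c + 2 * π)
    rwa [← h.orderIso_symm_add hN, OrderIso.apply_symm_apply, OrderIso.apply_symm_apply,
      h.orderIso_symm_add hN] at this
  rw [lintegral_circleMeasure hF c, ← himage, lintegral_image_eq_lintegral_abs_deriv_mul
    measurableSet_Ioc (fun x _ => (h.hasDerivAt x).hasDerivWithinAt) h.strictMono.injective.injOn]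
  congr 1
  refine lintegral_congr fun x => ?_
  have hpos := h.jacobian_pos (Circle.exp x)
  rw [← h.orderIso_apply, OrderIso.symm_apply_apply, abs_of_pos hpos,
    ENNReal.mul_div_cancel (ENNReal.ofReal_pos.2 hpos).ne' ENNReal.ofReal_ne_top]

lemma lintegral_eq_lintegral_sum_branch (h : IsLift b J φ) {N : ℕ}
    (hN : ∀ θ, φ (θ + 2 * π) = φ θ + N * (2 * π)) (t : ℝ) {F : Circle → ℝ≥0∞} (hF : Measurable F) :
    ∫⁻ w, F w ∂circleMeasure = ∫⁻ w, ∑ k : Fin N,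
      F (h.branch t k w) / ENNReal.ofReal (J (h.branch t k w)) ∂circleMeasure := by
  have hmeas (k : Fin N) : Measurable fun w =>
      F (h.branch t k w) / ENNReal.ofReal (J (h.branch t k w)) :=
    (hF.div (ENNReal.measurable_ofReal.comp h.continuous_jacobian.measurable)).comp
      (h.measurable_branch t k)
  rw [h.lintegral_circleMeasure_eq_lintegral_orderIso_symm hN hF (t - π),
    lintegral_Ioc_add_nat_mul _ _ Real.two_pi_pos.le,
    lintegral_circleMeasure (Finset.measurable_fun_sum _ fun k _ => hmeas k) (t - π),
    lintegral_finsetSum (f := fun (k : Fin N) (θ : ℝ) => F (h.branch t k (Circle.exp θ)) /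
      ENNReal.ofReal (J (h.branch t k (Circle.exp θ)))) _ fun k _ =>
      (hmeas k).comp Circle.exp.continuous.measurable]
  congr 1
  refine Finset.sum_congr rfl fun k _ => setLIntegral_congr_fun measurableSet_Ioc fun s hs => ?_
  simp only [branch, argAt_exp (t := t) ⟨hs.1, by linarith [hs.2]⟩]

/- The branch number `0` takes its values in the image of a period, and the others in the rest of
the circle. -/
lemma branch_notMem (h : IsLift b J φ) {N : ℕ} (hN : ∀ θ, φ (θ + 2 * π) = φ θ + N * (2 * π))
    (t : ℝ) {k : ℕ} (hk0 : k ≠ 0) (hkN : k < N) (w : Circle) : h.branch t k w ∉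
      Circle.exp '' Set.Ioo (h.orderIso.symm (t - π)) (h.orderIso.symm (t + π)) := by
  rintro ⟨x, ⟨hcx, hxd⟩, hxw⟩
  have hpi := Real.pi_pos
  obtain ⟨hlt, hle⟩ := argAt_mem t w
  have hk1 : (1 : ℝ) ≤ k := by exact_mod_cast Nat.one_le_iff_ne_zero.2 hk0
  have hkN1 : (k : ℝ) + 1 ≤ N := by exact_mod_cast hkN
  have hdy : h.orderIso.symm (t + π) < h.orderIso.symm (argAt t w + k * (2 * π)) :=
    h.orderIso.symm.strictMono (by nlinarith)
  have hyc : h.orderIso.symm (argAt t w + k * (2 * π)) ≤ h.orderIso.symm (t - π) + 2 * π := by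
    rw [← h.orderIso_symm_add hN]
    exact h.orderIso.symm.monotone (by nlinarith)
  have heq := Circle.exp_injOn_Ioc (by simp)
    ⟨hcx, (hxd.trans (hdy.trans_le hyc)).le⟩ ⟨hcx.trans (hxd.trans hdy), hyc⟩ hxw
  exact (hxd.trans hdy).ne heq

lemma exists_sections (h : IsLift b J φ) (w₀ : Circle) :
    ∃ S : Sections b J, S.IsSeparatedAt w₀ := by
  obtain ⟨N, hN0, hN⟩ := h.exists_degree
  obtain ⟨θ₀, rfl⟩ := Circle.exp_surjective w₀
  let t := φ θ₀
  have hsymm : h.orderIso.symm t = θ₀ := h.orderIso.symm_apply_apply θ₀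
  have hmem : θ₀ ∈ Set.Ioo (h.orderIso.symm (t - π)) (h.orderIso.symm (t + π)) := by
    rw [← hsymm]
    constructor <;> exact h.orderIso.symm.strictMono (by linarith [Real.pi_pos])
  refine ⟨⟨N, fun k => h.branch t k, fun k => h.measurable_branch t k, fun k => h.map_branch t k,
    h.continuous_jacobian, h.jacobian_pos,
    fun F hF => h.lintegral_eq_lintegral_sum_branch hN t hF⟩, ⟨0, Nat.pos_of_ne_zero hN0⟩, _,
    (isLocalHomeomorph_circleExp.isOpenMap _ isOpen_Ioo).mem_nhds ⟨θ₀, hmem, rfl⟩,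
    fun k hk => h.branch_notMem hN t (fun h0 => hk (Fin.ext h0)) k.2⟩

end IsLift

/-! ### Finite Blaschke products on the circle -/

lemma hasDerivAt_coe_circle_exp (θ : ℝ) :
    HasDerivAt (fun s : ℝ => (Circle.exp s : ℂ)) (Circle.exp θ * Complex.I) θ := by
  simp only [Circle.coe_exp]
  have h : HasDerivAt (fun s : ℝ => (s : ℂ) * Complex.I) Complex.I θ := by
    simpa using (Complex.ofRealCLM.hasDerivAt (x := θ)).mul_const Complex.I
  exact h.cexp

lemma exists_lift_of_mul_deriv_eq {G : ℂ → ℂ} {J : Circle → ℝ} (hJ : Continuous J)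
    (hG : ∀ w : Circle, DifferentiableAt ℂ G w) (hG1 : ‖G 1‖ = 1)
    (hderiv : ∀ w : Circle, w * deriv G w = J w * G w) :
    ∃ φ : ℝ → ℝ, (∀ θ, HasDerivAt φ (J (Circle.exp θ)) θ) ∧
      ∀ θ, G (Circle.exp θ) = Circle.exp (φ θ) := by
  let φ : ℝ → ℝ := fun θ => Complex.arg (G 1) + ∫ s in (0 : ℝ)..θ, J (Circle.exp s)
  have hφ (θ) : HasDerivAt φ (J (Circle.exp θ)) θ :=
    ((hJ.comp Circle.exp.continuous).integral_hasStrictDerivAt 0 θ).hasDerivAt.const_add _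
  let h : ℝ → ℂ := fun θ => G (Circle.exp θ) * Circle.exp (-φ θ)
  have hderiv_h (θ) : HasDerivAt h 0 θ := by
    have hGexp := (hG (Circle.exp θ)).hasDerivAt.comp θ (hasDerivAt_coe_circle_exp θ)
    have hexp := (hasDerivAt_coe_circle_exp (-φ θ)).scomp θ (hφ θ).neg
    refine (hGexp.mul hexp).congr_deriv ?_
    simp only [Function.comp_apply, Complex.real_smul, Complex.ofReal_neg]
    linear_combination (Complex.I * Circle.exp (-φ θ)) * hderiv (Circle.exp θ)
  have hconst (θ) : h θ = h 0 :=
    is_const_of_deriv_eq_zero (fun x => (hderiv_h x).differentiableAt)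
      (fun x => (hderiv_h x).deriv) θ 0
  have hzero : h 0 = 1 := by
    have harg := Complex.norm_mul_exp_arg_mul_I (G 1)
    rw [hG1, Complex.ofReal_one, one_mul, ← Circle.coe_exp] at harg
    simp only [h, φ, intervalIntegral.integral_same, add_zero, Circle.exp_zero, Circle.coe_one]
    rw [← harg, ← Circle.coe_mul, ← Circle.exp_add, harg, add_neg_cancel, Circle.exp_zero,
      Circle.coe_one]
  refine ⟨φ, hφ, fun θ => ?_⟩
  have hone := (hconst θ).trans hzero
  simp only [h, Circle.exp_neg, Circle.coe_inv] at hone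
  exact (mul_inv_eq_one₀ (Circle.coe_ne_zero _)).1 hone

lemma norm_blaschkeFactor_circle {a : ℂ} (ha : ‖a‖ < 1) (w : Circle) :
    ‖blaschkeFactor a w‖ = 1 := by
  rw [← pow_eq_one_iff_of_nonneg (norm_nonneg _) two_ne_zero,
    norm_blaschkeFactor_sq ha (Circle.norm_coe w).le, Circle.norm_coe]
  simp

lemma blaschkeFactor_circle_ne_zero {a : ℂ} (ha : ‖a‖ < 1) (w : Circle) :
    blaschkeFactor a w ≠ 0 :=
  norm_ne_zero_iff.1 ((norm_blaschkeFactor_circle ha w).trans_ne one_ne_zero)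

lemma differentiableAt_blaschkeFactor {a z : ℂ} (hz : 1 - conj a * z ≠ 0) :
    DifferentiableAt ℂ (blaschkeFactor a) z :=
  DifferentiableAt.div (by fun_prop) (by fun_prop) hz

lemma hasDerivAt_blaschkeFactor {a z : ℂ} (hz : 1 - conj a * z ≠ 0) :
    HasDerivAt (blaschkeFactor a) ((1 - ‖a‖ ^ 2) / (1 - conj a * z) ^ 2) z := by
  have hnum : HasDerivAt (fun z => z - a) 1 z := (hasDerivAt_id z).sub_const a
  have hden : HasDerivAt (fun z => 1 - conj a * z) (-(conj a * 1)) z :=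
    ((hasDerivAt_id z).const_mul (conj a)).const_sub 1
  refine (hnum.div hden hz).congr_deriv ?_
  rw [← Complex.conj_mul']
  congr 1
  ring

lemma mul_logDeriv_blaschkeFactor {a : ℂ} (ha : ‖a‖ < 1) (w : Circle) :
    w * logDeriv (blaschkeFactor a) w = ((1 - ‖a‖ ^ 2) / ‖w - a‖ ^ 2 : ℝ) := by
  have hnum := circle_sub_ne_zero w ha
  have hden : 1 - conj a * (w : ℂ) = w * conj (w - a) := by
    rw [map_sub, mul_sub, Complex.mul_conj', Circle.norm_coe]
    push_cast
    ring
  have hw := Circle.coe_ne_zero w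
  have hconj : conj ((w : ℂ) - a) ≠ 0 := (map_ne_zero _).2 hnum
  have hderiv := hasDerivAt_blaschkeFactor (one_sub_conj_mul_ne_zero ha (Circle.norm_coe w).le)
  rw [logDeriv_apply, hderiv.deriv, blaschkeFactor, hden]
  push_cast
  rw [← Complex.mul_conj' (w - a)]
  field_simp

/-- The modulus of the derivative on the circle of a Blaschke product with zeros `a`. -/
def blaschkeJacobian {n : ℕ} (a : Fin n → ℂ) (w : Circle) : ℝ :=
  ∑ j, (1 - ‖a j‖ ^ 2) / ‖(w : ℂ) - a j‖ ^ 2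

/-- The finite Blaschke product with zeros `a`, as a rational function on the plane. -/
def blaschke {n : ℕ} (c : ℂ) (a : Fin n → ℂ) (z : ℂ) : ℂ := c * ∏ j, blaschkeFactor (a j) z

section Blaschke

variable {n : ℕ} {a : Fin n → ℂ} {c : ℂ}

lemma continuous_blaschkeJacobian (ha : ∀ j, ‖a j‖ < 1) : Continuous (blaschkeJacobian a) :=
  continuous_finsetSum _ fun j _ => Continuous.div (by fun_prop) (by fun_prop) fun w =>
    pow_ne_zero 2 (norm_ne_zero_iff.2 (circle_sub_ne_zero w (ha j)))

lemma blaschkeJacobian_pos [Nonempty (Fin n)] (ha : ∀ j, ‖a j‖ < 1) (w : Circle) :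
    0 < blaschkeJacobian a w :=
  Finset.sum_pos (fun j _ => div_pos
    (sub_pos.2 (pow_lt_one₀ (norm_nonneg _) (ha j) two_ne_zero))
    (pow_pos (norm_pos_iff.2 (circle_sub_ne_zero w (ha j))) 2)) Finset.univ_nonempty

lemma norm_blaschke_circle (hc : ‖c‖ = 1) (ha : ∀ j, ‖a j‖ < 1) (w : Circle) :
    ‖blaschke c a w‖ = 1 := by
  rw [blaschke, norm_mul, hc, one_mul, norm_prod]
  exact Finset.prod_eq_one fun j _ => norm_blaschkeFactor_circle (ha j) w

lemma differentiableAt_blaschke (c : ℂ) {z : ℂ} (hz : ∀ j, 1 - conj (a j) * z ≠ 0) :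
    DifferentiableAt ℂ (blaschke c a) z :=
  (DifferentiableAt.fun_finsetProd fun j _ => differentiableAt_blaschkeFactor (hz j)).const_mul c

lemma continuousAt_deriv_blaschke (c : ℂ) {z : ℂ} (hz : ∀ j, 1 - conj (a j) * z ≠ 0) :
    ContinuousAt (deriv (blaschke c a)) z := by
  have hopen : IsOpen {z : ℂ | ∀ j, 1 - conj (a j) * z ≠ 0} := by
    simp only [Set.ofPred_forall]
    exact isOpen_iInter_of_finite fun j => isOpen_ne_fun (by fun_prop) (by fun_prop)
  have hd : DifferentiableOn ℂ (blaschke c a) {z : ℂ | ∀ j, 1 - conj (a j) * z ≠ 0} :=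
    fun z hz => (differentiableAt_blaschke c hz).differentiableWithinAt
  exact (hd.deriv hopen).continuousOn.continuousAt (hopen.mem_nhds hz)

lemma mul_deriv_blaschke (hc : ‖c‖ = 1) (ha : ∀ j, ‖a j‖ < 1) (w : Circle) :
    (w : ℂ) * deriv (blaschke c a) w = blaschkeJacobian a w * blaschke c a w := by
  have hc0 : c ≠ 0 := norm_ne_zero_iff.1 (hc.trans_ne one_ne_zero)
  have hne : blaschke c a w ≠ 0 :=
    norm_ne_zero_iff.1 ((norm_blaschke_circle hc ha w).trans_ne one_ne_zero)
  have hlog : logDeriv (blaschke c a) w = ∑ j, logDeriv (blaschkeFactor (a j)) w :=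
    (logDeriv_const_mul _ _ hc0).trans (logDeriv_prod
      (fun j _ => blaschkeFactor_circle_ne_zero (ha j) w)
      (fun j _ => differentiableAt_blaschkeFactor
        (one_sub_conj_mul_ne_zero (ha j) (Circle.norm_coe w).le)))
  have hsum : w * logDeriv (blaschke c a) w = blaschkeJacobian a w := by
    rw [hlog, Finset.mul_sum, blaschkeJacobian, Complex.ofReal_sum]
    exact Finset.sum_congr rfl fun j _ => mul_logDeriv_blaschkeFactor (ha j) w
  rw [← hsum, logDeriv_apply, mul_assoc, div_mul_cancel₀ _ hne]

end Blaschke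

lemma radialLimit_eq_of_eqOn {F G : ℂ → ℂ} (h : Set.EqOn F G (ball 0 1)) {w : Circle}
    (hG : ContinuousAt G w) : radialLimit F w = G w := by
  refine Tendsto.limUnder_eq ((hG.tendsto.comp (tendsto_ofReal_mul w)).congr' ?_)
  filter_upwards [eventually_ofReal_mul_circle_mem_ball w] with r hr using (h hr).symm

lemma IsFiniteBlaschke.exists_isLift {η : ℂ → ℂ} (hB : IsFiniteBlaschke η) (hη0 : η 0 = 0) :
    ∃ J φ, IsLift (boundaryMap η) J φ ∧ ∀ w, ‖radialLimit (deriv η) w‖ = J w := by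
  obtain ⟨c, n, a, hc, ha, hη⟩ := hB
  have heq : Set.EqOn η (blaschke c a) (ball 0 1) := hη
  have hn : Nonempty (Fin n) := by
    by_contra hn
    have hc0 := heq (mem_ball_self one_pos)
    rw [hη0, blaschke, Finset.univ_eq_empty_iff.2 (not_nonempty_iff.1 hn), Finset.prod_empty,
      mul_one] at hc0
    exact zero_ne_one (norm_zero.symm.trans (hc0 ▸ hc))
  have hden (w : Circle) (j) : 1 - conj (a j) * (w : ℂ) ≠ 0 :=
    one_sub_conj_mul_ne_zero (ha j) (Circle.norm_coe w).le
  have hderiv : Set.EqOn (deriv η) (deriv (blaschke c a)) (ball 0 1) := fun z hz =>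
    (heq.eventuallyEq_of_mem (isOpen_ball.mem_nhds hz)).deriv_eq
  obtain ⟨φ, hφ, hφexp⟩ := exists_lift_of_mul_deriv_eq (continuous_blaschkeJacobian ha)
    (fun w => differentiableAt_blaschke c (hden w))
    (by simpa using norm_blaschke_circle hc ha 1) (mul_deriv_blaschke hc ha)
  refine ⟨blaschkeJacobian a, φ, ⟨continuous_blaschkeJacobian ha, blaschkeJacobian_pos ha, hφ,
    fun θ => Circle.ext ?_⟩, fun w => ?_⟩
  · rw [boundaryMap, radialLimit_eq_of_eqOn heq (differentiableAt_blaschke c (hden _)).continuousAt,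
      coe_toCircle (norm_blaschke_circle hc ha _), hφexp]
  · have hnorm := congrArg norm (mul_deriv_blaschke hc ha w)
    rw [radialLimit_eq_of_eqOn hderiv (continuousAt_deriv_blaschke c (hden w))]
    rwa [norm_mul, norm_mul, Circle.norm_coe, one_mul, norm_blaschke_circle hc ha, mul_one,
      Complex.norm_real, Real.norm_of_nonneg (blaschkeJacobian_pos ha w).le] at hnorm

/-! ### The transfer operator -/

lemma enorm_sum_rpow_le_sum {ι E : Type*} [TopologicalSpace E] [ESeminormedAddCommMonoid E]
    (s : Finset ι) (x : ι → E) {p : ℝ} (hp0 : 0 < p) (hp1 : p ≤ 1) :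
    ‖∑ i ∈ s, x i‖ₑ ^ p ≤ ∑ i ∈ s, ‖x i‖ₑ ^ p :=
  Finset.le_sum_of_subadditive (fun y : E => ‖y‖ₑ ^ p) (by simp [hp0]) (fun y z =>
    (ENNReal.rpow_le_rpow (enorm_add_le y z) hp0.le).trans
      (ENNReal.rpow_add_le_add_rpow _ _ hp0.le hp1)) s x

lemma enorm_div_ofReal_rpow (x : ℂ) {r : ℝ} (hr : 0 < r) {p : ℝ} (hp : 0 ≤ p) :
    ‖x / (r : ℂ)‖ₑ ^ p = ‖x‖ₑ ^ p * ENNReal.ofReal r ^ (1 - p) / ENNReal.ofReal r := by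
  have hr0 : ENNReal.ofReal r ≠ 0 := (ENNReal.ofReal_pos.2 hr).ne'
  have hne : (r : ℂ) ≠ 0 := Complex.ofReal_ne_zero.2 hr.ne'
  have hnorm : ‖(r : ℂ)‖ₑ = ENNReal.ofReal r := by
    rw [← ofReal_norm, Complex.norm_real, Real.norm_of_nonneg hr.le]
  rw [div_eq_mul_inv, enorm_mul, enorm_inv hne, hnorm, ENNReal.mul_rpow_of_nonneg _ _ hp,
    ENNReal.inv_rpow, mul_div_assoc, sub_eq_neg_add, ENNReal.rpow_add _ _ hr0 ENNReal.ofReal_ne_top,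
    ENNReal.rpow_one, ENNReal.mul_div_cancel_right hr0 ENNReal.ofReal_ne_top, ENNReal.rpow_neg]

namespace Sections

variable {b : Circle → Circle} {J : Circle → ℝ} (S : Sections b J)

include S in
lemma exists_forall_jacobian_le : ∃ w₀, ∀ w, J w ≤ J w₀ := by
  obtain ⟨w₀, -, hmax⟩ :=
    isCompact_univ.exists_isMaxOn Set.univ_nonempty S.continuous_jacobian.continuousOn
  exact ⟨w₀, fun w => hmax (Set.mem_univ w)⟩

/-- The image under the section number `k` of the measure `dm / (J ∘ ζₖ)`: the restriction of arc
length to the image of the section. -/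
def sheetMeasure (k : Fin S.card) : Measure Circle :=
  (circleMeasure.withDensity fun w => (ENNReal.ofReal (J (S.sec k w)))⁻¹).map (S.sec k)

lemma measurable_inv_jacobian_sec (k : Fin S.card) :
    Measurable fun w => (ENNReal.ofReal (J (S.sec k w)))⁻¹ :=
  (S.continuous_jacobian.measurable.comp (S.measurable_sec k)).ennreal_ofReal.inv

lemma inv_jacobian_sec_lt_top (k : Fin S.card) (w : Circle) :
    (ENNReal.ofReal (J (S.sec k w)))⁻¹ < ⊤ :=
  ENNReal.inv_lt_top.2 (ENNReal.ofReal_pos.2 (S.jacobian_pos _))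

lemma sum_sheetMeasure : ∑ k, S.sheetMeasure k = circleMeasure := by
  ext A hA
  have hsec (k : Fin S.card) : S.sheetMeasure k A =
      ∫⁻ w, A.indicator 1 (S.sec k w) / ENNReal.ofReal (J (S.sec k w)) ∂circleMeasure := by
    rw [sheetMeasure, Measure.map_apply (S.measurable_sec k) hA,
      withDensity_apply _ (S.measurable_sec k hA), ← lintegral_indicator (S.measurable_sec k hA)]
    refine lintegral_congr fun w => ?_
    by_cases hw : S.sec k w ∈ A <;> simp [hw, Set.indicator]
  rw [Measure.finsetSum_apply, Finset.sum_congr rfl fun k _ => hsec k,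
    ← lintegral_finsetSum (f := fun k w => A.indicator (1 : Circle → ℝ≥0∞) (S.sec k w) /
      ENNReal.ofReal (J (S.sec k w))) _ fun k _ => ((measurable_one.indicator hA).comp
      (S.measurable_sec k)).mul (S.measurable_inv_jacobian_sec k),
    ← S.lintegral_eq _ (measurable_one.indicator hA), lintegral_indicator_one hA]

lemma sheetMeasure_le (k : Fin S.card) : S.sheetMeasure k ≤ circleMeasure := by
  rw [← S.sum_sheetMeasure]
  exact Finset.single_le_sum (fun _ _ => Measure.zero_le _) (Finset.mem_univ k)

lemma quasiMeasurePreserving (k : Fin S.card) :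
    Measure.QuasiMeasurePreserving (S.sec k) circleMeasure circleMeasure := by
  refine ⟨S.measurable_sec k, ?_⟩
  have hdensity := withDensity_absolutelyContinuous' (μ := circleMeasure)
    (S.measurable_inv_jacobian_sec k).aemeasurable
    (ae_of_all _ fun w => ENNReal.inv_ne_zero.2 ENNReal.ofReal_ne_top)
  exact (hdensity.map (S.measurable_sec k)).trans (S.sheetMeasure_le k).absolutelyContinuous

lemma ae_forall_sec_eq {E : Type*} {f g : Circle → E} (h : f =ᵐ[circleMeasure] g) :
    ∀ᵐ w ∂circleMeasure, ∀ k, f (S.sec k w) = g (S.sec k w) :=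
  ae_all_iff.2 fun k => (S.quasiMeasurePreserving k).ae_eq_comp h

lemma lintegral_eq_of_aemeasurable {F : Circle → ℝ≥0∞} (hF : AEMeasurable F circleMeasure) :
    ∫⁻ w, F w ∂circleMeasure =
      ∫⁻ w, ∑ k, F (S.sec k w) / ENNReal.ofReal (J (S.sec k w)) ∂circleMeasure := by
  obtain ⟨G, hG, hFG⟩ := hF
  rw [lintegral_congr_ae hFG, S.lintegral_eq G hG]
  refine lintegral_congr_ae ?_
  filter_upwards [S.ae_forall_sec_eq hFG] with w hw
  simp only [hw]

/-- The transfer operator `f ↦ ∑ₖ (f / J) ∘ ζₖ` of the map `b` with sections `ζₖ`. -/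
def transfer (f : Circle → ℂ) (w : Circle) : ℂ := ∑ k, f (S.sec k w) / (J (S.sec k w) : ℂ)

lemma transfer_add (f g : Circle → ℂ) : S.transfer (f + g) = S.transfer f + S.transfer g := by
  funext w
  simp only [transfer, Pi.add_apply, add_div, Finset.sum_add_distrib]

lemma transfer_sub (f g : Circle → ℂ) : S.transfer (f - g) = S.transfer f - S.transfer g := by
  funext w
  simp only [transfer, Pi.sub_apply, sub_div, Finset.sum_sub_distrib]

lemma transfer_smul (c : ℂ) (f : Circle → ℂ) : S.transfer (c • f) = c • S.transfer f := by
  funext w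
  simp only [transfer, Pi.smul_apply, smul_eq_mul, Finset.mul_sum, mul_div_assoc]

lemma transfer_congr {f g : Circle → ℂ} (h : f =ᵐ[circleMeasure] g) :
    S.transfer f =ᵐ[circleMeasure] S.transfer g := by
  filter_upwards [S.ae_forall_sec_eq h] with w hw
  simp only [transfer, hw]

lemma aestronglyMeasurable_transfer {f : Circle → ℂ}
    (hf : AEStronglyMeasurable f circleMeasure) :
    AEStronglyMeasurable (S.transfer f) circleMeasure := by
  refine Finset.aestronglyMeasurable_fun_sum _ fun k _ => ?_
  simp only [div_eq_mul_inv]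
  exact (hf.comp_quasiMeasurePreserving (S.quasiMeasurePreserving k)).mul
    (Complex.measurable_ofReal.comp
      (S.continuous_jacobian.measurable.comp (S.measurable_sec k))).inv.aestronglyMeasurable

include S in
lemma aemeasurable_enorm_rpow_mul_jacobian_rpow {f : Circle → ℂ}
    (hf : AEStronglyMeasurable f circleMeasure) (p : ℝ) :
    AEMeasurable (fun w => ‖f w‖ₑ ^ p * ENNReal.ofReal (J w) ^ (1 - p)) circleMeasure :=
  (hf.enorm.pow_const p).mul
    (S.continuous_jacobian.measurable.ennreal_ofReal.pow_const (1 - p)).aemeasurable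

lemma lintegral_transfer_rpow_le {f : Circle → ℂ} (hf : AEStronglyMeasurable f circleMeasure)
    {p : ℝ} (hp0 : 0 < p) (hp1 : p ≤ 1) :
    ∫⁻ w, ‖S.transfer f w‖ₑ ^ p ∂circleMeasure ≤
      ∫⁻ w, ‖f w‖ₑ ^ p * ENNReal.ofReal (J w) ^ (1 - p) ∂circleMeasure := by
  rw [S.lintegral_eq_of_aemeasurable (S.aemeasurable_enorm_rpow_mul_jacobian_rpow hf p)]
  exact lintegral_mono fun w => (enorm_sum_rpow_le_sum _ _ hp0 hp1).trans_eq
    (Finset.sum_congr rfl fun k _ => enorm_div_ofReal_rpow _ (S.jacobian_pos _) hp0.le)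

/- If `f` vanishes on the images of all sections but one, the sum defining its transfer has a single
term, and the subadditivity of `x ↦ x ^ p` is not lossy. -/
lemma lintegral_transfer_rpow_eq {f : Circle → ℂ} (hf : AEStronglyMeasurable f circleMeasure)
    {k₀ : Fin S.card} (hk : ∀ k, k ≠ k₀ → ∀ w, f (S.sec k w) = 0) {p : ℝ} (hp : 0 < p) :
    ∫⁻ w, ‖S.transfer f w‖ₑ ^ p ∂circleMeasure =
      ∫⁻ w, ‖f w‖ₑ ^ p * ENNReal.ofReal (J w) ^ (1 - p) ∂circleMeasure := by
  rw [S.lintegral_eq_of_aemeasurable (S.aemeasurable_enorm_rpow_mul_jacobian_rpow hf p)]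
  refine lintegral_congr fun w => ?_
  rw [transfer, Finset.sum_eq_single k₀ (fun k _ h => by simp [hk k h w]) (by simp),
    Finset.sum_eq_single k₀ (fun k _ h => by simp [hk k h w, hp]) (by simp)]
  exact enorm_div_ofReal_rpow _ (S.jacobian_pos _) hp.le

lemma lintegral_transfer_rpow_le_mul {f : Circle → ℂ} (hf : AEStronglyMeasurable f circleMeasure)
    {M : ℝ} (hM : ∀ w, J w ≤ M) {p : ℝ} (hp0 : 0 < p) (hp1 : p ≤ 1) :
    ∫⁻ w, ‖S.transfer f w‖ₑ ^ p ∂circleMeasure ≤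
      ENNReal.ofReal M ^ (1 - p) * ∫⁻ w, ‖f w‖ₑ ^ p ∂circleMeasure := by
  refine (S.lintegral_transfer_rpow_le hf hp0 hp1).trans ?_
  rw [← lintegral_const_mul' _ _
    (ENNReal.rpow_ne_top_of_nonneg (sub_nonneg.2 hp1) ENNReal.ofReal_ne_top)]
  refine lintegral_mono fun w => ?_
  rw [mul_comm]
  gcongr
  exact hM w

lemma integrable_transfer {f : Circle → ℂ} (hf : Integrable f circleMeasure) :
    Integrable (S.transfer f) circleMeasure := by
  refine ⟨S.aestronglyMeasurable_transfer hf.aestronglyMeasurable, ?_⟩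
  have hle := S.lintegral_transfer_rpow_le hf.aestronglyMeasurable one_pos le_rfl
  simp only [ENNReal.rpow_one, sub_self, ENNReal.rpow_zero, mul_one] at hle
  exact hle.trans_lt hf.2

include S in
lemma toReal_inv_jacobian_smul (z : ℂ) (w : Circle) :
    ((ENNReal.ofReal (J w))⁻¹).toReal • z = z / (J w : ℂ) := by
  rw [ENNReal.toReal_inv, ENNReal.toReal_ofReal (S.jacobian_pos w).le, Complex.real_smul,
    Complex.ofReal_inv, div_eq_inv_mul]

lemma integrable_sec_div_jacobian {f : Circle → ℂ} (hf : Integrable f circleMeasure)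
    (k : Fin S.card) : Integrable (fun w => f (S.sec k w) / (J (S.sec k w) : ℂ)) circleMeasure := by
  have hcomp := (hf.mono_measure (S.sheetMeasure_le k)).comp_measurable (S.measurable_sec k)
  rw [integrable_withDensity_iff_integrable_smul' (S.measurable_inv_jacobian_sec k)
    (ae_of_all _ (S.inv_jacobian_sec_lt_top k))] at hcomp
  simpa only [Function.comp_apply, S.toReal_inv_jacobian_smul] using hcomp

lemma integral_sheetMeasure {f : Circle → ℂ} (hf : Integrable f circleMeasure) (k : Fin S.card) :
    ∫ w, f w ∂S.sheetMeasure k = ∫ w, f (S.sec k w) / (J (S.sec k w) : ℂ) ∂circleMeasure := by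
  rw [sheetMeasure, integral_map (S.measurable_sec k).aemeasurable
      (hf.mono_measure (S.sheetMeasure_le k)).aestronglyMeasurable,
    integral_withDensity_eq_integral_toReal_smul (S.measurable_inv_jacobian_sec k)
      (ae_of_all _ (S.inv_jacobian_sec_lt_top k))]
  simp only [S.toReal_inv_jacobian_smul]

lemma integral_transfer {f : Circle → ℂ} (hf : Integrable f circleMeasure) :
    ∫ w, S.transfer f w ∂circleMeasure = ∫ w, f w ∂circleMeasure :=
  calc ∫ w, S.transfer f w ∂circleMeasure = ∑ k, ∫ w, f w ∂S.sheetMeasure k := by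
        simp only [transfer, S.integral_sheetMeasure hf]
        exact integral_finsetSum _ fun k _ => S.integrable_sec_div_jacobian hf k
    _ = ∫ w, f w ∂circleMeasure := by
        rw [← integral_finsetSum_measure fun k _ => hf.mono_measure (S.sheetMeasure_le k),
          S.sum_sheetMeasure]

end Sections

/-! ### The conditional expectation operator -/

namespace Sections

variable {η : ℂ → ℂ} {J : Circle → ℝ} (S : Sections (boundaryMap η) J) (hη : IsInner η)
  (hη0 : η 0 = 0)

include hη in
lemma represents {f : Circle → ℂ} (hf : Integrable f circleMeasure) :
    Represents η f (S.transfer f) := by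
  refine ⟨hf, S.integrable_transfer hf, fun Φ => ?_⟩
  rw [← S.integral_transfer (integrable_mul_comp hf hη.measurable_boundaryMap Φ)]
  refine integral_congr_ae (ae_of_all _ fun w => ?_)
  simp only [transfer, S.map_sec, Finset.sum_mul, div_mul_eq_mul_div]

include hη hη0

lemma condExp_ae_eq {f : Circle → ℂ} (hf : Integrable f circleMeasure) :
    circleMeasure[f | sigmaAlgebra η] =ᵐ[circleMeasure] fun w => S.transfer f (boundaryMap η w) :=
  (S.represents hη hf).condExp_ae_eq hη hη0

lemma transfer_comp_congr {f g : Circle → ℂ} (h : f =ᵐ[circleMeasure] g) :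
    (fun w => S.transfer f (boundaryMap η w)) =ᵐ[circleMeasure]
      fun w => S.transfer g (boundaryMap η w) :=
  (hη.measurePreserving hη0).quasiMeasurePreserving.ae_eq_comp (S.transfer_congr h)

lemma polyApprox_transfer_polynomial_comp (q : Polynomial ℂ) {p : ℝ≥0∞} (hp : p ≠ ⊤) :
    PolyApprox p fun w => S.transfer (fun w => q.eval (w : ℂ)) (boundaryMap η w) := by
  obtain ⟨Q, hQ⟩ := hη.exists_represents_polynomial hη0 q
  exact ((hη.hasBoundary.polynomial Q).polyApprox hp).congr
    ((hQ.condExp_ae_eq hη hη0).symm.trans (S.condExp_ae_eq hη hη0 (integrable_polynomial q)))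

variable {p : ℝ} (hp0 : 0 < p) (hp1 : p ≤ 1)

include hp0 hp1

lemma eLpNorm_transfer_comp_le {M : ℝ} (hM : ∀ w, J w ≤ M) {f : Circle → ℂ}
    (hf : AEStronglyMeasurable f circleMeasure) :
    eLpNorm (fun w => S.transfer f (boundaryMap η w)) (ENNReal.ofReal p) circleMeasure ≤
      ENNReal.ofReal (M ^ (1 / p - 1)) * eLpNorm f (ENNReal.ofReal p) circleMeasure := by
  have hM0 : 0 ≤ M := (S.jacobian_pos 1).le.trans (hM 1)
  have hexp : (1 / p - 1) * p = 1 - p := by field_simp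
  have hcomp : eLpNorm (fun w => S.transfer f (boundaryMap η w)) (ENNReal.ofReal p) circleMeasure =
      eLpNorm (S.transfer f) (ENNReal.ofReal p) circleMeasure :=
    eLpNorm_comp_measurePreserving (S.aestronglyMeasurable_transfer hf) (hη.measurePreserving hη0)
  rw [hcomp, ← ENNReal.rpow_le_rpow_iff hp0, ENNReal.mul_rpow_of_nonneg _ _ hp0.le,
    eLpNorm_ofReal_rpow hp0, eLpNorm_ofReal_rpow hp0,
    ENNReal.ofReal_rpow_of_nonneg (Real.rpow_nonneg hM0 _) hp0.le, ← Real.rpow_mul hM0, hexp,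
    ← ENNReal.ofReal_rpow_of_nonneg hM0 (sub_nonneg.2 hp1)]
  exact S.lintegral_transfer_rpow_le_mul hf hM hp0 hp1

lemma memLp_transfer_comp {f : Circle → ℂ} (hf : MemLp f (ENNReal.ofReal p) circleMeasure) :
    MemLp (fun w => S.transfer f (boundaryMap η w)) (ENNReal.ofReal p) circleMeasure := by
  obtain ⟨w₀, hw₀⟩ := S.exists_forall_jacobian_le
  exact ⟨(S.aestronglyMeasurable_transfer hf.1).comp_quasiMeasurePreserving
      (hη.measurePreserving hη0).quasiMeasurePreserving,
    (S.eLpNorm_transfer_comp_le hη hη0 hp0 hp1 hw₀ hf.1).trans_lt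
      (ENNReal.mul_lt_top ENNReal.ofReal_lt_top hf.2)⟩

/-- The extension `f ↦ (S.transfer f) ∘ η` of the conditional expectation to `L^p`. -/
def condOp : Lp ℂ (ENNReal.ofReal p) circleMeasure →ₗ[ℂ] Lp ℂ (ENNReal.ofReal p) circleMeasure where
  toFun f := (S.memLp_transfer_comp hη hη0 hp0 hp1 (Lp.memLp f)).toLp _
  map_add' f g := by
    rw [← MemLp.toLp_add]
    refine MemLp.toLp_congr _ _ ((S.transfer_comp_congr hη hη0 (Lp.coeFn_add f g)).trans ?_)
    rw [S.transfer_add]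
    rfl
  map_smul' c f := by
    rw [RingHom.id_apply, ← MemLp.toLp_const_smul]
    refine MemLp.toLp_congr _ _ ((S.transfer_comp_congr hη hη0 (Lp.coeFn_smul c f)).trans ?_)
    rw [S.transfer_smul]
    rfl

lemma coeFn_condOp (f : Lp ℂ (ENNReal.ofReal p) circleMeasure) :
    S.condOp hη hη0 hp0 hp1 f =ᵐ[circleMeasure] fun w => S.transfer f (boundaryMap η w) :=
  (S.memLp_transfer_comp hη hη0 hp0 hp1 (Lp.memLp f)).coeFn_toLp

lemma norm_condOp_le {M : ℝ} (hM : ∀ w, J w ≤ M) (f : Lp ℂ (ENNReal.ofReal p) circleMeasure) :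
    ‖S.condOp hη hη0 hp0 hp1 f‖ ≤ M ^ (1 / p - 1) * ‖f‖ := by
  have hM0 : 0 ≤ M := (S.jacobian_pos 1).le.trans (hM 1)
  rw [Lp.norm_def, Lp.norm_def, eLpNorm_congr_ae (S.coeFn_condOp hη hη0 hp0 hp1 f),
    ← ENNReal.toReal_ofReal (Real.rpow_nonneg hM0 (1 / p - 1)), ← ENNReal.toReal_mul]
  exact ENNReal.toReal_mono (ENNReal.mul_ne_top ENNReal.ofReal_ne_top (Lp.eLpNorm_ne_top f))
    (S.eLpNorm_transfer_comp_le hη hη0 hp0 hp1 hM (Lp.aestronglyMeasurable f))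

lemma condOp_mem_hardy (f : Lp ℂ (ENNReal.ofReal p) circleMeasure)
    (hf : f ∈ hardy (ENNReal.ofReal p)) :
    S.condOp hη hη0 hp0 hp1 f ∈ hardy (ENNReal.ofReal p) := by
  obtain ⟨w₀, hw₀⟩ := S.exists_forall_jacobian_le
  set C := ENNReal.ofReal (J w₀ ^ (1 / p - 1))
  have hC0 : C ≠ 0 := (ENNReal.ofReal_pos.2 (Real.rpow_pos_of_pos (S.jacobian_pos w₀) _)).ne'
  rw [mem_hardy_iff] at hf ⊢
  refine PolyApprox.of_approx (Lp.aestronglyMeasurable _) fun ε hε => ?_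
  obtain ⟨q, hq⟩ := hf (ε / C) (ENNReal.div_pos hε.ne' ENNReal.ofReal_ne_top)
  let g : Circle → ℂ := fun w => q.eval (w : ℂ)
  have hg : AEStronglyMeasurable g circleMeasure := (integrable_polynomial q).aestronglyMeasurable
  refine ⟨fun w => S.transfer g (boundaryMap η w),
    S.polyApprox_transfer_polynomial_comp hη hη0 q ENNReal.ofReal_ne_top,
    (S.aestronglyMeasurable_transfer hg).comp_quasiMeasurePreserving
      (hη.measurePreserving hη0).quasiMeasurePreserving, ?_⟩
  calc eLpNorm (fun w => S.condOp hη hη0 hp0 hp1 f w - S.transfer g (boundaryMap η w))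
        (ENNReal.ofReal p) circleMeasure
      = eLpNorm (fun w => S.transfer ((f : Circle → ℂ) - g) (boundaryMap η w))
          (ENNReal.ofReal p) circleMeasure := by
        refine eLpNorm_congr_ae ?_
        filter_upwards [S.coeFn_condOp hη hη0 hp0 hp1 f] with w hw
        rw [hw, S.transfer_sub, Pi.sub_apply]
    _ ≤ C * eLpNorm ((f : Circle → ℂ) - g) (ENNReal.ofReal p) circleMeasure :=
        S.eLpNorm_transfer_comp_le hη hη0 hp0 hp1 hw₀ ((Lp.aestronglyMeasurable f).sub hg)
    _ ≤ C * (ε / C) := mul_le_mul_right hq.le _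
    _ = ε := ENNReal.mul_div_cancel hC0 ENNReal.ofReal_ne_top

lemma isBoundedCondExp_condOp {X : Submodule ℂ (Lp ℂ (ENNReal.ofReal p) circleMeasure)}
    (hX : ∀ f ∈ X, S.condOp hη hη0 hp0 hp1 f ∈ X) :
    IsBoundedCondExp η X ((S.condOp hη hη0 hp0 hp1).restrict hX) := by
  obtain ⟨w₀, hw₀⟩ := S.exists_forall_jacobian_le
  exact ⟨⟨J w₀ ^ (1 / p - 1), fun f => S.norm_condOp_le hη hη0 hp0 hp1 hw₀ f⟩, fun f hf =>
    (S.coeFn_condOp hη hη0 hp0 hp1 f).trans (S.condExp_ae_eq hη hη0 hf).symm⟩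

end Sections

/-! ### Polynomials that concentrate at a point -/

lemma exists_lt_forall_le_of_unique_max {X : Type*} [TopologicalSpace X] [CompactSpace X]
    {g : X → ℝ≥0∞} (hg : Continuous g) {x₀ : X} (hpos : 0 < g x₀)
    (hmax : ∀ x, x ≠ x₀ → g x < g x₀) {V : Set X} (hV : IsOpen V) (hx₀ : x₀ ∈ V) :
    ∃ ρ < g x₀, ∀ x ∈ Vᶜ, g x ≤ ρ := by
  rcases (Vᶜ).eq_empty_or_nonempty with hempty | hne
  · exact ⟨0, hpos, by simp [hempty]⟩
  · obtain ⟨x₁, hx₁, hle⟩ := hV.isClosed_compl.isCompact.exists_isMaxOn hne hg.continuousOn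
    exact ⟨g x₁, hmax x₁ fun h => hx₁ (h ▸ hx₀), fun x hx => hle hx⟩

/- Powers of a function with a strict maximum concentrate at the maximum. -/
lemma exists_setLIntegral_compl_pow_le {X : Type*} [TopologicalSpace X] [CompactSpace X]
    [MeasurableSpace X] [OpensMeasurableSpace X] (μ : Measure X) [IsFiniteMeasure μ]
    [μ.IsOpenPosMeasure] {g : X → ℝ≥0∞} (hg : Continuous g) {x₀ : X} (hpos : 0 < g x₀)
    (hmax : ∀ x, x ≠ x₀ → g x < g x₀) {V : Set X} (hV : IsOpen V) (hx₀ : x₀ ∈ V)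
    {τ : ℝ≥0∞} (hτ : 0 < τ) : ∃ n : ℕ,
      ∫⁻ x in Vᶜ, g x ^ n ∂μ ≤ τ * ∫⁻ x in V, g x ^ n ∂μ ∧ ∫⁻ x in V, g x ^ n ∂μ ≠ 0 := by
  obtain ⟨ρ, hρ, hgρ⟩ := exists_lt_forall_le_of_unique_max hg hpos hmax hV hx₀
  obtain ⟨σ, hρσ, hσ⟩ := exists_between hρ
  have hσ0 : σ ≠ 0 := hρσ.ne_bot
  have hσtop : σ ≠ ⊤ := hσ.ne_top
  let W : Set X := V ∩ {x | σ < g x}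
  have hW : IsOpen W := hV.inter (isOpen_lt continuous_const hg)
  have hμW : μ W ≠ 0 := hW.measure_ne_zero μ ⟨x₀, hx₀, hσ⟩
  have hupper (n : ℕ) : ∫⁻ x in Vᶜ, g x ^ n ∂μ ≤ ρ ^ n * μ Vᶜ := by
    rw [← setLIntegral_const]
    exact setLIntegral_mono measurable_const fun x hx => pow_le_pow_left' (hgρ x hx) n
  have hlower (n : ℕ) : σ ^ n * μ W ≤ ∫⁻ x in V, g x ^ n ∂μ := by
    rw [← setLIntegral_const]
    exact (setLIntegral_mono' hW.measurableSet fun x hx => pow_le_pow_left' hx.2.le n).trans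
      (lintegral_mono_set Set.inter_subset_left)
  have hlim : Tendsto (fun n : ℕ => (ρ / σ) ^ n * μ Vᶜ) atTop (𝓝 0) := by
    have hlt : ρ / σ < 1 := by
      rwa [ENNReal.div_lt_iff (Or.inl hσ0) (Or.inl hσtop), one_mul]
    simpa only [zero_mul] using ENNReal.Tendsto.mul_const
      (ENNReal.tendsto_pow_atTop_nhds_zero_of_lt_one hlt) (Or.inr (measure_ne_top μ Vᶜ))
  obtain ⟨n, hn⟩ := (hlim.eventually (gt_mem_nhds (ENNReal.mul_pos hτ.ne' hμW))).exists
  refine ⟨n, ?_, ((ENNReal.mul_pos (pow_ne_zero n hσ0) hμW).trans_le (hlower n)).ne'⟩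
  calc ∫⁻ x in Vᶜ, g x ^ n ∂μ ≤ ρ ^ n * μ Vᶜ := hupper n
    _ = σ ^ n * ((ρ / σ) ^ n * μ Vᶜ) := by
        rw [← mul_assoc, ← mul_pow, ENNReal.mul_div_cancel hσ0 hσtop]
    _ ≤ σ ^ n * (τ * μ W) := mul_le_mul_right hn.le _
    _ = τ * (σ ^ n * μ W) := mul_left_comm _ _ _
    _ ≤ τ * ∫⁻ x in V, g x ^ n ∂μ := mul_le_mul_right (hlower n) _

/-- The polynomial `(1 + z / w₀) / 2`, whose modulus on the circle has a strict maximum at `w₀`. -/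
def peakPolynomial (w₀ : Circle) : Polynomial ℂ :=
  Polynomial.C (1 / 2) * (1 + Polynomial.C ((w₀⁻¹ : Circle) : ℂ) * Polynomial.X)

lemma eval_peakPolynomial (w₀ w : Circle) :
    (peakPolynomial w₀).eval (w : ℂ) = (1 + ((w₀⁻¹ * w : Circle) : ℂ)) / 2 := by
  simp only [peakPolynomial, Polynomial.eval_mul, Polynomial.eval_C, Polynomial.eval_add,
    Polynomial.eval_one, Polynomial.eval_X, Circle.coe_mul]
  ring

lemma eval_peakPolynomial_self (w₀ : Circle) : (peakPolynomial w₀).eval (w₀ : ℂ) = 1 := by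
  rw [eval_peakPolynomial, inv_mul_cancel, Circle.coe_one]
  norm_num

lemma norm_one_add_div_two_lt {u : ℂ} (hu : ‖u‖ = 1) (h : u ≠ 1) : ‖(1 + u) / 2‖ < 1 := by
  have hpar := parallelogram_law_with_norm ℝ (1 : ℂ) u
  have hpos : 0 < ‖1 - u‖ := norm_pos_iff.2 (sub_ne_zero.2 h.symm)
  rw [hu, norm_one] at hpar
  rw [norm_div, Complex.norm_two]
  nlinarith [norm_nonneg (1 + u)]

lemma norm_eval_peakPolynomial_lt_one {w₀ w : Circle} (h : w ≠ w₀) :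
    ‖(peakPolynomial w₀).eval (w : ℂ)‖ < 1 := by
  rw [eval_peakPolynomial]
  refine norm_one_add_div_two_lt (Circle.norm_coe _) fun h1 => h ?_
  rw [Circle.coe_eq_one] at h1
  exact (inv_mul_eq_one.1 h1).symm

lemma exists_polynomial_concentrated {w₀ : Circle} {V : Set Circle} (hV : IsOpen V) (hw₀ : w₀ ∈ V)
    {p : ℝ} (hp : 0 < p) {τ : ℝ≥0∞} (hτ : 0 < τ) : ∃ q : Polynomial ℂ,
      ∫⁻ w in Vᶜ, ‖q.eval (w : ℂ)‖ₑ ^ p ∂circleMeasure ≤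
        τ * ∫⁻ w in V, ‖q.eval (w : ℂ)‖ₑ ^ p ∂circleMeasure ∧
      ∫⁻ w in V, ‖q.eval (w : ℂ)‖ₑ ^ p ∂circleMeasure ≠ 0 := by
  have hself : ‖(peakPolynomial w₀).eval (w₀ : ℂ)‖ₑ ^ p = 1 := by
    rw [eval_peakPolynomial_self, enorm_one, ENNReal.one_rpow]
  obtain ⟨n, hn⟩ := exists_setLIntegral_compl_pow_le circleMeasure
    (g := fun w : Circle => ‖(peakPolynomial w₀).eval (w : ℂ)‖ₑ ^ p)
    (ENNReal.continuous_rpow_const.comp (by fun_prop)) (by simp only [hself, one_pos])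
    (fun w hw => by
      rw [hself]
      refine ENNReal.rpow_lt_one ?_ hp
      rw [← ofReal_norm, ENNReal.ofReal_lt_one]
      exact norm_eval_peakPolynomial_lt_one hw) hV hw₀ hτ
  refine ⟨peakPolynomial w₀ ^ n, ?_⟩
  simpa only [Polynomial.eval_pow, enorm_pow, ← ENNReal.rpow_natCast_mul,
    ← ENNReal.rpow_mul_natCast, mul_comm] using hn

/-! ### The lower bound for the operator norm -/

lemma lintegral_enorm_indicator_rpow {X E : Type*} [MeasurableSpace X] {μ : Measure X}
    [TopologicalSpace E] [ESeminormedAddMonoid E] {A : Set X} (hA : MeasurableSet A) (f : X → E)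
    {p : ℝ} (hp : 0 < p) : ∫⁻ x, ‖A.indicator f x‖ₑ ^ p ∂μ = ∫⁻ x in A, ‖f x‖ₑ ^ p ∂μ := by
  rw [← lintegral_indicator hA]
  refine lintegral_congr fun x => ?_
  by_cases hx : x ∈ A <;> simp [hx, hp]

namespace Sections

variable {b : Circle → Circle} {J : Circle → ℝ} (S : Sections b J) {p : ℝ}

lemma mul_setLIntegral_le_lintegral_transfer_indicator {V : Set Circle} (hV : MeasurableSet V)
    {k₀ : Fin S.card} (hk : ∀ k, k ≠ k₀ → ∀ w, S.sec k w ∉ V) {t : ℝ≥0∞} (ht : t ≠ ⊤)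
    (htJ : ∀ w ∈ V, t ≤ ENNReal.ofReal (J w) ^ (1 - p)) (hp : 0 < p) {f : Circle → ℂ}
    (hf : AEStronglyMeasurable f circleMeasure) :
    t * ∫⁻ w in V, ‖f w‖ₑ ^ p ∂circleMeasure ≤
      ∫⁻ w, ‖S.transfer (V.indicator f) w‖ₑ ^ p ∂circleMeasure := by
  rw [S.lintegral_transfer_rpow_eq (hf.indicator hV)
    (fun k hne w => Set.indicator_of_notMem (hk k hne w) f) hp,
    ← lintegral_enorm_indicator_rpow hV f hp, ← lintegral_const_mul' _ _ ht]
  refine lintegral_mono fun w => ?_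
  by_cases hw : w ∈ V
  · rw [mul_comm]
    exact mul_le_mul_right (htJ w hw) _
  · simp [hw, hp]

lemma lintegral_transfer_indicator_le (hp0 : 0 < p) (hp1 : p ≤ 1) (V : Set Circle)
    {f : Circle → ℂ} (hf : AEStronglyMeasurable f circleMeasure) :
    ∫⁻ w, ‖S.transfer (V.indicator f) w‖ₑ ^ p ∂circleMeasure ≤
      ∫⁻ w, ‖S.transfer f w‖ₑ ^ p ∂circleMeasure +
        ∫⁻ w, ‖S.transfer (Vᶜ.indicator f) w‖ₑ ^ p ∂circleMeasure := by
  have hsplit : V.indicator f = f - Vᶜ.indicator f := by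
    rw [eq_sub_iff_add_eq, Set.indicator_self_add_compl]
  rw [hsplit, S.transfer_sub,
    ← lintegral_add_left' ((S.aestronglyMeasurable_transfer hf).enorm.pow_const p)]
  exact lintegral_mono fun w => (ENNReal.rpow_le_rpow enorm_sub_le hp0.le).trans
    (ENNReal.rpow_add_le_add_rpow _ _ hp0.le hp1)

lemma le_add_mul_of_lintegral_transfer_polynomial_le {V : Set Circle} (hV : IsOpen V)
    (hVne : V.Nonempty) {k₀ : Fin S.card} (hk : ∀ k, k ≠ k₀ → ∀ w, S.sec k w ∉ V) {t : ℝ≥0∞}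
    (ht : t ≠ ⊤) (htJ : ∀ w ∈ V, t ≤ ENNReal.ofReal (J w) ^ (1 - p)) {M : ℝ} (hM : ∀ w, J w ≤ M)
    (hp0 : 0 < p) (hp1 : p ≤ 1) {K : ℝ≥0∞}
    (hK : ∀ q : Polynomial ℂ,
      ∫⁻ w, ‖S.transfer (fun w => q.eval (w : ℂ)) w‖ₑ ^ p ∂circleMeasure ≤
        K * ∫⁻ w : Circle, ‖q.eval (w : ℂ)‖ₑ ^ p ∂circleMeasure) {τ : ℝ≥0∞} (hτ : 0 < τ) :
    t ≤ K + (K + ENNReal.ofReal M ^ (1 - p)) * τ := by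
  obtain ⟨w₀, hw₀⟩ := hVne
  obtain ⟨q, hcompl, hne⟩ := exists_polynomial_concentrated hV hw₀ hp0 hτ
  let f : Circle → ℂ := fun w => q.eval (w : ℂ)
  have hf : AEStronglyMeasurable f circleMeasure := (integrable_polynomial q).aestronglyMeasurable
  have hVm : MeasurableSet V := hV.measurableSet
  set N := ENNReal.ofReal M ^ (1 - p)
  set A := ∫⁻ w in V, ‖f w‖ₑ ^ p ∂circleMeasure
  set B := ∫⁻ w in Vᶜ, ‖f w‖ₑ ^ p ∂circleMeasure
  have hAB : ∫⁻ w, ‖f w‖ₑ ^ p ∂circleMeasure = A + B := (lintegral_add_compl _ hVm).symm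
  have hA : A ≠ ⊤ := by
    refine ne_top_of_le_ne_top ?_ (setLIntegral_le_lintegral V _)
    rw [← eLpNorm_ofReal_rpow hp0]
    exact ENNReal.rpow_ne_top_of_nonneg hp0.le ((HasBoundary.id.polynomial q).memLp _).2.ne
  refine (ENNReal.mul_le_mul_iff_left hne hA).1 ?_
  calc t * A ≤ ∫⁻ w, ‖S.transfer (V.indicator f) w‖ₑ ^ p ∂circleMeasure :=
        S.mul_setLIntegral_le_lintegral_transfer_indicator hVm hk ht htJ hp0 hf
    _ ≤ ∫⁻ w, ‖S.transfer f w‖ₑ ^ p ∂circleMeasure +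
          ∫⁻ w, ‖S.transfer (Vᶜ.indicator f) w‖ₑ ^ p ∂circleMeasure :=
        S.lintegral_transfer_indicator_le hp0 hp1 V hf
    _ ≤ K * (A + B) + N * B := by
        refine add_le_add (hAB ▸ hK q) ((S.lintegral_transfer_rpow_le_mul (hf.indicator hVm.compl)
          hM hp0 hp1).trans_eq ?_)
        rw [lintegral_enorm_indicator_rpow hVm.compl f hp0]
    _ ≤ K * (A + τ * A) + N * (τ * A) := by gcongr
    _ = (K + (K + N) * τ) * A := by ring

/- Near a maximum point `w₀` of `J` only one section is involved, and there the transfer operator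
multiplies the mass `∫ ‖f‖ ^ p` by almost `J w₀ ^ (1 - p)`. -/
lemma rpow_le_of_lintegral_transfer_polynomial_le {w₀ : Circle} (hM : ∀ w, J w ≤ J w₀)
    (hS : S.IsSeparatedAt w₀) (hp0 : 0 < p) (hp1 : p ≤ 1) {K : ℝ≥0∞}
    (hK : ∀ q : Polynomial ℂ,
      ∫⁻ w, ‖S.transfer (fun w => q.eval (w : ℂ)) w‖ₑ ^ p ∂circleMeasure ≤
        K * ∫⁻ w : Circle, ‖q.eval (w : ℂ)‖ₑ ^ p ∂circleMeasure) :
    ENNReal.ofReal (J w₀) ^ (1 - p) ≤ K := by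
  obtain ⟨k₀, U, hU, hk⟩ := hS
  set N := ENNReal.ofReal (J w₀) ^ (1 - p)
  have hN : N ≠ ⊤ := ENNReal.rpow_ne_top_of_nonneg (sub_nonneg.2 hp1) ENNReal.ofReal_ne_top
  refine le_of_forall_lt_imp_le_of_dense fun t ht => ?_
  let V : Set Circle := interior U ∩ {w | t < ENNReal.ofReal (J w) ^ (1 - p)}
  have hV : IsOpen V := isOpen_interior.inter (isOpen_lt continuous_const
    (ENNReal.continuous_rpow_const.comp (ENNReal.continuous_ofReal.comp S.continuous_jacobian)))
  have hw₀ : w₀ ∈ V := ⟨mem_interior_iff_mem_nhds.2 hU, ht⟩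
  refine ENNReal.le_of_forall_pos_le_add fun ε hε hKtop => ?_
  have hτ : 0 < (ε : ℝ≥0∞) / (K + N) :=
    ENNReal.div_pos (ENNReal.coe_pos.2 hε).ne' (ENNReal.add_ne_top.2 ⟨hKtop.ne, hN⟩)
  calc t ≤ K + (K + N) * (ε / (K + N)) := S.le_add_mul_of_lintegral_transfer_polynomial_le hV
        ⟨w₀, hw₀⟩ (fun k hne w h => hk k hne w (interior_subset h.1)) ht.ne_top
        (fun w hw => hw.2.le) hM hp0 hp1 hK hτ
    _ ≤ K + ε := by gcongr; exact ENNReal.mul_div_le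

end Sections

/-! ### Uniqueness of the bounded extension -/

/-- The integrable functions in the subspace `X` of `L^p` are dense in `X`. -/
def IntegrableDense {p : ℝ≥0∞} (X : Submodule ℂ (Lp ℂ p circleMeasure)) : Prop :=
  ∀ f ∈ X, ∀ ε : ℝ≥0∞, 0 < ε → ∃ g ∈ X, Integrable g circleMeasure ∧
    eLpNorm (f - g : Lp ℂ p circleMeasure) p circleMeasure ≤ ε

lemma IntegrableDense.of_memLp {p : ℝ≥0∞} {X : Submodule ℂ (Lp ℂ p circleMeasure)}
    (h : ∀ f ∈ X, ∀ ε : ℝ≥0∞, 0 < ε → ∃ (g : Circle → ℂ) (hg : MemLp g p circleMeasure),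
      hg.toLp g ∈ X ∧ Integrable g circleMeasure ∧ eLpNorm (⇑f - g) p circleMeasure ≤ ε) :
    IntegrableDense X := by
  intro f hf ε hε
  obtain ⟨g, hg, hgX, hint, hle⟩ := h f hf ε hε
  refine ⟨hg.toLp g, hgX, hint.congr hg.coeFn_toLp.symm, le_of_eq_of_le (eLpNorm_congr_ae ?_) hle⟩
  exact (Lp.coeFn_sub _ _).trans (EventuallyEq.rfl.sub hg.coeFn_toLp)

lemma integrableDense_hardy (p : ℝ≥0∞) : IntegrableDense (hardy p) :=
  .of_memLp fun f hf ε hε => by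
    obtain ⟨q, hq⟩ := hf ε hε
    exact ⟨_, (HasBoundary.id.polynomial q).memLp p, toLp_mem_hardy _ (polyApprox_polynomial p q),
      integrable_polynomial q, hq.le⟩

lemma integrableDense_top {p : ℝ≥0∞} (hp : p ≠ ⊤) :
    IntegrableDense (⊤ : Submodule ℂ (Lp ℂ p circleMeasure)) :=
  .of_memLp fun f _ ε hε => by
    obtain ⟨s, hs, hmem⟩ := (Lp.memLp f).exists_simpleFunc_eLpNorm_sub_lt hp hε.ne'
    exact ⟨s, hmem, Submodule.mem_top, SimpleFunc.integrable_of_isFiniteMeasure s, hs.le⟩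

namespace IsBoundedCondExp

variable {η : ℂ → ℂ} {p : ℝ≥0∞} {X : Submodule ℂ (Lp ℂ p circleMeasure)} {T T' : X →ₗ[ℂ] X}

lemma eLpNorm_apply_sub_apply_le (hT' : IsBoundedCondExp η X T') (hT : IsBoundedCondExp η X T)
    (f : X) {g : X} (hg : Integrable (g : Lp ℂ p circleMeasure) circleMeasure) :
    eLpNorm (T' f - T f : Lp ℂ p circleMeasure) p circleMeasure ≤
      ENNReal.LpAddConst p * (ENNReal.ofReal (opNorm T') + ENNReal.ofReal (opNorm T)) *
        eLpNorm (f - g : Lp ℂ p circleMeasure) p circleMeasure := by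
  have hTg : T' g = T g := Subtype.ext (Lp.ext ((hT'.2 g hg).trans (hT.2 g hg).symm))
  have hd : T' f - T f = T' (f - g) - T (f - g) := by
    rw [map_sub, map_sub, hTg, sub_sub_sub_cancel_right]
  rw [← Submodule.coe_sub, hd, Submodule.coe_sub, eLpNorm_congr_ae (Lp.coeFn_sub _ _), mul_assoc,
    add_mul]
  refine (eLpNorm_sub_le' (Lp.aestronglyMeasurable _) (Lp.aestronglyMeasurable _) p).trans ?_
  gcongr
  exacts [hT'.eLpNorm_apply_le (f - g), hT.eLpNorm_apply_le (f - g)]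

lemma unique (hT' : IsBoundedCondExp η X T') (hT : IsBoundedCondExp η X T) (hp : 0 < p)
    (hX : IntegrableDense X) : T' = T := by
  ext1 f
  set L := ENNReal.LpAddConst p * (ENNReal.ofReal (opNorm T') + ENNReal.ofReal (opNorm T))
  have hL : L ≠ ⊤ := ENNReal.mul_ne_top (ENNReal.LpAddConst_lt_top p).ne
    (ENNReal.add_ne_top.2 ⟨ENNReal.ofReal_ne_top, ENNReal.ofReal_ne_top⟩)
  have hzero : eLpNorm (T' f - T f : Lp ℂ p circleMeasure) p circleMeasure = 0 := by
    refine nonpos_iff_eq_zero.1 (ENNReal.le_of_forall_pos_le_add fun ε hε _ => ?_)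
    have hε' : (ε : ℝ≥0∞) ≠ 0 := (ENNReal.coe_pos.2 hε).ne'
    obtain ⟨g, hg, hint, hfg⟩ := hX f f.2 (ε / L) (ENNReal.div_pos hε' hL)
    rw [zero_add]
    exact (hT'.eLpNorm_apply_sub_apply_le hT f (g := ⟨g, hg⟩) hint).trans
      ((mul_le_mul_right hfg _).trans ENNReal.mul_div_le)
  refine sub_eq_zero.1 (Subtype.ext ((Lp.norm_eq_zero_iff hp).1 ?_))
  rw [Lp.norm_def, Submodule.coe_sub, hzero, ENNReal.toReal_zero]

end IsBoundedCondExp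

/-! ### The norm of the conditional expectation -/

lemma IsBoundedCondExp.rpow_le_opNorm {η : ℂ → ℂ} (hη : IsInner η) (hη0 : η 0 = 0)
    {J : Circle → ℝ} (S : Sections (boundaryMap η) J) {w₀ : Circle} (hM : ∀ w, J w ≤ J w₀)
    (hS : S.IsSeparatedAt w₀) {p : ℝ} (hp0 : 0 < p) (hp1 : p ≤ 1)
    {X : Submodule ℂ (Lp ℂ (ENNReal.ofReal p) circleMeasure)} {T : X →ₗ[ℂ] X}
    (hT : IsBoundedCondExp η X T) (hX : hardy (ENNReal.ofReal p) ≤ X) :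
    J w₀ ^ (1 / p - 1) ≤ opNorm T := by
  have hexp : (1 / p - 1) * p = 1 - p := by field_simp
  have hle := S.rpow_le_of_lintegral_transfer_polynomial_le hM hS hp0 hp1 fun q =>
    hT.lintegral_rpow_le hη hη0 hp0 ((HasBoundary.id.polynomial q).memLp _)
      (hX (toLp_mem_hardy _ (polyApprox_polynomial _ q)))
      (S.represents hη (integrable_polynomial q))
  rwa [← hexp, ENNReal.rpow_mul, ENNReal.rpow_le_rpow_iff hp0,
    ENNReal.ofReal_rpow_of_pos (S.jacobian_pos w₀),
    ENNReal.ofReal_le_ofReal_iff (opNorm_nonneg T)] at hle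

theorem IsFiniteBlaschke.exists_condExp {η : ℂ → ℂ} (hB : IsFiniteBlaschke η) (hη : IsInner η)
    (hη0 : η 0 = 0) {p : ℝ} (hp0 : 0 < p) (hp1 : p ≤ 1) :
    ∃ L : Lp ℂ (ENNReal.ofReal p) circleMeasure →ₗ[ℂ] Lp ℂ (ENNReal.ofReal p) circleMeasure,
      (∀ f ∈ hardy (ENNReal.ofReal p), L f ∈ hardy (ENNReal.ofReal p)) ∧
      ∀ (X : Submodule ℂ (Lp ℂ (ENNReal.ofReal p) circleMeasure)) (hX : ∀ f ∈ X, L f ∈ X),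
        IsBoundedCondExp η X (L.restrict hX) ∧ (hardy (ENNReal.ofReal p) ≤ X →
          opNorm (L.restrict hX) = derivSup η ^ (1 / p - 1)) := by
  obtain ⟨J, φ, hφ, hJη⟩ := hB.exists_isLift hη0
  obtain ⟨w₀, hM⟩ := (hφ.exists_sections 1).choose.exists_forall_jacobian_le
  obtain ⟨S, hS⟩ := hφ.exists_sections w₀
  have hsup : derivSup η = J w₀ := by
    simp only [derivSup, hJη]
    exact le_antisymm (ciSup_le hM) (le_ciSup (f := J) ⟨J w₀, Set.forall_mem_range.2 hM⟩ w₀)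
  refine ⟨S.condOp hη hη0 hp0 hp1, S.condOp_mem_hardy hη hη0 hp0 hp1, fun X hX => ?_⟩
  have hbdd := S.isBoundedCondExp_condOp hη hη0 hp0 hp1 hX
  refine ⟨hbdd, fun hle => ?_⟩
  rw [hsup]
  exact le_antisymm (opNorm_le (Real.rpow_nonneg (S.jacobian_pos w₀).le _) fun f =>
      S.norm_condOp_le hη hη0 hp0 hp1 hM f)
    (hbdd.rpow_le_opNorm hη hη0 S hM hS hp0 hp1 hle)

end HardyCondExp

end

theorem theorem1p2 (p : ℝ) (hp0 : 0 < p) (hp1 : p < 1) (η : ℂ → ℂ) (hη : IsInner η)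
    (hη0 : η 0 = 0) :
    ((∃ T : hardy (ENNReal.ofReal p) →ₗ[ℂ] hardy (ENNReal.ofReal p),
        IsBoundedCondExp η (hardy (ENNReal.ofReal p)) T) ↔ IsFiniteBlaschke η) ∧
    (IsFiniteBlaschke η →
      ∃ (T : hardy (ENNReal.ofReal p) →ₗ[ℂ] hardy (ENNReal.ofReal p))
        (S : (⊤ : Submodule ℂ (Lp ℂ (ENNReal.ofReal p) circleMeasure)) →ₗ[ℂ]
          (⊤ : Submodule ℂ (Lp ℂ (ENNReal.ofReal p) circleMeasure))),
        (IsBoundedCondExp η (hardy (ENNReal.ofReal p)) T ∧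
          ∀ T', IsBoundedCondExp η (hardy (ENNReal.ofReal p)) T' → T' = T) ∧
        (IsBoundedCondExp η ⊤ S ∧ ∀ S', IsBoundedCondExp η ⊤ S' → S' = S) ∧
        opNorm T = opNorm S ∧
        opNorm S = derivSup η ^ (1 / p - 1)) := by
  have hP0 : 0 < ENNReal.ofReal p := by simpa using hp0
  refine ⟨⟨fun ⟨T, hT⟩ => hT.isFiniteBlaschke hη hη0 hp0 hp1, fun hB => ?_⟩, fun hB => ?_⟩
  · obtain ⟨L, hL, h⟩ := hB.exists_condExp hη hη0 hp0 hp1.le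
    exact ⟨_, (h _ hL).1⟩
  · obtain ⟨L, hL, h⟩ := hB.exists_condExp hη hη0 hp0 hp1.le
    obtain ⟨hT, hTn⟩ := h _ hL
    obtain ⟨hS, hSn⟩ := h ⊤ fun _ _ => Submodule.mem_top
    exact ⟨_, _, ⟨hT, fun T' hT' => hT'.unique hT hP0 (integrableDense_hardy _)⟩,
      ⟨hS, fun S' hS' => hS'.unique hS hP0 (integrableDense_top ENNReal.ofReal_ne_top)⟩,
      (hTn le_rfl).trans (hSn le_top).symm, hSn le_top⟩
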